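/- Let $d\ge 2$, let $1<p<\frac{2d}{d-1}$, let $p'=\frac{p}{p-1}$ and $q=\frac{d+1}{d-1}\,p'$. Write $\widehat g(\xi)=\int_{\mathbb R^d}e^{-ix\cdot\xi}g(x)\,\mathrm dx$ and $$e^{itD}g(x)=\frac1{(2\pi)^d}\int_{\mathbb R^d}e^{it|\xi|}\,\widehat g(\xi)\,e^{ix\cdot\xi}\,\mathrm d\xi ,$$ in the sense of tempered distributions, and call a tempered distribution $g$ on $\mathbb R^d$ admissible if $\widehat g\in L^p(\mathbb R^d,|\xi|^{p-1}\mathrm d\xi)$ and $e^{itD}g\in L^q(\mathbb R^{1+d})$. An admissible $f$ is called a critical point for the inequality $\|e^{itD}g\|_{L^q(\mathbb R^{1+d})}\le C\,\|\widehat g\|_{L^p(\mathbb R^d,|\xi|^{p-1}\mathrm d\xi)}$ if there is $\lambda\in\mathbb R$ such that, for every admissible $g$, $$\operatorname{Re}\int_{\mathbb R^{1+d}}|e^{itD}f|^{q-2}\,\overline{e^{itD}f}\;e^{itD}g\,\mathrm dt\,\mathrm dx=\lambda\operatorname{Re}\int_{\mathbb R^d}|\widehat f(\xi)|^{p-2}\,\overline{\widehat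 f(\xi)}\,\widehat g(\xi)\,|\xi|^{p-1}\,\mathrm d\xi .$$ An $\mathfrak F$-function is a distribution $f_\star$ with $$\widehat f_\star(\xi)=|\xi|^{-1}\exp(A|\xi|+b\cdot\xi+c),\qquad A,c\in\mathbb C,\ b\in\mathbb C^d,\ |\operatorname{Re} b|<-\operatorname{Re}A .$$ Then every $\mathfrak F$-function is admissible, and it is a critical point for the inequality if and only if $p=2$. -/

import Mathlib

open MeasureTheory

namespace ConeExtension

/-- The frequency weight `|ξ|^(p-1) dξ` on `ℝ^d`. -/
noncomputable def freqMeasure (d : ℕ) (p : ℝ) : Measure (EuclideanSpace ℝ (Fin d)) :=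
  (volume : Measure (EuclideanSpace ℝ (Fin d))).withDensity
    (fun ξ => ENNReal.ofReal (‖ξ‖ ^ (p - 1)))

/-- The integral over space-time `∫∫ e^{i(t|ξ| + x·ξ)} φ(t,x) dt dx` of a Schwartz function `φ`
against the plane wave with frequency `(|ξ|, ξ)` on the cone. -/
noncomputable def coneTransform {d : ℕ} (φ : SchwartzMap (ℝ × EuclideanSpace ℝ (Fin d)) ℂ)
    (ξ : EuclideanSpace ℝ (Fin d)) : ℂ :=
  ∫ z : ℝ × EuclideanSpace ℝ (Fin d),
    Complex.exp (Complex.I * ((z.1 * ‖ξ‖ + inner ℝ z.2 ξ : ℝ) : ℂ)) * φ z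

/-- `IsHalfWave G v`: the function `v(t,x)` on `ℝ^{1+d}` is the half-wave evolution `e^{itD} g` of
the tempered distribution `g` on `ℝ^d` whose Fourier transform `∫ e^{-ix·ξ} g(x) dx` is the
function `G`, that is,
`v(t,x) = (2π)^{-d} ∫ e^{it|ξ|} G(ξ) e^{ix·ξ} dξ`. Since `G` need not be integrable, the identity
is read in the sense of tempered distributions on `ℝ^{1+d}`. -/
def IsHalfWave {d : ℕ} (G : EuclideanSpace ℝ (Fin d) → ℂ)
    (v : ℝ × EuclideanSpace ℝ (Fin d) → ℂ) : Prop :=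
  ∀ φ : SchwartzMap (ℝ × EuclideanSpace ℝ (Fin d)) ℂ,
    ∫ z, v z * φ z = (((2 * Real.pi) ^ d)⁻¹ : ℝ) * ∫ ξ, G ξ * coneTransform φ ξ

/-- `(G, v) = (ĝ, e^{itD} g)` for some `g` with `ĝ ∈ L^p(ℝ^d, |ξ|^(p-1) dξ)` and
`e^{itD} g ∈ L^q(ℝ^{1+d})`. -/
structure IsAdmissible {d : ℕ} (p q : ℝ) (G : EuclideanSpace ℝ (Fin d) → ℂ)
    (v : ℝ × EuclideanSpace ℝ (Fin d) → ℂ) : Prop where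
  memLp_freq : MemLp G (ENNReal.ofReal p) (freqMeasure d p)
  memLp_wave : MemLp v (ENNReal.ofReal q) volume
  isHalfWave : IsHalfWave G v

/-- The Euler-Lagrange equation with multiplier `lam` for `f`, tested against `g`,
where `F = f̂`, `u = e^{itD} f`, `G = ĝ`, `v = e^{itD} g`. -/
def EulerLagrange {d : ℕ} (p q lam : ℝ)
    (F : EuclideanSpace ℝ (Fin d) → ℂ) (u : ℝ × EuclideanSpace ℝ (Fin d) → ℂ)
    (G : EuclideanSpace ℝ (Fin d) → ℂ) (v : ℝ × EuclideanSpace ℝ (Fin d) → ℂ) : Prop :=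
  (∫ z, ((‖u z‖ ^ (q - 2) : ℝ) : ℂ) * (starRingEnd ℂ) (u z) * v z).re =
    lam * (∫ ξ, ((‖F ξ‖ ^ (p - 2) : ℝ) : ℂ) * (starRingEnd ℂ) (F ξ) * G ξ
      * ((‖ξ‖ ^ (p - 1) : ℝ) : ℂ)).re

/-- The distribution `f` with `f̂ = F` is a critical point for the inequality
`‖e^{itD} g‖_{L^q(ℝ^{1+d})} ≤ C ‖ĝ‖_{L^p(|ξ|^(p-1) dξ)}`: both norms of `f` are finite and, for some
multiplier independent of the test distribution `g`, the Euler-Lagrange equation holds for every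
`g` with both norms finite. -/
def IsCriticalPoint {d : ℕ} (p q : ℝ) (F : EuclideanSpace ℝ (Fin d) → ℂ) : Prop :=
  ∃ u, IsAdmissible p q F u ∧
    ∃ lam : ℝ, ∀ G v, IsAdmissible p q G v → EulerLagrange p q lam F u G v

/-- `F` is the Fourier transform of an `𝔉`-function:
`F(ξ) = |ξ|⁻¹ exp(A|ξ| + b·ξ + c)` with `A, c ∈ ℂ`, `b ∈ ℂ^d` and `|Re b| < -Re A`, where
`b·ξ = ∑ b_j ξ_j`. -/
def IsFoschian {d : ℕ} (F : EuclideanSpace ℝ (Fin d) → ℂ) : Prop :=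
  ∃ (A c : ℂ) (b : Fin d → ℂ),
    Real.sqrt (∑ j, (b j).re ^ 2) < -A.re ∧
    ∀ᵐ ξ : EuclideanSpace ℝ (Fin d),
      F ξ = (‖ξ‖ : ℂ)⁻¹ * Complex.exp (A * ‖ξ‖ + ∑ j, b j * (ξ j : ℂ) + c)

end ConeExtension

open scoped ContDiff

namespace ConeExtension

/-! Put `e = (-Re A, Re b)`, which lies in the open forward cone, and let `z₀` collect the imaginary
parts of `A` and `b`. The wave of an 𝔉-function is then a scalar multiple of `coneInt e (z + z₀)`.
Scaling and translating the variable `ξ` gives a first-order equation for `coneInt e` along rays,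
whose solution is a constant times `quad e z ^ (-(d-1)/2)` (`coneInt_sq_mul_quad_pow`,
`norm_coneInt`). Hence `|u|^q` is a multiple of a translate of `|quad e|^(-N)` with `N = q(d-1)/2`.
This is integrable for `N > d`, which is exactly the hypothesis `p < 2d/(d-1)`; on the frequency
side the weight always leaves `|ξ|⁻¹` times an exponential. This gives admissibility.

Necessity of `p = 2`. The Euler-Lagrange equation is tested on `f` and on the function with
transform `(rho e)² f̂`. Differentiating `coneInt` twice in `e` shows that the second wave is `u`
times `(d-1)((d+1) ratio² - mass/quad)`. Dividing out the multiplier leaves one identity between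
moments of `ratio`, `ratio²` and `mass/quad` under `|quad|^(-N)`. Since `quad e z = -mass (z + i n)`
with `n = (e.1, -e.2)`, the complex fields `z·∇ ± i ∂_n` are Euler fields of `quad` and of its
conjugate. Integrating by parts along them yields three linear relations (`exists_moments`), and
these are compatible with the tested identity only if `N = d + 1` (`eq_of_second_moment`), that is
`p = 2`.

Sufficiency. If `N = d + 1`, then `|u|^(q-2)` is a multiple of `1/(quad · conj quad)`, and the
factor `conj u / conj quad` is a multiple of the conjugate of the Cauchy–Szegő kernel of the light
cone (`szego_eq_coneInt`, `dualWave_eq`). The remaining factor `1/quad` is holomorphic in the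
forward tube, so after regularisation its Fourier transform lives in the forward cone
(`hardyFourier_eq_zero`). Pairing such a function with the conjugate Szegő kernel and restricting
the Fourier transform to the cone gives a multiple of `exp (-rho e)`
(`integral_hardyKernel_mul_szego`). This is the Euler-Lagrange equation for `p = 2`, because there
`|ξ|` times the conjugate of `f̂` is an exponential. Since the dual wave is not a Schwartz function,
the distributional definition of the half-wave is first extended to continuous test functions of
sufficient decay (`IsAdmissible.integral_mul`). -/

lemma norm_cexp_sub_cexp_le {a b : ℂ} {M : ℝ} (ha : a.re ≤ M) (hb : b.re ≤ M) :
    ‖Complex.exp a - Complex.exp b‖ ≤ Real.exp M * ‖a - b‖ := by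
  refine (convex_halfSpace_re_le M).norm_image_sub_le_of_norm_hasDerivWithin_le
    (f := Complex.exp) (f' := Complex.exp) (fun x _ => (Complex.hasDerivAt_exp x).hasDerivWithinAt)
    (fun x hx => ?_) hb ha
  rw [Complex.norm_exp]
  exact Real.exp_le_exp.2 hx

/-! ### The wave of an 𝔉-function: integral identities and closed form. -/

section Kernel

variable {E : Type*} [NormedAddCommGroup E] [InnerProductSpace ℝ E]

/-- The Minkowski pairing of `(α, β)` with the point `(|ξ|, ξ)` of the cone. -/
noncomputable def rho (e : ℝ × E) (ξ : E) : ℝ := e.1 * ‖ξ‖ - inner ℝ e.2 ξ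

/-- The phase of the half-wave with frequency `(|ξ|, ξ)` at the point `z`. -/
noncomputable def phase (z : ℝ × E) (ξ : E) : ℝ := z.1 * ‖ξ‖ + inner ℝ z.2 ξ

/-- The complex exponent `-rho e + i phase z`. -/
noncomputable def expo (e z : ℝ × E) (ξ : E) : ℂ :=
  -(rho e ξ : ℂ) + Complex.I * (phase z ξ : ℂ)

lemma continuous_rho (e : ℝ × E) : Continuous (rho e) := by unfold rho; fun_prop

lemma continuous_phase (z : ℝ × E) : Continuous (phase z) := by unfold phase; fun_prop

lemma continuous_expo (e z : ℝ × E) : Continuous (expo e z) := by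
  have h1 := continuous_rho e
  have h2 := continuous_phase z
  unfold expo; fun_prop

lemma rho_lower (e : ℝ × E) (ξ : E) : (e.1 - ‖e.2‖) * ‖ξ‖ ≤ rho e ξ := by
  have := real_inner_le_norm e.2 ξ
  unfold rho; nlinarith

lemma abs_rho_le (e : ℝ × E) (ξ : E) : |rho e ξ| ≤ (|e.1| + ‖e.2‖) * ‖ξ‖ := by
  have h1 := abs_real_inner_le_norm e.2 ξ
  have h2 : |e.1 * ‖ξ‖| = |e.1| * ‖ξ‖ := by rw [abs_mul, abs_norm]
  unfold rho
  calc _ ≤ |e.1 * ‖ξ‖| + |inner ℝ e.2 ξ| := abs_sub _ _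
    _ ≤ _ := by rw [h2, add_mul]; gcongr

lemma abs_phase_le (z : ℝ × E) (ξ : E) : |phase z ξ| ≤ (|z.1| + ‖z.2‖) * ‖ξ‖ := by
  have h1 := abs_real_inner_le_norm z.2 ξ
  have h2 : |z.1 * ‖ξ‖| = |z.1| * ‖ξ‖ := by rw [abs_mul, abs_norm]
  unfold phase
  calc _ ≤ |z.1 * ‖ξ‖| + |inner ℝ z.2 ξ| := abs_add_le _ _
    _ ≤ _ := by rw [h2, add_mul]; gcongr

lemma norm_expo_le (e z : ℝ × E) (ξ : E) :
    ‖expo e z ξ‖ ≤ (|e.1| + ‖e.2‖ + (|z.1| + ‖z.2‖)) * ‖ξ‖ := by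
  unfold expo
  calc _ ≤ ‖-(rho e ξ : ℂ)‖ + ‖Complex.I * (phase z ξ : ℂ)‖ := norm_add_le _ _
    _ = |rho e ξ| + |phase z ξ| := by simp
    _ ≤ _ := by rw [add_mul]; exact add_le_add (abs_rho_le e ξ) (abs_phase_le z ξ)

lemma expo_re (e z : ℝ × E) (ξ : E) : (expo e z ξ).re = -rho e ξ := by simp [expo]

lemma norm_exp_expo (e z : ℝ × E) (ξ : E) :
    ‖Complex.exp (expo e z ξ)‖ = Real.exp (-rho e ξ) := by
  rw [Complex.norm_exp, expo_re]

lemma norm_exp_expo_le (e z : ℝ × E) (ξ : E) :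
    ‖Complex.exp (expo e z ξ)‖ ≤ Real.exp (-((e.1 - ‖e.2‖) * ‖ξ‖)) := by
  rw [norm_exp_expo]
  exact Real.exp_le_exp.2 (neg_le_neg (rho_lower e ξ))

lemma rho_smul (e : ℝ × E) (s : ℝ) (hs : 0 ≤ s) (ξ : E) : rho e (s • ξ) = s * rho e ξ := by
  simp only [rho, norm_smul, Real.norm_eq_abs, abs_of_nonneg hs, inner_smul_right]; ring

lemma phase_smul (z : ℝ × E) (s : ℝ) (hs : 0 ≤ s) (ξ : E) : phase z (s • ξ) = s * phase z ξ := by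
  simp only [phase, norm_smul, Real.norm_eq_abs, abs_of_nonneg hs, inner_smul_right]; ring

lemma expo_smul (e z : ℝ × E) (s : ℝ) (hs : 0 ≤ s) (ξ : E) :
    expo e z (s • ξ) = s * expo e z ξ := by
  simp only [expo, rho_smul e s hs, phase_smul z s hs]; push_cast; ring

lemma rho_smul_left (e : ℝ × E) (s : ℝ) (ξ : E) : rho (s • e) ξ = s * rho e ξ := by
  simp only [rho, Prod.smul_fst, Prod.smul_snd, inner_smul_left, smul_eq_mul,
    RCLike.conj_to_real]; ring

lemma phase_smul_left (e : ℝ × E) (s : ℝ) (ξ : E) : phase (s • e) ξ = s * phase e ξ := by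
  simp only [phase, Prod.smul_fst, Prod.smul_snd, inner_smul_left, smul_eq_mul,
    RCLike.conj_to_real]; ring

lemma rho_add_left (e e' : ℝ × E) (ξ : E) : rho (e + e') ξ = rho e ξ + rho e' ξ := by
  simp only [rho, Prod.fst_add, Prod.snd_add, inner_add_left]; ring

lemma phase_add_left (e e' : ℝ × E) (ξ : E) : phase (e + e') ξ = phase e ξ + phase e' ξ := by
  simp only [phase, Prod.fst_add, Prod.snd_add, inner_add_left]; ring

lemma expo_add_smul (e z e' z' : ℝ × E) (s : ℝ) (ξ : E) :
    expo (e + s • e') (z + s • z') ξ = expo e z ξ + s * expo e' z' ξ := by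
  simp only [expo, rho_add_left, phase_add_left, rho_smul_left, phase_smul_left]; push_cast; ring

/-- The invariant quadratic form `t² - |x|²`. -/
noncomputable def mass (e : ℝ × E) : ℝ := e.1 ^ 2 - ‖e.2‖ ^ 2

/-- The pairing `αt + β·x`. -/
noncomputable def ell (e z : ℝ × E) : ℝ := e.1 * z.1 + inner ℝ e.2 z.2

/-- The form `(α - it)² - (β + ix)²`. -/
noncomputable def quad (e z : ℝ × E) : ℂ :=
  (mass e - mass z : ℝ) - 2 * Complex.I * (ell e z : ℝ)

lemma mass_pos {e : ℝ × E} (he : ‖e.2‖ < e.1) : 0 < mass e := by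
  have := norm_nonneg e.2
  unfold mass; nlinarith

lemma norm_expo_sub_le (e z : ℝ × E) (ξ η : E) :
    ‖expo e z ξ - expo e z η‖ ≤ (|e.1| + ‖e.2‖ + (|z.1| + ‖z.2‖)) * ‖ξ - η‖ := by
  have h0 := abs_norm_sub_norm_le ξ η
  have h1 : |rho e ξ - rho e η| ≤ (|e.1| + ‖e.2‖) * ‖ξ - η‖ := by
    have h2 := abs_real_inner_le_norm e.2 (ξ - η)
    have h3 : rho e ξ - rho e η = e.1 * (‖ξ‖ - ‖η‖) - inner ℝ e.2 (ξ - η) := by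
      simp only [rho, inner_sub_right]; ring
    rw [h3, add_mul]
    refine (abs_sub _ _).trans (add_le_add ?_ h2)
    rw [abs_mul]; gcongr
  have h2 : |phase z ξ - phase z η| ≤ (|z.1| + ‖z.2‖) * ‖ξ - η‖ := by
    have h2 := abs_real_inner_le_norm z.2 (ξ - η)
    have h3 : phase z ξ - phase z η = z.1 * (‖ξ‖ - ‖η‖) + inner ℝ z.2 (ξ - η) := by
      simp only [phase, inner_sub_right]; ring
    rw [h3, add_mul]
    refine (abs_add_le _ _).trans (add_le_add ?_ h2)
    rw [abs_mul]; gcongr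
  have h3 : expo e z ξ - expo e z η = -((rho e ξ - rho e η : ℝ) : ℂ) +
      Complex.I * ((phase z ξ - phase z η : ℝ) : ℂ) := by
    simp only [expo]; push_cast; ring
  rw [h3, add_mul]
  refine (norm_add_le _ _).trans (add_le_add ?_ ?_)
  · rwa [norm_neg, Complex.norm_real]
  · rwa [norm_mul, Complex.norm_I, one_mul, Complex.norm_real]

lemma quad_eq (e z : ℝ × E) : quad e z = ((e.1 : ℂ) - Complex.I * z.1) ^ 2 -
    (((‖e.2‖ ^ 2 - ‖z.2‖ ^ 2 : ℝ) : ℂ) + 2 * Complex.I * (inner ℝ e.2 z.2 : ℝ)) := by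
  simp only [quad, mass, ell]
  push_cast
  linear_combination (-(z.1:ℂ) ^ 2) * Complex.I_sq

lemma fst_sub_I_ne_zero {e : ℝ × E} (he : ‖e.2‖ < e.1) (z : ℝ × E) :
    ((e.1 : ℂ) - Complex.I * z.1) ≠ 0 := by
  intro h
  have := congrArg Complex.re h
  simp at this
  linarith [norm_nonneg e.2]

/-- A zero would satisfy `mass z = mass e > 0`, so `‖z.2‖ < |z.1|`, and also `e.1 |z.1| = |⟨e.2,
z.2⟩| ≤ ‖e.2‖ ‖z.2‖`. These are incompatible with `‖e.2‖ < e.1`. -/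
lemma quad_ne_zero {e : ℝ × E} (he : ‖e.2‖ < e.1) (z : ℝ × E) : quad e z ≠ 0 := by
  intro h
  have h1 := congrArg Complex.re h
  have h2 := congrArg Complex.im h
  simp [quad] at h1 h2
  have h3 := mass_pos he
  have h4 : mass z = z.1 ^ 2 - ‖z.2‖ ^ 2 := rfl
  have h5 := abs_real_inner_le_norm e.2 z.2
  have h6 : |e.1 * z.1| = |(inner ℝ e.2 z.2 : ℝ)| := by
    unfold ell at h2
    rw [eq_neg_of_add_eq_zero_left h2, abs_neg]
  have h0 := norm_nonneg e.2
  have h0' := norm_nonneg z.2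
  rw [abs_mul, abs_of_pos (lt_of_le_of_lt h0 he)] at h6
  have h7 : ‖z.2‖ < |z.1| := by
    apply lt_of_pow_lt_pow_left₀ 2 (abs_nonneg _)
    rw [sq_abs]; linarith
  nlinarith

lemma quad_path (e z : ℝ × E) (s : ℝ) :
    quad e (s • z) = mass e - s ^ 2 * mass z - 2 * Complex.I * (s * ell e z) := by
  simp only [quad, mass, ell, Prod.smul_fst, Prod.smul_snd, norm_smul, inner_smul_right,
    smul_eq_mul, Real.norm_eq_abs, mul_pow, sq_abs]
  push_cast; ring

lemma quad_smul_left (e z : ℝ × E) (s : ℝ) :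
    quad (s • e) z = s ^ 2 * mass e - mass z - 2 * Complex.I * (s * ell e z) := by
  simp only [quad, mass, ell, Prod.smul_fst, Prod.smul_snd, norm_smul, inner_smul_left,
    smul_eq_mul, Real.norm_eq_abs, mul_pow, sq_abs, RCLike.conj_to_real]
  push_cast; ring

variable [FiniteDimensional ℝ E] [MeasurableSpace E] [BorelSpace E]

open Module

/-- In polar coordinates the radial weight is `r^(d-2+m) e^(-σr)`; this is where `d ≥ 2` makes the
singularity `|ξ|⁻¹` harmless. -/
lemma integrable_norm_pow_inv_exp (hd : 2 ≤ finrank ℝ E) (m : ℕ) {σ : ℝ} (hσ : 0 < σ) :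
    Integrable (fun ξ : E => ‖ξ‖⁻¹ * ‖ξ‖ ^ m * Real.exp (-(σ * ‖ξ‖))) := by
  have : Nontrivial E := Module.nontrivial_of_finrank_pos (R := ℝ) (by omega)
  rw [MeasureTheory.integrable_fun_norm_addHaar (volume : Measure E)
    (f := fun r => r⁻¹ * r ^ m * Real.exp (-(σ * r)))]
  have h := integrableOn_rpow_mul_exp_neg_mul_rpow (p := 1) (b := σ)
    (s := ((finrank ℝ E - 2 + m : ℕ) : ℝ))
    (by have : (0:ℝ) ≤ ((finrank ℝ E - 2 + m : ℕ) : ℝ) := Nat.cast_nonneg _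
        linarith) one_pos hσ
  refine h.congr_fun (fun r hr => ?_) measurableSet_Ioi
  have hr : 0 < r := hr
  simp only [Real.rpow_one, Real.rpow_natCast, smul_eq_mul]
  obtain ⟨n, hn⟩ : ∃ n, finrank ℝ E = n + 2 := ⟨finrank ℝ E - 2, by omega⟩
  rw [hn, show n + 2 - 1 = n + 1 by omega, show n + 2 - 2 + m = n + m by omega]
  rw [neg_mul]
  field_simp
  ring

lemma integrable_weight_exp (hd : 2 ≤ finrank ℝ E) {P : E → ℂ} (hP : Continuous P) {m : ℕ} {C : ℝ}
    (hPb : ∀ ξ, ‖P ξ‖ ≤ C * ‖ξ‖ ^ m) {e : ℝ × E} (he : ‖e.2‖ < e.1) (z : ℝ × E) :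
    Integrable (fun ξ : E => (‖ξ‖ : ℂ)⁻¹ * P ξ * Complex.exp (expo e z ξ)) := by
  have h1 := continuous_expo e z
  refine ((integrable_norm_pow_inv_exp hd m (sub_pos.2 he)).const_mul C).mono' ?_ ?_
  · refine (Measurable.mul ?_ ?_).aestronglyMeasurable
    · exact (by fun_prop : Measurable fun ξ : E => (‖ξ‖ : ℂ)⁻¹).mul hP.measurable
    · exact (Complex.continuous_exp.comp h1).measurable
  · refine Filter.Eventually.of_forall fun ξ => ?_
    rw [norm_mul, norm_mul, norm_inv, Complex.norm_real, norm_norm]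
    calc _ ≤ ‖ξ‖⁻¹ * (C * ‖ξ‖ ^ m) * Real.exp (-((e.1 - ‖e.2‖) * ‖ξ‖)) := by
          gcongr
          · exact mul_nonneg (by positivity) ((norm_nonneg _).trans (hPb ξ))
          · exact hPb ξ
          · exact norm_exp_expo_le e z ξ
      _ = _ := by ring

/-- The neighbourhood of `s = 0` is small enough that `s * expo e' z'` uses up at most half of the
gap `e.1 - ‖e.2‖`. The other half dominates, at the cost of one more power of `‖ξ‖`. -/
lemma hasDerivAt_weight_integral (hd : 2 ≤ finrank ℝ E) {P : E → ℂ} (hP : Continuous P) {m : ℕ}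
    {C : ℝ} (hPb : ∀ ξ, ‖P ξ‖ ≤ C * ‖ξ‖ ^ m) {e : ℝ × E} (he : ‖e.2‖ < e.1) (z e' z' : ℝ × E) :
    HasDerivAt (fun s : ℝ => ∫ ξ : E, (‖ξ‖ : ℂ)⁻¹ * P ξ *
        Complex.exp (expo e z ξ + s * expo e' z' ξ))
      (∫ ξ : E, (‖ξ‖ : ℂ)⁻¹ * (P ξ * expo e' z' ξ) * Complex.exp (expo e z ξ)) 0 := by
  set B := |e'.1| + ‖e'.2‖ + (|z'.1| + ‖z'.2‖) with hB
  have hB0 : 0 ≤ B := by positivity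
  set σ := e.1 - ‖e.2‖ with hσ
  have hσ0 : 0 < σ := sub_pos.2 he
  have hc1 := continuous_expo e z
  have hc2 := continuous_expo e' z'
  have hmi : Measurable fun ξ : E => (‖ξ‖ : ℂ)⁻¹ := by fun_prop
  have key := hasDerivAt_integral_of_dominated_loc_of_deriv_le (μ := (volume : Measure E)) (𝕜 := ℝ)
    (F := fun s ξ => (‖ξ‖ : ℂ)⁻¹ * P ξ * Complex.exp (expo e z ξ + s * expo e' z' ξ))
    (F' := fun s ξ => (‖ξ‖ : ℂ)⁻¹ * (P ξ * expo e' z' ξ) *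
      Complex.exp (expo e z ξ + s * expo e' z' ξ))
    (x₀ := 0) (s := Metric.ball 0 (σ / (2 * (B + 1))))
    (bound := fun ξ => C * B * (‖ξ‖⁻¹ * ‖ξ‖ ^ (m + 1) * Real.exp (-(σ / 2 * ‖ξ‖))))
    (Metric.ball_mem_nhds 0 (by positivity)) ?_ ?_ ?_ ?_ ?_ ?_
  · have := key.2
    simpa using this
  · refine Filter.Eventually.of_forall fun s => ?_
    refine ((hmi.mul hP.measurable).mul ?_).aestronglyMeasurable
    exact (by fun_prop : Continuous fun ξ =>
      Complex.exp (expo e z ξ + s * expo e' z' ξ)).measurable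
  · simpa using integrable_weight_exp hd hP hPb he z
  · refine ((hmi.mul (hP.mul hc2).measurable).mul ?_).aestronglyMeasurable
    exact (by fun_prop : Continuous fun ξ =>
      Complex.exp (expo e z ξ + (0:ℝ) * expo e' z' ξ)).measurable
  · refine Filter.Eventually.of_forall fun ξ s hs => ?_
    rw [mem_ball_zero_iff, Real.norm_eq_abs, lt_div_iff₀ (by positivity)] at hs
    have hn := norm_expo_le e' z' ξ
    rw [← hB] at hn
    have hexp : ‖Complex.exp (expo e z ξ + s * expo e' z' ξ)‖ ≤ Real.exp (-(σ / 2 * ‖ξ‖)) := by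
      rw [Complex.norm_exp]
      apply Real.exp_le_exp.2
      have h1 : (expo e z ξ).re ≤ -(σ * ‖ξ‖) := by
        rw [expo_re]; exact neg_le_neg (rho_lower e ξ)
      have h2 : ((s : ℂ) * expo e' z' ξ).re ≤ |s| * (B * ‖ξ‖) := by
        refine (Complex.re_le_norm _).trans ?_
        rw [norm_mul, Complex.norm_real, Real.norm_eq_abs]
        gcongr
      have h3 : |s| * (B * ‖ξ‖) ≤ σ / 2 * ‖ξ‖ := by
        rw [← mul_assoc]
        gcongr
        nlinarith [abs_nonneg s]
      rw [Complex.add_re]; linarith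
    rw [norm_mul, norm_mul, norm_mul, norm_inv, Complex.norm_real, norm_norm]
    have hC : 0 ≤ C * ‖ξ‖ ^ m := (norm_nonneg _).trans (hPb ξ)
    calc _ ≤ ‖ξ‖⁻¹ * ((C * ‖ξ‖ ^ m) * (B * ‖ξ‖)) * Real.exp (-(σ / 2 * ‖ξ‖)) := by
          gcongr
          exact hPb ξ
      _ = _ := by ring
  · exact (integrable_norm_pow_inv_exp hd (m + 1) (half_pos hσ0)).const_mul _
  · refine Filter.Eventually.of_forall fun ξ s _ => ?_
    have h1 : HasDerivAt (fun s : ℝ => expo e z ξ + (s : ℂ) * expo e' z' ξ) (expo e' z' ξ) s := by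
      have := ((Complex.ofRealCLM.hasDerivAt (x := s)).mul_const (expo e' z' ξ)).const_add
        (expo e z ξ)
      simpa using this
    have h2 := (h1.cexp).const_mul ((‖ξ‖ : ℂ)⁻¹ * P ξ)
    exact h2.congr_deriv (by ring)

/-- The half-wave (up to normalisation) whose Fourier transform is `|ξ|⁻¹ exp (-rho e)`. -/
noncomputable def coneInt (e z : ℝ × E) : ℂ :=
  ∫ ξ : E, (‖ξ‖ : ℂ)⁻¹ * Complex.exp (expo e z ξ)

lemma hasDerivAt_coneInt (hd : 2 ≤ finrank ℝ E) {e : ℝ × E} (he : ‖e.2‖ < e.1) (z e' z' : ℝ × E) :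
    HasDerivAt (fun s : ℝ => coneInt (e + s • e') (z + s • z'))
      (∫ ξ : E, (‖ξ‖ : ℂ)⁻¹ * expo e' z' ξ * Complex.exp (expo e z ξ)) 0 := by
  have := hasDerivAt_weight_integral hd (P := fun _ => 1) continuous_const (m := 0) (C := 1)
    (by simp) he z e' z'
  simpa [coneInt, expo_add_smul] using this

/-- Scaling `e` and `z` together by `1 + s` amounts to scaling `ξ`, so `coneInt` is homogeneous of
degree `1 - d` in `(e, z)`. This is Euler's relation, obtained by differentiating at `s = 0`. -/
lemma coneInt_dilation (hd : 2 ≤ finrank ℝ E) {e : ℝ × E} (he : ‖e.2‖ < e.1) (z : ℝ × E) :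
    ∫ ξ : E, (‖ξ‖ : ℂ)⁻¹ * expo e z ξ * Complex.exp (expo e z ξ) =
      -((finrank ℝ E : ℂ) - 1) * coneInt e z := by
  obtain ⟨n, hn⟩ : ∃ n, finrank ℝ E = n + 1 := ⟨finrank ℝ E - 1, by omega⟩
  have h1 := hasDerivAt_coneInt hd he z e z
  have h2 : (fun s : ℝ => coneInt (e + s • e) (z + s • z)) =ᶠ[nhds 0]
      fun s : ℝ => (((1 + s) ^ n)⁻¹ : ℝ) * coneInt e z := by
    filter_upwards [lt_mem_nhds (show (-1 : ℝ) < 0 by norm_num)] with s hs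
    have hs : 0 < 1 + s := by linarith
    have := Measure.integral_comp_smul (volume : Measure E)
      (fun ξ : E => (‖ξ‖ : ℂ)⁻¹ * Complex.exp (expo e z ξ)) (1 + s)
    simp only [expo_smul e z (1 + s) hs.le, norm_smul, Real.norm_eq_abs, abs_of_pos hs] at this
    have h3 : coneInt (e + s • e) (z + s • z) = ((1 + s : ℝ) : ℂ) *
        ∫ ξ : E, (((1 + s) * ‖ξ‖ : ℝ) : ℂ)⁻¹ * Complex.exp (((1 + s : ℝ) : ℂ) * expo e z ξ) := by
      rw [← integral_const_mul]
      unfold coneInt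
      congr 1
      ext ξ
      rw [expo_add_smul]
      have : ((1 + s : ℝ) : ℂ) ≠ 0 := by exact_mod_cast hs.ne'
      rw [Complex.ofReal_mul, mul_inv, ← mul_assoc, ← mul_assoc, mul_inv_cancel₀ this, one_mul]
      congr 2
      push_cast; ring
    rw [h3, this, hn, abs_of_pos (by positivity), Complex.real_smul, ← mul_assoc]
    congr 1
    rw [← Complex.ofReal_mul]
    congr 1
    field_simp
    rw [pow_succ]; ring
  have h3 : HasDerivAt (fun s : ℝ => (((1 + s) ^ n)⁻¹ : ℝ) * coneInt e z)
      (-(n : ℂ) * coneInt e z) 0 := by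
    have h4 : HasDerivAt (fun s : ℝ => ((1 + s) ^ n)⁻¹) (-(n : ℝ)) 0 := by
      have := (((hasDerivAt_id (0:ℝ)).const_add 1).fun_pow n).fun_inv (by simp)
      simpa using this
    have := (h4.ofReal_comp).mul_const (coneInt e z)
    simpa using this
  have h4 := (h1.congr_of_eventuallyEq h2.symm).unique h3
  rw [h4, hn]; push_cast; ring

lemma integrable_exp_expo (hd : 2 ≤ finrank ℝ E) {e : ℝ × E} (he : ‖e.2‖ < e.1) (z : ℝ × E) :
    Integrable (fun ξ : E => Complex.exp (expo e z ξ)) := by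
  have : Nontrivial E := Module.nontrivial_of_finrank_pos (R := ℝ) (by omega)
  have := integrable_weight_exp hd (P := fun ξ : E => (‖ξ‖ : ℂ)) (by fun_prop) (m := 1) (C := 1)
    (by simp) he z
  refine this.congr ?_
  filter_upwards [Measure.ae_ne volume (0:E)] with ξ hξ
  rw [inv_mul_cancel₀ (by simpa using hξ), one_mul]

/-- The integral of the derivative of `exp (expo e z)` in the direction `h` vanishes. -/
lemma coneInt_translation (hd : 2 ≤ finrank ℝ E) {e : ℝ × E} (he : ‖e.2‖ < e.1) (z : ℝ × E)
    (h : E) :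
    ((e.1 : ℂ) - Complex.I * z.1) *
        ∫ ξ : E, (‖ξ‖ : ℂ)⁻¹ * (inner ℝ ξ h : ℝ) * Complex.exp (expo e z ξ) =
      ((inner ℝ e.2 h : ℝ) + Complex.I * (inner ℝ z.2 h : ℝ)) *
        ∫ ξ : E, Complex.exp (expo e z ξ) := by
  have : Nontrivial E := Module.nontrivial_of_finrank_pos (R := ℝ) (by omega)
  set B := |e.1| + ‖e.2‖ + (|z.1| + ‖z.2‖) with hB
  have hB0 : 0 ≤ B := by positivity
  set σ := e.1 - ‖e.2‖ with hσ
  have hσ0 : 0 < σ := sub_pos.2 he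
  have hc1 := continuous_expo e z
  have hmi : Measurable fun ξ : E => (‖ξ‖ : ℂ)⁻¹ := by fun_prop
  have hint : Integrable (fun ξ : E => Real.exp (-(σ * ‖ξ‖))) := by
    have := (integrable_norm_pow_inv_exp hd 1 hσ0)
    refine this.congr ?_
    filter_upwards [Measure.ae_ne volume (0:E)] with ξ hξ
    rw [pow_one, inv_mul_cancel₀ (by simpa using hξ), one_mul]
  -- The norm is not differentiable where `ξ + s • h = 0`, so for a given `ξ` the derivative may
  -- fail at some `s`. The Lipschitz form of the theorem only needs the derivative at `s = 0`, which
  -- exists for every `ξ ≠ 0`.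
  have key := hasDerivAt_integral_of_dominated_loc_of_lip (μ := (volume : Measure E)) (𝕜 := ℝ)
    (F := fun s ξ => Complex.exp (expo e z (ξ + s • h)))
    (F' := fun ξ => (-((e.1 : ℂ) - Complex.I * z.1) * ((‖ξ‖ : ℂ)⁻¹ * (inner ℝ ξ h : ℝ)) +
      ((inner ℝ e.2 h : ℝ) + Complex.I * (inner ℝ z.2 h : ℝ))) * Complex.exp (expo e z ξ))
    (x₀ := 0) (s := Metric.ball 0 1)
    (bound := fun ξ => Real.exp (σ * ‖h‖) * B * ‖h‖ * Real.exp (-(σ * ‖ξ‖)))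
    (Metric.ball_mem_nhds 0 one_pos) ?_ ?_ ?_ ?_ ?_ ?_
  · have h1 : (fun s : ℝ => ∫ ξ : E, Complex.exp (expo e z (ξ + s • h))) =
        fun _ => ∫ ξ : E, Complex.exp (expo e z ξ) := by
      ext s
      exact integral_add_right_eq_self (fun ξ => Complex.exp (expo e z ξ)) (s • h)
    have h2 := key.2
    rw [h1] at h2
    have h3 := h2.unique (hasDerivAt_const _ _)
    have i1 := integrable_weight_exp hd (P := fun ξ : E => ((inner ℝ ξ h : ℝ) : ℂ)) (by fun_prop)
      (m := 1) (C := ‖h‖) (fun ξ => by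
        rw [Complex.norm_real, pow_one, mul_comm]; exact norm_inner_le_norm ξ h) he z
    have i2 := integrable_exp_expo hd he z
    have h4 : (fun ξ : E => (-((e.1 : ℂ) - Complex.I * z.1) * ((‖ξ‖ : ℂ)⁻¹ * (inner ℝ ξ h : ℝ)) +
        ((inner ℝ e.2 h : ℝ) + Complex.I * (inner ℝ z.2 h : ℝ))) * Complex.exp (expo e z ξ)) =
        fun ξ => -((e.1 : ℂ) - Complex.I * z.1) *
          ((‖ξ‖ : ℂ)⁻¹ * (inner ℝ ξ h : ℝ) * Complex.exp (expo e z ξ)) +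
        ((inner ℝ e.2 h : ℝ) + Complex.I * (inner ℝ z.2 h : ℝ)) * Complex.exp (expo e z ξ) := by
      ext ξ; ring
    rw [h4, integral_add (i1.const_mul _) (i2.const_mul _), integral_const_mul,
      integral_const_mul] at h3
    linear_combination -h3
  · refine Filter.Eventually.of_forall fun s => Continuous.aestronglyMeasurable ?_
    fun_prop
  · simpa using integrable_exp_expo hd he z
  · refine Measurable.aestronglyMeasurable (Measurable.mul ?_ (by fun_prop))
    refine Measurable.add_const ((hmi.mul ?_).const_mul _) _
    exact (by fun_prop : Continuous fun ξ : E => ((inner ℝ ξ h : ℝ) : ℂ)).measurable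
  · refine Filter.Eventually.of_forall fun ξ => LipschitzOnWith.of_dist_le_mul fun s hs s' hs' => ?_
    have hre : ∀ s ∈ Metric.ball (0:ℝ) 1,
        (expo e z (ξ + s • h)).re ≤ σ * ‖h‖ + -(σ * ‖ξ‖) := by
      intro s hs
      rw [mem_ball_zero_iff, Real.norm_eq_abs] at hs
      have h1 := rho_lower e (ξ + s • h)
      have h2 : ‖ξ‖ ≤ ‖ξ + s • h‖ + ‖h‖ := by
        calc ‖ξ‖ = ‖(ξ + s • h) - s • h‖ := by simp
          _ ≤ ‖ξ + s • h‖ + ‖s • h‖ := norm_sub_le _ _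
          _ ≤ _ := by
            rw [norm_smul, Real.norm_eq_abs]
            have := norm_nonneg h
            gcongr; nlinarith
      rw [expo_re]
      nlinarith
    rw [dist_eq_norm, Real.coe_nnabs, abs_of_nonneg (by positivity), Real.dist_eq]
    refine (norm_cexp_sub_cexp_le (hre s hs) (hre s' hs')).trans ?_
    rw [Real.exp_add]
    calc _ ≤ Real.exp (σ * ‖h‖) * Real.exp (-(σ * ‖ξ‖)) *
          (B * ‖(ξ + s • h) - (ξ + s' • h)‖) := by
          gcongr; exact norm_expo_sub_le e z _ _
      _ = _ := by
          rw [add_sub_add_left_eq_sub, ← sub_smul, norm_smul, Real.norm_eq_abs]; ring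
  · exact hint.const_mul _
  · filter_upwards [Measure.ae_ne volume (0:E)] with ξ hξ
    have h1 : HasDerivAt (fun s : ℝ => ξ + s • h) h 0 := by
      simpa using ((hasDerivAt_id (0:ℝ)).smul_const h).const_add ξ
    have h2 : HasDerivAt (fun s : ℝ => ‖ξ + s • h‖) (‖ξ‖⁻¹ * inner ℝ ξ h) 0 := by
      have h3 := h1.norm_sq.sqrt (by simpa using hξ)
      simp only [Real.sqrt_sq (norm_nonneg _)] at h3
      refine h3.congr_deriv ?_
      simp only [zero_smul, add_zero]
      have : ‖ξ‖ ≠ 0 := by simpa using hξ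
      field_simp
    have h3 : ∀ y : E, HasDerivAt (fun s : ℝ => (inner ℝ y (ξ + s • h) : ℝ)) (inner ℝ y h) 0 := by
      intro y
      simpa using (hasDerivAt_const (0:ℝ) y).inner ℝ h1
    have h4 : HasDerivAt (fun s : ℝ => expo e z (ξ + s • h))
        (-((e.1 * (‖ξ‖⁻¹ * inner ℝ ξ h) - inner ℝ e.2 h : ℝ) : ℂ) +
          Complex.I * ((z.1 * (‖ξ‖⁻¹ * inner ℝ ξ h) + inner ℝ z.2 h : ℝ) : ℂ)) 0 := by
      unfold expo rho phase
      exact ((((h2.const_mul e.1).sub (h3 e.2)).ofReal_comp).neg).add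
        ((((h2.const_mul z.1).add (h3 z.2)).ofReal_comp).const_mul Complex.I)
    refine h4.cexp.congr_deriv ?_
    simp only [zero_smul, add_zero]
    push_cast
    ring

/-- Pointwise, `expo e' z'` splits into a multiple of `‖ξ‖`, which cancels the weight `‖ξ‖⁻¹`, and
terms linear in `ξ`, which `coneInt_translation` evaluates. -/
lemma coneInt_linear (hd : 2 ≤ finrank ℝ E) {e : ℝ × E} (he : ‖e.2‖ < e.1) (z e' z' : ℝ × E) :
    ∫ ξ : E, (‖ξ‖ : ℂ)⁻¹ * expo e' z' ξ * Complex.exp (expo e z ξ) =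
      -((e'.1 : ℂ) - Complex.I * z'.1) * (∫ ξ : E, Complex.exp (expo e z ξ)) +
      ((∫ ξ : E, (‖ξ‖ : ℂ)⁻¹ * (inner ℝ ξ e'.2 : ℝ) * Complex.exp (expo e z ξ)) +
        Complex.I * ∫ ξ : E, (‖ξ‖ : ℂ)⁻¹ * (inner ℝ ξ z'.2 : ℝ) * Complex.exp (expo e z ξ)) := by
  have : Nontrivial E := Module.nontrivial_of_finrank_pos (R := ℝ) (by omega)
  have i1 : ∀ h : E, Integrable fun ξ : E =>
      (‖ξ‖ : ℂ)⁻¹ * (inner ℝ ξ h : ℝ) * Complex.exp (expo e z ξ) := fun h =>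
    integrable_weight_exp hd (P := fun ξ : E => ((inner ℝ ξ h : ℝ) : ℂ)) (by fun_prop)
      (m := 1) (C := ‖h‖) (fun ξ => by
        rw [Complex.norm_real, pow_one, mul_comm]; exact norm_inner_le_norm ξ h) he z
  have i2 := integrable_exp_expo hd he z
  rw [← integral_const_mul, ← integral_const_mul, ← integral_add (i1 _) ((i1 _).const_mul _),
    ← integral_add (i2.const_mul _)]
  · refine integral_congr_ae ?_
    filter_upwards [Measure.ae_ne volume (0:E)] with ξ hξ
    have h0 : (‖ξ‖ : ℂ) ≠ 0 := by simpa using hξ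
    simp only [expo, rho, phase, real_inner_comm ξ]
    push_cast
    field_simp
    ring
  · exact (i1 _).add ((i1 _).const_mul _)

/-- Euler's relation from `coneInt_dilation`, expanded by `coneInt_linear`, together with the
translation identities in the directions `e.2` and `z.2`, is a linear system. Eliminating the two
integrals that are linear in `ξ` produces the factor `quad`. -/
lemma quad_mul_integral_exp (hd : 2 ≤ finrank ℝ E) {e : ℝ × E} (he : ‖e.2‖ < e.1) (z : ℝ × E) :
    quad e z * ∫ ξ : E, Complex.exp (expo e z ξ) =
      ((finrank ℝ E : ℂ) - 1) * ((e.1 : ℂ) - Complex.I * z.1) * coneInt e z := by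
  have h1 := coneInt_linear hd he z e z
  rw [coneInt_dilation hd he z] at h1
  have h2 := coneInt_translation hd he z e.2
  have h3 := coneInt_translation hd he z z.2
  rw [quad_eq]
  rw [real_inner_self_eq_norm_sq] at h2 h3
  rw [real_inner_comm e.2 z.2] at h2
  push_cast at h2 h3 ⊢
  linear_combination ((e.1 : ℂ) - Complex.I * z.1) * h1 + h2 + Complex.I * h3 +
    (‖z.2‖ ^ 2 * (∫ ξ : E, Complex.exp (expo e z ξ))) * Complex.I_sq

lemma quad_mul_integral_expo (hd : 2 ≤ finrank ℝ E) {e : ℝ × E} (he : ‖e.2‖ < e.1)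
    (z e' z' : ℝ × E) :
    quad e z * ∫ ξ : E, (‖ξ‖ : ℂ)⁻¹ * expo e' z' ξ * Complex.exp (expo e z ξ) =
      -((finrank ℝ E : ℂ) - 1) * (((e'.1 : ℂ) - Complex.I * z'.1) * ((e.1 : ℂ) - Complex.I * z.1) -
        ((inner ℝ e'.2 e.2 : ℝ) - (inner ℝ z'.2 z.2 : ℝ) +
          Complex.I * ((inner ℝ z'.2 e.2 : ℝ) + (inner ℝ e'.2 z.2 : ℝ)))) * coneInt e z := by
  have h1 := coneInt_linear hd he z e' z'
  have h2 := coneInt_translation hd he z e'.2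
  have h3 := coneInt_translation hd he z z'.2
  have h4 := quad_mul_integral_exp hd he z
  rw [h1]
  apply mul_left_cancel₀ (fst_sub_I_ne_zero he z)
  rw [real_inner_comm e'.2 e.2, real_inner_comm e'.2 z.2] at h2
  rw [real_inner_comm z'.2 e.2, real_inner_comm z'.2 z.2] at h3
  linear_combination quad e z * h2 + Complex.I * quad e z * h3 +
    ((inner ℝ e'.2 e.2 : ℝ) - (inner ℝ z'.2 z.2 : ℝ) +
          Complex.I * ((inner ℝ z'.2 e.2 : ℝ) + (inner ℝ e'.2 z.2 : ℝ)) -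
      ((e'.1 : ℂ) - Complex.I * z'.1) * ((e.1 : ℂ) - Complex.I * z.1)) * h4 +
    ((inner ℝ z'.2 z.2 : ℝ) * (quad e z * ∫ ξ : E, Complex.exp (expo e z ξ))) * Complex.I_sq

/-- Along the ray `s • z`, with `2B` the derivative of `quad`, `quad_mul_integral_expo` says that
`quad` times the derivative of `coneInt` is `-(d-1) B coneInt`. Thus `coneInt` behaves like
`quad^(-(d-1)/2)`; squaring avoids choosing a branch of the half-integral power. -/
lemma coneInt_sq_mul_quad_pow (hd : 2 ≤ finrank ℝ E) {e : ℝ × E} (he : ‖e.2‖ < e.1)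
    (z : ℝ × E) :
    coneInt e z ^ 2 * quad e z ^ (finrank ℝ E - 1) =
      coneInt e 0 ^ 2 * (mass e : ℂ) ^ (finrank ℝ E - 1) := by
  obtain ⟨n, hn⟩ : ∃ n, finrank ℝ E = n + 2 := ⟨finrank ℝ E - 2, by omega⟩
  rw [show finrank ℝ E - 1 = n + 1 by omega]
  have key : ∀ s : ℝ, HasDerivAt
      (fun s : ℝ => coneInt e (s • z) ^ 2 * quad e (s • z) ^ (n + 1)) 0 s := by
    intro s
    set B : ℂ := -Complex.I * ell e z - s * mass z with hB
    set D := ∫ ξ : E, (‖ξ‖ : ℂ)⁻¹ * expo 0 z ξ * Complex.exp (expo e (s • z) ξ) with hD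
    have h1 : HasDerivAt (fun s : ℝ => coneInt e (s • z)) D s := by
      have h := hasDerivAt_coneInt hd he (s • z) 0 z
      have h' := HasDerivAt.comp_sub_const s s (f := fun h : ℝ => coneInt (e + h • 0) (s • z + h • z))
        (f' := D) (by rw [sub_self]; exact h)
      have h'' : (fun x : ℝ => coneInt (e + (x - s) • (0 : ℝ × E)) (s • z + (x - s) • z)) =
          fun x : ℝ => coneInt e (x • z) := by
        ext x
        rw [smul_zero, add_zero, ← add_smul, add_sub_cancel]
      rwa [h''] at h'
    have h2 : quad e (s • z) * D = -((n : ℂ) + 1) * B * coneInt e (s • z) := by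
      have := quad_mul_integral_expo hd he (s • z) 0 z
      rw [← hD, hn] at this
      rw [this]
      simp only [hB, mass, ell, Prod.smul_fst, Prod.smul_snd, inner_smul_right, smul_eq_mul,
        Prod.fst_zero, Prod.snd_zero, inner_zero_left, real_inner_self_eq_norm_sq,
        real_inner_comm e.2 z.2]
      push_cast
      linear_combination (-(n + 1) * s * z.1 ^ 2 * coneInt e (s • z)) * Complex.I_sq
    have h3 : HasDerivAt (fun s : ℝ => quad e (s • z)) (2 * B) s := by
      simp only [quad_path]
      have h4 : HasDerivAt (fun s : ℝ => (s : ℂ)) 1 s := by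
        simpa using (hasDerivAt_id s).ofReal_comp
      refine ((((h4.fun_pow 2).mul_const (mass z : ℂ)).const_sub (mass e : ℂ)).fun_sub
        ((h4.mul_const (ell e z : ℂ)).const_mul (2 * Complex.I))).congr_deriv ?_
      simp only [hB]; push_cast; ring
    refine ((h1.fun_pow 2).fun_mul (h3.fun_pow (n + 1))).congr_deriv ?_
    simp only [add_tsub_cancel_right]
    push_cast
    linear_combination 2 * coneInt e (s • z) * quad e (s • z) ^ n * h2
  have h := is_const_of_deriv_eq_zero (fun s => (key s).differentiableAt)
    (fun s => (key s).deriv) 1 0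
  have h0 : quad e 0 = mass e := by simp [quad, mass, ell]
  simpa [h0] using h

lemma coneInt_zero (e : ℝ × E) :
    coneInt e 0 = ((∫ ξ : E, ‖ξ‖⁻¹ * Real.exp (-rho e ξ) : ℝ) : ℂ) := by
  rw [← integral_complex_ofReal]
  unfold coneInt
  congr 1
  ext ξ
  simp [expo, phase]

lemma integrable_inv_mul_exp_neg_rho (hd : 2 ≤ finrank ℝ E) {e : ℝ × E} (he : ‖e.2‖ < e.1) :
    Integrable fun ξ : E => ‖ξ‖⁻¹ * Real.exp (-rho e ξ) := by
  have := (integrable_weight_exp hd (P := fun _ => 1) continuous_const (m := 0) (C := 1)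
    (by simp) he 0).norm
  refine this.congr (Filter.Eventually.of_forall fun ξ => ?_)
  simp [norm_exp_expo]

lemma integral_inv_mul_exp_neg_rho_pos (hd : 2 ≤ finrank ℝ E) {e : ℝ × E} (he : ‖e.2‖ < e.1) :
    0 < ∫ ξ : E, ‖ξ‖⁻¹ * Real.exp (-rho e ξ) := by
  have : Nontrivial E := Module.nontrivial_of_finrank_pos (R := ℝ) (by omega)
  rw [integral_pos_iff_support_of_nonneg (fun ξ => by positivity)
    (integrable_inv_mul_exp_neg_rho hd he)]
  have : Function.support (fun ξ : E => ‖ξ‖⁻¹ * Real.exp (-rho e ξ)) = {0}ᶜ := by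
    ext ξ; simp [Real.exp_ne_zero]
  rw [this]
  exact isOpen_compl_singleton.measure_pos _ (by
    obtain ⟨x, hx⟩ := exists_ne (0 : E); exact ⟨x, hx⟩)

/-- The explicit modulus of the half-wave with data `|ξ|⁻¹ exp (-rho e)`. -/
lemma norm_coneInt (hd : 2 ≤ finrank ℝ E) {e : ℝ × E} (he : ‖e.2‖ < e.1) :
    ∃ C : ℝ, 0 < C ∧ ∀ z, ‖coneInt e z‖ = C * ‖quad e z‖ ^ (-(((finrank ℝ E : ℝ) - 1) / 2)) := by
  have hm := mass_pos he
  have hJ := integral_inv_mul_exp_neg_rho_pos hd he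
  set J := ∫ ξ : E, ‖ξ‖⁻¹ * Real.exp (-rho e ξ) with hJdef
  refine ⟨J * mass e ^ (((finrank ℝ E : ℝ) - 1) / 2), by positivity, fun z => ?_⟩
  have h1 := congrArg norm (coneInt_sq_mul_quad_pow hd he z)
  rw [coneInt_zero, ← hJdef] at h1
  simp only [norm_mul, norm_pow, Complex.norm_real, Real.norm_eq_abs, abs_of_pos hJ,
    abs_of_pos hm] at h1
  have hq : 0 < ‖quad e z‖ := norm_pos_iff.2 (quad_ne_zero he z)
  obtain ⟨n, hn⟩ : ∃ n, finrank ℝ E = n + 1 := ⟨finrank ℝ E - 1, by omega⟩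
  rw [hn, add_tsub_cancel_right] at h1
  rw [hn]
  push_cast
  have h2 : ∀ x : ℝ, 0 < x → (x ^ ((n : ℝ) / 2)) ^ 2 = x ^ n := by
    intro x hx
    rw [← Real.rpow_natCast, ← Real.rpow_mul hx.le, ← Real.rpow_natCast x n]
    congr 1; push_cast; ring
  rw [Real.rpow_neg hq.le, add_sub_cancel_right]
  rw [← div_eq_mul_inv, eq_div_iff (by positivity)]
  rw [← sq_eq_sq₀ (by positivity) (by positivity), mul_pow, mul_pow, h2 _ hq, h2 _ hm, h1]

/-- The half-wave with data `|ξ|⁻¹ (rho e) exp (-rho e)`. -/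
lemma integral_rho_mul (hd : 2 ≤ finrank ℝ E) {e : ℝ × E} (he : ‖e.2‖ < e.1) (z : ℝ × E)
    {s : ℝ} (hs : 0 < s) :
    ∫ ξ : E, (‖ξ‖ : ℂ)⁻¹ * (rho e ξ : ℂ) * Complex.exp (expo (s • e) z ξ) =
      ((finrank ℝ E : ℂ) - 1) * ((s * mass e - Complex.I * ell e z) / quad (s • e) z) *
        coneInt (s • e) z := by
  have he' : ‖(s • e).2‖ < (s • e).1 := by
    simp only [Prod.smul_fst, Prod.smul_snd, norm_smul, Real.norm_eq_abs, abs_of_pos hs,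
      smul_eq_mul]
    gcongr
  have h1 := quad_mul_integral_expo hd he' z e 0
  have hq := quad_ne_zero he' z
  have h2 : ∫ ξ : E, (‖ξ‖ : ℂ)⁻¹ * expo e 0 ξ * Complex.exp (expo (s • e) z ξ) =
      -∫ ξ : E, (‖ξ‖ : ℂ)⁻¹ * (rho e ξ : ℂ) * Complex.exp (expo (s • e) z ξ) := by
    rw [← integral_neg]
    congr 1; ext ξ
    simp [expo, phase]
  rw [h2] at h1
  apply mul_left_cancel₀ hq
  have h3 := mul_div_cancel₀ (s * mass e - Complex.I * ell e z : ℂ) hq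
  simp only [Prod.smul_fst, Prod.smul_snd, inner_smul_right, smul_eq_mul, Prod.fst_zero,
    Prod.snd_zero, inner_zero_left, real_inner_self_eq_norm_sq] at h1
  generalize (s * mass e - Complex.I * ell e z : ℂ) / quad (s • e) z = w at h3 ⊢
  simp only [mass, ell] at h3
  push_cast at h1 h3
  linear_combination -h1 - ((finrank ℝ E : ℂ) - 1) * coneInt (s • e) z * h3

/-- The half-wave with data `|ξ|⁻¹ (rho e)² exp (-rho e)`. -/
lemma integral_rho_sq_mul (hd : 2 ≤ finrank ℝ E) {e : ℝ × E} (he : ‖e.2‖ < e.1) (z : ℝ × E) :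
    ∫ ξ : E, (‖ξ‖ : ℂ)⁻¹ * (rho e ξ : ℂ) ^ 2 * Complex.exp (expo e z ξ) =
      ((finrank ℝ E : ℂ) - 1) * (((finrank ℝ E : ℂ) + 1) *
        ((mass e - Complex.I * ell e z) / quad e z) ^ 2 - mass e / quad e z) * coneInt e z := by
  have hq := quad_ne_zero he z
  have hI : HasDerivAt (fun s : ℝ => coneInt (e + s • e) z) (-((finrank ℝ E : ℂ) - 1) *
      ((mass e - Complex.I * ell e z) / quad e z) * coneInt e z) 0 := by
    have h := hasDerivAt_coneInt hd he z e 0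
    have h1 : ∫ ξ : E, (‖ξ‖ : ℂ)⁻¹ * expo e 0 ξ * Complex.exp (expo e z ξ) =
        -∫ ξ : E, (‖ξ‖ : ℂ)⁻¹ * (rho e ξ : ℂ) * Complex.exp (expo e z ξ) := by
      rw [← integral_neg]
      congr 1; ext ξ
      simp [expo, phase]
    have h2 := integral_rho_mul hd he z one_pos
    simp only [one_smul, Complex.ofReal_one, one_mul] at h2
    rw [h1, h2] at h
    simp only [smul_zero, add_zero] at h
    exact h.congr_deriv (by ring)
  have hQ : HasDerivAt (fun s : ℝ => quad ((1 + s) • e) z)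
      (2 * (mass e - Complex.I * ell e z)) 0 := by
    simp only [quad_smul_left]
    have h4 : HasDerivAt (fun s : ℝ => ((1 + s : ℝ) : ℂ)) 1 0 := by
      simpa using ((hasDerivAt_id (0:ℝ)).const_add 1).ofReal_comp
    refine ((((h4.fun_pow 2).mul_const (mass e : ℂ)).sub_const (mass z : ℂ)).fun_sub
      ((h4.mul_const (ell e z : ℂ)).const_mul (2 * Complex.I))).congr_deriv ?_
    push_cast; ring
  have hT : HasDerivAt (fun s : ℝ => (((1 + s : ℝ) : ℂ) * mass e - Complex.I * ell e z))
      (mass e) 0 := by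
    have h4 : HasDerivAt (fun s : ℝ => ((1 + s : ℝ) : ℂ)) 1 0 := by
      simpa using ((hasDerivAt_id (0:ℝ)).const_add 1).ofReal_comp
    simpa using (h4.mul_const (mass e : ℂ)).sub_const (Complex.I * ell e z)
  have hc := continuous_rho e
  have h1 := hasDerivAt_weight_integral hd (P := fun ξ => (rho e ξ : ℂ)) (by fun_prop) (m := 1)
    (C := |e.1| + ‖e.2‖) (fun ξ => by
      rw [Complex.norm_real, pow_one]; exact abs_rho_le e ξ) he z e 0
  -- Moving `e` along itself changes only the exponent, and each derivative brings down a factor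
  -- `-rho e`. The closed form of `integral_rho_mul` at `(1 + s) • e` is what gets differentiated on
  -- the other side.
  have h2 : (fun s : ℝ => ∫ ξ : E, (‖ξ‖ : ℂ)⁻¹ * (rho e ξ : ℂ) *
        Complex.exp (expo e z ξ + s * expo e 0 ξ)) =ᶠ[nhds 0]
      fun s : ℝ => ((finrank ℝ E : ℂ) - 1) * ((((1 + s : ℝ) : ℂ) * mass e -
        Complex.I * ell e z) / quad ((1 + s) • e) z) * coneInt (e + s • e) z := by
    filter_upwards [lt_mem_nhds (show (-1 : ℝ) < 0 by norm_num)] with s hs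
    have h3 := integral_rho_mul hd he z (show 0 < 1 + s by linarith)
    have h4 : (1 + s) • e = e + s • e := by rw [add_smul, one_smul]
    rw [h4] at h3 ⊢
    rw [← h3]
    congr 1; ext ξ
    have := expo_add_smul e z e 0 s ξ
    rw [smul_zero, add_zero] at this
    rw [this]
  have hq' : quad (((1 : ℝ) + 0) • e) z ≠ 0 := by simpa using hq
  have h3 := ((hT.fun_div hQ hq').const_mul ((finrank ℝ E : ℂ) - 1)).fun_mul hI
  have h4 := (h1.congr_of_eventuallyEq h2.symm).unique h3
  have h5 : ∫ ξ : E, (‖ξ‖ : ℂ)⁻¹ * ((rho e ξ : ℂ) * expo e 0 ξ) * Complex.exp (expo e z ξ) =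
      -∫ ξ : E, (‖ξ‖ : ℂ)⁻¹ * (rho e ξ : ℂ) ^ 2 * Complex.exp (expo e z ξ) := by
    rw [← integral_neg]
    congr 1; ext ξ
    simp only [expo, phase, Prod.fst_zero, Prod.snd_zero, inner_zero_left]; push_cast; ring
  rw [h5] at h4
  rw [← neg_inj, h4]
  simp only [add_zero, one_smul, zero_smul, Complex.ofReal_one, one_mul]
  field_simp
  ring

end Kernel

/-! ### Size of `quad` and integrability of its negative powers. -/

section Decay

variable {E : Type*} [NormedAddCommGroup E] [InnerProductSpace ℝ E]

lemma quad_re (e z : ℝ × E) : (quad e z).re = mass e - mass z := by simp [quad, -Complex.ofReal_sub]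

lemma quad_im (e z : ℝ × E) : (quad e z).im = -(2 * ell e z) := by simp [quad, -Complex.ofReal_sub]

lemma mass_reference : mass ((1, 0) : ℝ × E) = 1 := by simp [mass]

lemma ell_reference (z : ℝ × E) : ell ((1, 0) : ℝ × E) z = z.1 := by simp [ell]

lemma abs_mass_sub_le (e z : ℝ × E) : |mass e - mass z| ≤ ‖quad e z‖ := by
  rw [← quad_re]
  exact Complex.abs_re_le_norm (quad e z)

lemma two_mul_abs_ell_le (e z : ℝ × E) : 2 * |ell e z| ≤ ‖quad e z‖ := by
  have := Complex.abs_im_le_norm (quad e z)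
  rwa [quad_im, abs_neg, abs_mul, abs_two] at this

/-- `quad e` is bounded below by its value in the reference frame, locally uniformly in `e`. -/
lemma exists_norm_quad_le {s : ℝ} (hs : 0 < s) : ∃ C : ℝ, 0 < C ∧ ∀ e : ℝ × E, s ≤ e.1 - ‖e.2‖ →
    ∀ z, ‖quad ((1, 0) : ℝ × E) z‖ ≤ C * (1 + e.1) ^ 2 * ‖quad e z‖ := by
  set K := 1 / s ^ 2 + 1 / 2 with hK
  have hK0 : 0 < K := by positivity
  refine ⟨4 / s ^ 2 + 1 + 1 / s + 2 * K / s, by positivity, fun e he z => ?_⟩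
  set Q := ‖quad e z‖ with hQ
  have h1 := abs_mass_sub_le e z
  have h2 := two_mul_abs_ell_le e z
  rw [← hQ] at h1 h2
  have hb := norm_nonneg e.2
  set r := ‖z.2‖ with hr
  have hr0 : 0 ≤ r := norm_nonneg _
  have hR : mass z = |z.1| ^ 2 - r ^ 2 := by rw [sq_abs]; rfl
  have ht0 := abs_nonneg z.1
  have hm : s ^ 2 ≤ mass e := by unfold mass; nlinarith
  have hm' : mass e ≤ e.1 ^ 2 := by unfold mass; nlinarith
  have hα : 0 < e.1 := by linarith
  have hl : e.1 * |z.1| - ‖e.2‖ * r ≤ |ell e z| := by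
    have h3 := abs_real_inner_le_norm e.2 z.2
    have h4 : |e.1 * z.1| = e.1 * |z.1| := by rw [abs_mul, abs_of_pos hα]
    have h5 : e.1 * z.1 = ell e z - inner ℝ e.2 z.2 := by unfold ell; ring
    have h6 := abs_sub (ell e z) (inner ℝ e.2 z.2)
    rw [← h5, h4] at h6
    linarith
  -- If `Q` were smaller, `mass z` would stay above `s ^ 2 / 2`, making `z` timelike. Then `|ell e
  -- z| ≥ s |z.1|` is bounded below, against `2 |ell e z| ≤ Q`.
  have hlow : s ^ 2 / 2 ≤ Q := by
    by_contra! hlt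
    have h3 := (abs_le.1 h1).2
    have h4 : s ^ 2 / 2 ≤ |z.1| ^ 2 - r ^ 2 := by linarith
    have h5 : r ≤ |z.1| := by nlinarith
    have h6 : s * |z.1| ≤ |ell e z| := by nlinarith
    have h7 : s ^ 2 / 2 ≤ |z.1| ^ 2 := by nlinarith
    have h8 : (s * |z.1|) ^ 2 ≤ (s ^ 2 / 4) ^ 2 := by
      apply pow_le_pow_left₀ (by positivity)
      linarith
    have h9 : s ^ 2 * (s ^ 2 / 2) ≤ s ^ 2 * |z.1| ^ 2 := by gcongr
    have : 0 < s ^ 4 := by positivity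
    nlinarith
  have hQ0 : 0 < Q := lt_of_lt_of_le (by positivity) hlow
  have hone : 1 ≤ 2 / s ^ 2 * Q := by
    rw [div_mul_eq_mul_div, le_div_iff₀ (by positivity)]; linarith
  have hsq : √Q ≤ K * Q := by
    rw [Real.sqrt_le_left (by positivity)]
    have h3 : (1 + Q) / 2 ≤ K * Q := by
      have : K * Q = (2 / s ^ 2 * Q + Q) / 2 := by rw [hK]; ring
      rw [this]; linarith
    have h4 : ((1 + Q) / 2) ^ 2 ≤ (K * Q) ^ 2 := by gcongr
    nlinarith [sq_nonneg (1 - Q)]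
  have hrt : r ≤ |z.1| + √Q := by
    have h3 := (abs_le.1 h1).1
    have h3' := (abs_le.1 h1).2
    apply le_of_sq_le_sq _ (by positivity)
    have := Real.sq_sqrt hQ0.le
    have := Real.sqrt_nonneg Q
    nlinarith
  -- The bound `e.1 |z.1| - ‖e.2‖ r ≤ Q / 2` combined with `r ≤ |z.1| + √Q` leaves the gap `s` as
  -- the coefficient of `|z.1|`, and `√Q ≤ K * Q` because `Q` is bounded below.
  have ht : |z.1| ≤ (1 / 2 + e.1 * K) / s * Q := by
    rw [div_mul_eq_mul_div, le_div_iff₀ hs]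
    have h3 : ‖e.2‖ * r ≤ ‖e.2‖ * |z.1| + e.1 * (K * Q) := by
      have h4 : ‖e.2‖ * r ≤ ‖e.2‖ * (|z.1| + √Q) := by gcongr
      have h5 : ‖e.2‖ * √Q ≤ e.1 * (K * Q) := by gcongr; linarith
      linarith
    nlinarith
  have h3 : ‖quad ((1, 0) : ℝ × E) z‖ ≤ |1 - mass z| + 2 * |z.1| := by
    have := Complex.norm_le_abs_re_add_abs_im (quad ((1, 0) : ℝ × E) z)
    rwa [quad_re, quad_im, mass_reference, ell_reference, abs_neg, abs_mul, abs_two] at this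
  have h4 : |1 - mass z| ≤ 1 + mass e + Q := by
    have h5 := (abs_le.1 h1)
    rw [abs_le]; constructor <;> linarith [h5.1, h5.2, sq_nonneg s]
  have hexp : (1 + e.1) ^ 2 = 1 + 2 * e.1 + e.1 ^ 2 := by ring
  have hα2 : 0 ≤ e.1 ^ 2 := sq_nonneg _
  have hexp1 : 1 ≤ (1 + e.1) ^ 2 := by linarith
  have h5 : 1 + mass e ≤ (1 + e.1) ^ 2 * (2 / s ^ 2 * Q) := by
    calc 1 + mass e ≤ (1 + e.1) ^ 2 * 1 := by linarith [hexp]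
      _ ≤ _ := by gcongr
  have h6 : 2 * |z.1| ≤ (1 + e.1) ^ 2 * ((1 / s + 2 * K / s) * Q) := by
    have h7 : 2 * ((1 / 2 + e.1 * K) / s * Q) = (1 / s + e.1 * (2 * K / s)) * Q := by ring
    have h8 : 1 / s + e.1 * (2 * K / s) ≤ (1 + e.1) ^ 2 * (1 / s + 2 * K / s) := by
      have a1 : 0 < 1 / s := by positivity
      have a2 : 0 < 2 * K / s := by positivity
      have a4 : e.1 ≤ (1 + e.1) ^ 2 := by linarith
      have a5 := mul_le_mul_of_nonneg_right hexp1 a1.le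
      have a6 := mul_le_mul_of_nonneg_right a4 a2.le
      linarith
    have h9 := mul_le_mul_of_nonneg_right h8 hQ0.le
    linarith
  have h7 : Q ≤ (1 + e.1) ^ 2 * Q := le_mul_of_one_le_left hQ0.le hexp1
  have h8 : 0 ≤ (1 + e.1) ^ 2 * (2 / s ^ 2 * Q) := by positivity
  calc _ ≤ (1 + e.1) ^ 2 * (2 / s ^ 2 * Q) + (1 + e.1) ^ 2 * Q +
        (1 + e.1) ^ 2 * ((1 / s + 2 * K / s) * Q) := by linarith
    _ ≤ _ := by
      have : (4 / s ^ 2 + 1 + 1 / s + 2 * K / s) * (1 + e.1) ^ 2 * Q =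
        2 * ((1 + e.1) ^ 2 * (2 / s ^ 2 * Q)) + (1 + e.1) ^ 2 * Q +
        (1 + e.1) ^ 2 * ((1 / s + 2 * K / s) * Q) := by ring
      linarith

/-- In the reference frame the form factors through the null coordinates `t ± |x|`; all decay
estimates are read off from this product. -/
lemma norm_quad_reference_sq (z : ℝ × E) : ‖quad ((1, 0) : ℝ × E) z‖ ^ 2 =
    (1 + (z.1 - ‖z.2‖) ^ 2) * (1 + (z.1 + ‖z.2‖) ^ 2) := by
  rw [← Complex.normSq_eq_norm_sq, Complex.normSq_apply]
  rw [quad_re, quad_im, mass_reference, ell_reference, mass]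
  ring

lemma one_le_norm_quad_reference (z : ℝ × E) : 1 ≤ ‖quad ((1, 0) : ℝ × E) z‖ := by
  have h := norm_quad_reference_sq z
  have h1 : (1:ℝ) ≤ ‖quad ((1, 0) : ℝ × E) z‖ ^ 2 := by
    rw [h]; nlinarith [sq_nonneg (z.1 - ‖z.2‖), sq_nonneg (z.1 + ‖z.2‖),
      mul_nonneg (sq_nonneg (z.1 - ‖z.2‖)) (sq_nonneg (z.1 + ‖z.2‖))]
  nlinarith [norm_nonneg (quad ((1, 0) : ℝ × E) z)]

/-- Such a shift moves each null coordinate by at most `2`, and then `1 + u²` changes by a factor at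
most `10`; two such factors give `10²` for the square. -/
lemma norm_quad_reference_le_add {z y : ℝ × E} (h1 : |y.1| ≤ 1) (h2 : ‖y.2‖ ≤ 1) :
    ‖quad ((1, 0) : ℝ × E) z‖ ≤ 10 * ‖quad ((1, 0) : ℝ × E) (z + y)‖ := by
  apply le_of_sq_le_sq _ (by positivity)
  rw [mul_pow, norm_quad_reference_sq, norm_quad_reference_sq]
  have h3 : |‖(z + y).2‖ - ‖z.2‖| ≤ 1 := by
    refine (abs_norm_sub_norm_le _ _).trans ?_
    simpa using h2
  have h1' := abs_le.1 h1
  have h3' := abs_le.1 h3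
  have key : ∀ u a : ℝ, -2 ≤ a → a ≤ 2 → 1 + u ^ 2 ≤ 10 * (1 + (u + a) ^ 2) := by
    intro u a h h'
    nlinarith [sq_nonneg (u + 2 * a), sq_nonneg (u + a)]
  have e1 := key (z.1 - ‖z.2‖) (y.1 - (‖(z + y).2‖ - ‖z.2‖)) (by linarith) (by linarith)
  have e2 := key (z.1 + ‖z.2‖) (y.1 + (‖(z + y).2‖ - ‖z.2‖)) (by linarith) (by linarith)
  have e3 : z.1 - ‖z.2‖ + (y.1 - (‖(z + y).2‖ - ‖z.2‖)) = (z + y).1 - ‖(z + y).2‖ := by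
    rw [Prod.fst_add]; ring
  have e4 : z.1 + ‖z.2‖ + (y.1 + (‖(z + y).2‖ - ‖z.2‖)) = (z + y).1 + ‖(z + y).2‖ := by
    rw [Prod.fst_add]; ring
  rw [e3] at e1
  rw [e4] at e2
  calc _ ≤ (10 * (1 + ((z + y).1 - ‖(z + y).2‖) ^ 2)) *
        (10 * (1 + ((z + y).1 + ‖(z + y).2‖) ^ 2)) := by gcongr
    _ = _ := by ring

lemma continuous_quad (e : ℝ × E) : Continuous (quad e) := by
  unfold quad mass ell; fun_prop

variable [FiniteDimensional ℝ E] [MeasurableSpace E] [BorelSpace E]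

open Module

/-- According to the sign of `t`, one of the null coordinates `t ± |x|` has modulus at least `|x|`.
That factor gives `(1 + |x|²)^(-N/2)`, integrable in `x` since `N > d`, while the other factor is
integrable in `t` uniformly in `x` since `N > 1`. -/
lemma integrable_norm_quad_reference {N : ℝ} (hN : (finrank ℝ E : ℝ) < N) (hd : 1 ≤ finrank ℝ E) :
    Integrable fun z : ℝ × E => ‖quad ((1, 0) : ℝ × E) z‖ ^ (-N) := by
  have hN1 : (1 : ℝ) < N := lt_of_le_of_lt (by exact_mod_cast hd) hN
  set g : ℝ → ℝ := fun u => (1 + u ^ 2) ^ (-N / 2) with hg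
  have hgi : Integrable g := by
    have := integrable_rpow_neg_one_add_norm_sq (E := ℝ) (μ := volume) (r := N) (by simpa using hN1)
    simpa [hg] using this
  have hH : Integrable fun x : E => (1 + ‖x‖ ^ 2) ^ (-N / 2) :=
    integrable_rpow_neg_one_add_norm_sq hN
  have hB : Integrable (fun z : ℝ × E => (1 + ‖z.2‖ ^ 2) ^ (-N / 2) *
      (g (z.1 - ‖z.2‖) + g (z.1 + ‖z.2‖))) := by
    rw [Measure.volume_eq_prod, integrable_prod_iff']
    · have h1 : ∀ x : E, Integrable fun t : ℝ => g (t - ‖x‖) + g (t + ‖x‖) := fun x =>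
        (hgi.comp_sub_right _).add (hgi.comp_add_right _)
      refine ⟨Filter.Eventually.of_forall fun x => ?_, ?_⟩
      · exact (h1 x).const_mul ((1 + ‖x‖ ^ 2) ^ (-N / 2))
      have h2 : ∀ x : E, ∫ t : ℝ, ‖(1 + ‖x‖ ^ 2) ^ (-N / 2) * (g (t - ‖x‖) + g (t + ‖x‖))‖ =
          (1 + ‖x‖ ^ 2) ^ (-N / 2) * (2 * ∫ t, g t) := by
        intro x
        have h3 : ∀ t : ℝ, ‖(1 + ‖x‖ ^ 2) ^ (-N / 2) * (g (t - ‖x‖) + g (t + ‖x‖))‖ =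
            (1 + ‖x‖ ^ 2) ^ (-N / 2) * (g (t - ‖x‖) + g (t + ‖x‖)) := fun t =>
          Real.norm_of_nonneg (by positivity)
        simp only [h3]
        rw [integral_const_mul, integral_add (hgi.comp_sub_right _) (hgi.comp_add_right _),
          integral_sub_right_eq_self g, integral_add_right_eq_self g]
        ring
      simp only [h2]
      exact hH.mul_const _
    · refine Measurable.aestronglyMeasurable ?_
      fun_prop
  refine hB.mono' ?_ (Filter.Eventually.of_forall fun z => ?_)
  · have := continuous_quad ((1, 0) : ℝ × E)
    exact Measurable.aestronglyMeasurable (by fun_prop)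
  · have h1 := norm_quad_reference_sq z
    have h2 : ‖quad ((1, 0) : ℝ × E) z‖ ^ (-N) =
        (1 + (z.1 - ‖z.2‖) ^ 2) ^ (-N / 2) * (1 + (z.1 + ‖z.2‖) ^ 2) ^ (-N / 2) := by
      rw [← Real.mul_rpow (by positivity) (by positivity), ← h1, ← Real.rpow_natCast,
        ← Real.rpow_mul (norm_nonneg _)]
      congr 1; push_cast; ring
    rw [Real.norm_of_nonneg (by positivity), h2]
    have hr := norm_nonneg z.2
    have hneg : -N / 2 ≤ 0 := by linarith
    rcases le_total 0 z.1 with h | h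
    · have h3 : (1 + (z.1 + ‖z.2‖) ^ 2) ^ (-N / 2) ≤ (1 + ‖z.2‖ ^ 2) ^ (-N / 2) :=
        Real.rpow_le_rpow_of_nonpos (by positivity) (by nlinarith) hneg
      calc _ ≤ (1 + (z.1 - ‖z.2‖) ^ 2) ^ (-N / 2) * (1 + ‖z.2‖ ^ 2) ^ (-N / 2) := by gcongr
        _ ≤ _ := by
          rw [mul_comm]
          have : 0 ≤ g (z.1 + ‖z.2‖) := by positivity
          gcongr
          simp only [hg] at this ⊢
          linarith
    · have h3 : (1 + (z.1 - ‖z.2‖) ^ 2) ^ (-N / 2) ≤ (1 + ‖z.2‖ ^ 2) ^ (-N / 2) :=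
        Real.rpow_le_rpow_of_nonpos (by positivity) (by nlinarith) hneg
      calc _ ≤ (1 + ‖z.2‖ ^ 2) ^ (-N / 2) * (1 + (z.1 + ‖z.2‖) ^ 2) ^ (-N / 2) := by gcongr
        _ ≤ _ := by
          have : 0 ≤ g (z.1 - ‖z.2‖) := by positivity
          gcongr
          simp only [hg] at this ⊢
          linarith

lemma norm_quad_rpow_neg_le {e : ℝ × E} {K N : ℝ} (hN : 0 ≤ N) (hK : 0 < K) {z : ℝ × E}
    (h : ‖quad ((1, 0) : ℝ × E) z‖ ≤ K * ‖quad e z‖) :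
    ‖quad e z‖ ^ (-N) ≤ K ^ N * ‖quad ((1, 0) : ℝ × E) z‖ ^ (-N) := by
  have h1 := one_le_norm_quad_reference z
  have h2 : 0 < ‖quad e z‖ := by
    by_contra! h3
    have : ‖quad e z‖ = 0 := le_antisymm h3 (norm_nonneg _)
    rw [this] at h; linarith
  rw [Real.rpow_neg (by positivity), Real.rpow_neg (by positivity), ← div_eq_mul_inv,
    inv_le_comm₀ (by positivity) (by positivity), inv_div, div_le_iff₀ (by positivity),
    ← Real.mul_rpow (by positivity) hK.le, mul_comm _ K]
  exact Real.rpow_le_rpow (by positivity) h hN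

lemma integrable_norm_quad {e : ℝ × E} (he : ‖e.2‖ < e.1) {N : ℝ} (hN : (finrank ℝ E : ℝ) < N)
    (hd : 1 ≤ finrank ℝ E) : Integrable fun z : ℝ × E => ‖quad e z‖ ^ (-N) := by
  obtain ⟨C, hC, h⟩ := exists_norm_quad_le (E := E) (sub_pos.2 he)
  have hc := continuous_quad e
  have h0 : 0 ≤ N := (Nat.cast_nonneg _).trans hN.le
  have h1 : 0 < 1 + e.1 := by linarith [norm_nonneg e.2]
  refine ((integrable_norm_quad_reference hN hd).const_mul ((C * (1 + e.1) ^ 2) ^ N)).mono'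
    (Measurable.aestronglyMeasurable (by fun_prop)) (Filter.Eventually.of_forall fun z => ?_)
  rw [Real.norm_of_nonneg (by positivity)]
  exact norm_quad_rpow_neg_le h0 (by positivity) (h e le_rfl z)

end Decay

/-! ### Integration by parts in space-time and the moments of `ratio`. -/

section Spacetime

lemma integral_add_mul_add_mul {α : Type*} [MeasurableSpace α] {ν : Measure α} {f g h : α → ℂ}
    (hf : Integrable f ν) (hg : Integrable g ν) (hh : Integrable h ν) (c c' : ℂ) :
    ∫ z, (f z + c * g z + c' * h z) ∂ν = (∫ z, f z ∂ν) + c * (∫ z, g z ∂ν) + c' * ∫ z, h z ∂ν := by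
  have h1 : Integrable (fun z => f z + c * g z) ν := hf.add (hg.const_mul c)
  rw [integral_add h1 (hh.const_mul c'), integral_add hf (hg.const_mul c), integral_const_mul,
    integral_const_mul]

/-- The logarithmic derivative of `‖q‖` is the real part of `q' / q`. -/
lemma hasDerivAt_mul_norm_rpow {h q : ℝ → ℂ} {h' q' : ℂ} {s : ℝ} (N : ℝ) (hh : HasDerivAt h h' s)
    (hq : HasDerivAt q q' s) (h0 : q s ≠ 0) :
    HasDerivAt (fun s => h s * ((‖q s‖ ^ (-N) : ℝ) : ℂ))
      ((h' - N * h s * ((q' / q s).re : ℝ)) * ((‖q s‖ ^ (-N) : ℝ) : ℂ)) s := by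
  have hn : 0 < ‖q s‖ := norm_pos_iff.2 h0
  have h1 : ∀ x : ℂ, ‖x‖ ^ (-N) = (‖x‖ ^ 2) ^ (-N / 2) := by
    intro x
    rw [← Real.rpow_natCast, ← Real.rpow_mul (norm_nonneg _)]
    congr 1; push_cast; ring
  have h2 : HasDerivAt (fun s => ‖q s‖ ^ (-N)) (-N * (q' / q s).re * ‖q s‖ ^ (-N)) s := by
    simp only [h1]
    have h3 := hq.norm_sq.rpow_const (p := -N / 2) (Or.inl (by positivity))
    refine h3.congr_deriv ?_
    have h4 : (q' / q s).re = inner ℝ (q s) q' / ‖q s‖ ^ 2 := by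
      rw [Complex.inner, Complex.div_re, ← Complex.normSq_eq_norm_sq]
      simp [Complex.mul_re]; ring
    rw [h4, Real.rpow_sub_one (by positivity)]
    ring
  refine (hh.fun_mul h2.ofReal_comp).congr_deriv ?_
  push_cast; ring

variable {E : Type*} [NormedAddCommGroup E] [InnerProductSpace ℝ E]

lemma norm_quad_reference_le_smul {z : ℝ × E} {s : ℝ} (hs : 1 / 2 ≤ s) :
    ‖quad ((1, 0) : ℝ × E) z‖ ≤ 4 * ‖quad ((1, 0) : ℝ × E) (s • z)‖ := by
  apply le_of_sq_le_sq _ (by positivity)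
  rw [mul_pow, norm_quad_reference_sq, norm_quad_reference_sq]
  have hs0 : 0 ≤ s := by linarith
  have key : ∀ u : ℝ, 1 + u ^ 2 ≤ 4 * (1 + (s * u) ^ 2) := by
    intro u
    have : (1 / 2) ^ 2 ≤ s ^ 2 := by gcongr
    nlinarith [sq_nonneg u]
  simp only [Prod.smul_fst, Prod.smul_snd, norm_smul, Real.norm_eq_abs, abs_of_nonneg hs0,
    smul_eq_mul, ← mul_sub, ← mul_add]
  calc _ ≤ (4 * (1 + (s * (z.1 - ‖z.2‖)) ^ 2)) * (4 * (1 + (s * (z.1 + ‖z.2‖)) ^ 2)) := by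
        gcongr
        · exact key _
        · exact key _
    _ = _ := by ring

lemma continuous_ell (e : ℝ × E) : Continuous (ell e) := by unfold ell; fun_prop

lemma ell_smul (e z : ℝ × E) (s : ℝ) : ell e (s • z) = s * ell e z := by
  simp only [ell, Prod.smul_fst, Prod.smul_snd, inner_smul_right, smul_eq_mul]; ring

lemma ell_add_reflect (e z : ℝ × E) (s : ℝ) :
    ell e (z + s • ((e.1, -e.2) : ℝ × E)) = ell e z + s * mass e := by
  simp only [ell, mass, Prod.fst_add, Prod.snd_add, Prod.smul_fst, Prod.smul_snd, inner_add_right,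
    inner_smul_right, inner_neg_right, smul_eq_mul, real_inner_self_eq_norm_sq]; ring

lemma mass_add_reflect (e z : ℝ × E) (s : ℝ) :
    mass (z + s • ((e.1, -e.2) : ℝ × E)) = mass z + 2 * s * ell e z + s ^ 2 * mass e := by
  simp only [ell, mass, Prod.fst_add, Prod.snd_add, Prod.smul_fst, Prod.smul_snd, smul_eq_mul,
    norm_add_sq_real, norm_smul, norm_neg, inner_smul_right, inner_neg_right, mul_pow,
    Real.norm_eq_abs, sq_abs, real_inner_comm e.2 z.2]; ring

lemma hasDerivAt_quad_smul (e z : ℝ × E) : HasDerivAt (fun s : ℝ => quad e (s • z))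
    (2 * quad e z - 2 * (mass e - Complex.I * ell e z)) 1 := by
  simp only [quad_path]
  have h4 : HasDerivAt (fun s : ℝ => (s : ℂ)) 1 1 := by
    simpa using (hasDerivAt_id (1:ℝ)).ofReal_comp
  refine ((((h4.fun_pow 2).mul_const (mass z : ℂ)).const_sub (mass e : ℂ)).fun_sub
    ((h4.mul_const (ell e z : ℂ)).const_mul (2 * Complex.I))).congr_deriv ?_
  simp only [quad]; push_cast; ring

lemma hasDerivAt_quad_add (e z : ℝ × E) :
    HasDerivAt (fun s : ℝ => quad e (z + s • ((e.1, -e.2) : ℝ × E)))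
    (-2 * Complex.I * (mass e - Complex.I * ell e z)) 0 := by
  unfold quad
  simp only [ell_add_reflect, mass_add_reflect]
  push_cast
  have h4 : HasDerivAt (fun s : ℝ => (s : ℂ)) 1 0 := by
    simpa using (hasDerivAt_id (0:ℝ)).ofReal_comp
  refine ((((((h4.const_mul 2).mul_const (ell e z : ℂ)).const_add (mass z : ℂ)).fun_add
    ((h4.fun_pow 2).mul_const (mass e : ℂ))).const_sub (mass e : ℂ)).fun_sub
    (((h4.mul_const (mass e : ℂ)).const_add (ell e z : ℂ)).const_mul (2 * Complex.I))).congr_deriv ?_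
  push_cast
  linear_combination (-2 * ell e z : ℂ) * Complex.I_sq

lemma hasDerivAt_num_smul (e z : ℝ × E) :
    HasDerivAt (fun s : ℝ => (mass e - Complex.I * ell e (s • z) : ℂ))
    (-Complex.I * ell e z) 1 := by
  simp only [ell_smul]
  have h4 : HasDerivAt (fun s : ℝ => (s : ℂ)) 1 1 := by
    simpa using (hasDerivAt_id (1:ℝ)).ofReal_comp
  push_cast
  exact (((h4.mul_const (ell e z : ℂ)).const_mul Complex.I).const_sub (mass e : ℂ)).congr_deriv
    (by ring)

lemma hasDerivAt_num_add (e z : ℝ × E) :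
    HasDerivAt (fun s : ℝ => (mass e - Complex.I * ell e (z + s • ((e.1, -e.2) : ℝ × E)) : ℂ))
    (-Complex.I * mass e) 0 := by
  simp only [ell_add_reflect]
  have h4 : HasDerivAt (fun s : ℝ => (s : ℂ)) 1 0 := by
    simpa using (hasDerivAt_id (0:ℝ)).ofReal_comp
  push_cast
  exact ((((h4.mul_const (mass e : ℂ)).const_add (ell e z : ℂ)).const_mul Complex.I).const_sub
    (mass e : ℂ)).congr_deriv (by ring)

variable [FiniteDimensional ℝ E] [MeasurableSpace E] [BorelSpace E]

open Module

instance isAddHaarMeasure_spacetime : (volume : Measure (ℝ × E)).IsAddHaarMeasure := by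
  rw [Measure.volume_eq_prod]; infer_instance

/-- Space-time has dimension `d + 1`, so the integral of `φ (s • z)` is `s^(-(d+1))` times that of
`φ`; the identity is its derivative at `s = 1`. For `s` near `1` the decay of `a (s • z)` is
controlled by that of the reference weight at `z`. -/
lemma integral_dilation_derivative {φ a : ℝ × E → ℂ} {N K : ℝ} (hN : (finrank ℝ E : ℝ) < N)
    (hd : 1 ≤ finrank ℝ E) (hφ : Continuous φ) (ha : Continuous a)
    (hφb : ∀ z, ‖φ z‖ ≤ K * ‖quad ((1, 0) : ℝ × E) z‖ ^ (-N))
    (hab : ∀ z, ‖a z‖ ≤ K * ‖quad ((1, 0) : ℝ × E) z‖ ^ (-N))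
    (hder : ∀ z, HasDerivAt (fun s : ℝ => φ (s • z)) (a z) 1) :
    ∫ z, a z = -((finrank ℝ E : ℂ) + 1) * ∫ z, φ z := by
  have hN0 : 0 < N := lt_of_le_of_lt (Nat.cast_nonneg _) hN
  have hw := integrable_norm_quad_reference hN hd
  have hK : 0 ≤ K := by
    have := (norm_nonneg _).trans (hφb 0)
    have h1 : 0 < ‖quad ((1, 0) : ℝ × E) 0‖ ^ (-N) :=
      Real.rpow_pos_of_pos (by linarith [one_le_norm_quad_reference (0 : ℝ × E)]) _
    exact nonneg_of_mul_nonneg_left this h1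
  have hder' : ∀ z, ∀ s : ℝ, 0 < s → HasDerivAt (fun s : ℝ => φ (s • z)) ((s : ℂ)⁻¹ * a (s • z)) s := by
    intro z s hs
    have h1 : HasDerivAt (fun r : ℝ => r / s) s⁻¹ s := by
      simpa using (hasDerivAt_id s).div_const s
    have h2 := hder (s • z)
    rw [← div_self hs.ne'] at h2
    have h3 := HasDerivAt.scomp (h := fun r : ℝ => r / s) (g₁ := fun r : ℝ => φ (r • s • z)) s h2 h1
    have h4 : (fun r : ℝ => φ (r • s • z)) ∘ (fun r : ℝ => r / s) = fun r : ℝ => φ (r • z) := by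
      ext r
      simp only [Function.comp]
      rw [smul_smul, div_mul_cancel₀ _ hs.ne']
    rw [h4] at h3
    refine h3.congr_deriv ?_
    rw [Complex.real_smul]; push_cast; rfl
  have key := hasDerivAt_integral_of_dominated_loc_of_deriv_le
    (μ := (volume : Measure (ℝ × E))) (𝕜 := ℝ) (F := fun s z => φ (s • z))
    (F' := fun s z => (s : ℂ)⁻¹ * a (s • z)) (x₀ := 1) (s := Metric.ball 1 (1 / 2))
    (bound := fun z => 2 * (K * (4 ^ N * ‖quad ((1, 0) : ℝ × E) z‖ ^ (-N))))
    (Metric.ball_mem_nhds 1 (by norm_num)) ?_ ?_ ?_ ?_ ?_ ?_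
  · have h1 := key.2
    have h2 : (fun s : ℝ => ∫ z, φ (s • z)) =ᶠ[nhds 1]
        fun s : ℝ => (((s ^ (finrank ℝ E + 1))⁻¹ : ℝ) : ℂ) * ∫ z, φ z := by
      filter_upwards [lt_mem_nhds (show (0 : ℝ) < 1 by norm_num)] with s hs
      rw [Measure.integral_comp_smul, Complex.real_smul, abs_of_pos (by positivity)]
      congr 4
      rw [finrank_prod, finrank_self, add_comm]
    have h3 : HasDerivAt (fun s : ℝ => (((s ^ (finrank ℝ E + 1))⁻¹ : ℝ) : ℂ) * ∫ z, φ z)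
        (-((finrank ℝ E : ℂ) + 1) * ∫ z, φ z) 1 := by
      have h4 : HasDerivAt (fun s : ℝ => ((s ^ (finrank ℝ E + 1))⁻¹ : ℝ))
          (-((finrank ℝ E : ℝ) + 1)) 1 := by
        have := ((hasDerivAt_id (1:ℝ)).fun_pow (finrank ℝ E + 1)).fun_inv (by simp)
        simpa using this
      exact (h4.ofReal_comp.mul_const (∫ z, φ z)).congr_deriv (by push_cast; ring)
    have h4 := (h1.congr_of_eventuallyEq h2.symm).unique h3
    simpa using h4
  · refine Filter.Eventually.of_forall fun s => Continuous.aestronglyMeasurable ?_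
    fun_prop
  · simp only [one_smul]
    exact (hw.const_mul K).mono' hφ.aestronglyMeasurable (Filter.Eventually.of_forall hφb)
  · refine Continuous.aestronglyMeasurable ?_
    fun_prop
  · refine Filter.Eventually.of_forall fun z s hs => ?_
    rw [mem_ball_iff_norm, Real.norm_eq_abs, abs_lt] at hs
    have hs1 : 1 / 2 ≤ s := by linarith
    have h1 : ‖quad ((1, 0) : ℝ × E) (s • z)‖ ^ (-N) ≤ 4 ^ N * ‖quad ((1, 0) : ℝ × E) z‖ ^ (-N) := by
      have h2 := norm_quad_reference_le_smul (z := z) hs1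
      have h3 := one_le_norm_quad_reference z
      have h4 := one_le_norm_quad_reference (s • z)
      rw [Real.rpow_neg (by positivity), Real.rpow_neg (by positivity), ← div_eq_mul_inv,
        inv_le_comm₀ (by positivity) (by positivity), inv_div, div_le_iff₀ (by positivity),
        ← Real.mul_rpow (by positivity) (by positivity), mul_comm _ (4:ℝ)]
      exact Real.rpow_le_rpow (by positivity) h2 hN0.le
    rw [norm_mul, norm_inv, Complex.norm_real, Real.norm_of_nonneg (by linarith)]
    gcongr
    · rw [inv_le_comm₀ (by linarith) (by norm_num)]; linarith
    · exact (hab _).trans (by gcongr)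
  · exact ((hw.const_mul _).const_mul _).const_mul _
  · refine Filter.Eventually.of_forall fun z s hs => ?_
    rw [mem_ball_iff_norm, Real.norm_eq_abs, abs_lt] at hs
    exact hder' z s (by linarith)

lemma integral_translation_derivative {φ b : ℝ × E → ℂ} {N K : ℝ} (n : ℝ × E)
    (hN : (finrank ℝ E : ℝ) < N) (hd : 1 ≤ finrank ℝ E) (hφ : Continuous φ) (hb : Continuous b)
    (hφb : ∀ z, ‖φ z‖ ≤ K * ‖quad ((1, 0) : ℝ × E) z‖ ^ (-N))
    (hbb : ∀ z, ‖b z‖ ≤ K * ‖quad ((1, 0) : ℝ × E) z‖ ^ (-N))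
    (hder : ∀ z, HasDerivAt (fun s : ℝ => φ (z + s • n)) (b z) 0) :
    ∫ z, b z = 0 := by
  have hN0 : 0 < N := lt_of_le_of_lt (Nat.cast_nonneg _) hN
  have hw := integrable_norm_quad_reference hN hd
  have hK : 0 ≤ K := by
    have := (norm_nonneg _).trans (hφb 0)
    have h1 : 0 < ‖quad ((1, 0) : ℝ × E) 0‖ ^ (-N) :=
      Real.rpow_pos_of_pos (by linarith [one_le_norm_quad_reference (0 : ℝ × E)]) _
    exact nonneg_of_mul_nonneg_left this h1
  have hder' : ∀ z, ∀ s : ℝ, HasDerivAt (fun s : ℝ => φ (z + s • n)) (b (z + s • n)) s := by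
    intro z s
    have h2 := hder (z + s • n)
    rw [← sub_self s] at h2
    have h3 := HasDerivAt.comp_sub_const s s h2
    have h4 : (fun x : ℝ => φ (z + s • n + (x - s) • n)) = fun r : ℝ => φ (z + r • n) := by
      ext r
      rw [add_assoc, ← add_smul, add_sub_cancel]
    rwa [h4] at h3
  have hpos : 0 < 1 + ‖n‖ := by positivity
  have key := hasDerivAt_integral_of_dominated_loc_of_deriv_le
    (μ := (volume : Measure (ℝ × E))) (𝕜 := ℝ) (F := fun s z => φ (z + s • n))
    (F' := fun s z => b (z + s • n)) (x₀ := 0) (s := Metric.ball 0 (1 / (1 + ‖n‖)))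
    (bound := fun z => K * (10 ^ N * ‖quad ((1, 0) : ℝ × E) z‖ ^ (-N)))
    (Metric.ball_mem_nhds 0 (by positivity)) ?_ ?_ ?_ ?_ ?_ ?_
  · have h1 := key.2
    have h2 : (fun s : ℝ => ∫ z, φ (z + s • n)) = fun s : ℝ => ∫ z, φ z := by
      ext s
      exact integral_add_right_eq_self φ (s • n)
    rw [h2] at h1
    simpa using h1.unique (hasDerivAt_const _ _)
  · refine Filter.Eventually.of_forall fun s => Continuous.aestronglyMeasurable ?_
    fun_prop
  · simp only [zero_smul, add_zero]
    exact (hw.const_mul K).mono' hφ.aestronglyMeasurable (Filter.Eventually.of_forall hφb)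
  · refine Continuous.aestronglyMeasurable ?_
    fun_prop
  · refine Filter.Eventually.of_forall fun z s hs => ?_
    rw [mem_ball_zero_iff, Real.norm_eq_abs, lt_div_iff₀ hpos] at hs
    have h0 : ‖s • n‖ ≤ 1 := by
      rw [norm_smul, Real.norm_eq_abs]; nlinarith [abs_nonneg s]
    have h1 : ‖quad ((1, 0) : ℝ × E) (z + s • n)‖ ^ (-N) ≤
        10 ^ N * ‖quad ((1, 0) : ℝ × E) z‖ ^ (-N) := by
      have h2 := norm_quad_reference_le_add (z := z) (y := s • n)
        ((norm_fst_le (s • n)).trans h0) ((norm_snd_le (s • n)).trans h0)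
      have h3 := one_le_norm_quad_reference z
      have h4 := one_le_norm_quad_reference (z + s • n)
      rw [Real.rpow_neg (by positivity), Real.rpow_neg (by positivity), ← div_eq_mul_inv,
        inv_le_comm₀ (by positivity) (by positivity), inv_div, div_le_iff₀ (by positivity),
        ← Real.mul_rpow (by positivity) (by positivity), mul_comm _ (10:ℝ)]
      exact Real.rpow_le_rpow (by positivity) h2 hN0.le
    exact (hbb _).trans (by gcongr)
  · exact (hw.const_mul _).const_mul _
  · exact Filter.Eventually.of_forall fun z s hs => hder' z s

/-- The normalised derivative `⟨Z, e⟩ / ⟨Z, Z⟩` of the logarithm of `quad`. -/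
noncomputable def ratio (e z : ℝ × E) : ℂ := (mass e - Complex.I * ell e z) / quad e z

lemma continuous_ratio {e : ℝ × E} (he : ‖e.2‖ < e.1) : Continuous (ratio e) := by
  have h1 := continuous_quad e
  have h2 := continuous_ell e
  unfold ratio
  exact Continuous.div (by fun_prop) h1 (quad_ne_zero he)

/-- Here `ratio` is bounded because `|ell e z|` is at most half of `‖quad e z‖` and `‖quad e z‖` is
bounded below. -/
lemma exists_norm_inv_quad_le {e : ℝ × E} (he : ‖e.2‖ < e.1) :
    ∃ K : ℝ, 0 < K ∧ (∀ z, ‖(quad e z)⁻¹‖ ≤ K) ∧ (∀ z, ‖ratio e z‖ ≤ K) ∧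
      ∀ z, ‖quad ((1, 0) : ℝ × E) z‖ ≤ K * ‖quad e z‖ := by
  obtain ⟨C, hC, h⟩ := exists_norm_quad_le (E := E) (sub_pos.2 he)
  have hα : 0 < 1 + e.1 := by linarith [norm_nonneg e.2]
  have hm := mass_pos he
  set K := C * (1 + e.1) ^ 2 with hK
  have hK0 : 0 < K := by positivity
  have h1 : ∀ z, ‖(quad e z)⁻¹‖ ≤ K := by
    intro z
    have h2 := h e le_rfl z
    have h3 := one_le_norm_quad_reference z
    have h4 := norm_pos_iff.2 (quad_ne_zero he z)
    rw [norm_inv, inv_le_iff_one_le_mul₀ h4]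
    exact h3.trans h2
  refine ⟨K + mass e * K + 1, by positivity, fun z => (h1 z).trans (by nlinarith),
    fun z => ?_, fun z => ?_⟩
  · have h2 : ‖(mass e - Complex.I * ell e z : ℂ)‖ ≤ mass e + |ell e z| := by
      refine (norm_sub_le _ _).trans ?_
      simp [abs_of_pos hm]
    have h3 := two_mul_abs_ell_le e z
    have h4 := norm_pos_iff.2 (quad_ne_zero he z)
    have h5 := h1 z
    rw [norm_inv, inv_le_iff_one_le_mul₀ h4] at h5
    unfold ratio
    rw [norm_div, div_le_iff₀ h4]
    have h6 := abs_nonneg (ell e z)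
    nlinarith
  · refine (h e le_rfl z).trans ?_
    rw [← hK]
    gcongr
    nlinarith

lemma integrable_mul_norm_quad {e : ℝ × E} (he : ‖e.2‖ < e.1) {N K : ℝ}
    (hN : (finrank ℝ E : ℝ) < N) (hd : 1 ≤ finrank ℝ E) {h : ℝ × E → ℂ} (hc : Continuous h)
    (hb : ∀ z, ‖h z‖ ≤ K) :
    Integrable fun z => h z * ((‖quad e z‖ ^ (-N) : ℝ) : ℂ) := by
  have h1 := continuous_quad e
  refine (integrable_norm_quad he hN hd).ofReal.bdd_mul hc.aestronglyMeasurable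
    (Filter.Eventually.of_forall hb)

/-- Integration by parts for the complex dilations `z ↦ z·∇ ∓ i ∂_n` with respect to the weight
`|quad|^(-N)`. -/
lemma integral_weighted_dilation {e : ℝ × E} (he : ‖e.2‖ < e.1) {N K : ℝ}
    (hN : (finrank ℝ E : ℝ) < N) (hd : 1 ≤ finrank ℝ E) {h hE hn : ℝ × E → ℂ}
    (hc : Continuous h) (hEc : Continuous hE) (hnc : Continuous hn)
    (hb : ∀ z, ‖h z‖ ≤ K) (hEb : ∀ z, ‖hE z‖ ≤ K) (hnb : ∀ z, ‖hn z‖ ≤ K)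
    (hEd : ∀ z, HasDerivAt (fun s : ℝ => h (s • z)) (hE z) 1)
    (hnd : ∀ z, HasDerivAt (fun s : ℝ => h (z + s • ((e.1, -e.2) : ℝ × E))) (hn z) 0) :
    (∫ z, (hE z - Complex.I * hn z - N * h z * (2 - 2 * ratio e z) +
        ((finrank ℝ E : ℂ) + 1) * h z) * ((‖quad e z‖ ^ (-N) : ℝ) : ℂ) = 0) ∧
    (∫ z, (hE z + Complex.I * hn z - N * h z * (2 - 2 * (starRingEnd ℂ) (ratio e z)) +
        ((finrank ℝ E : ℂ) + 1) * h z) * ((‖quad e z‖ ^ (-N) : ℝ) : ℂ) = 0) := by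
  obtain ⟨C, hC, -, hX, hQ⟩ := exists_norm_inv_quad_le he
  have hN0 : 0 < N := lt_of_le_of_lt (Nat.cast_nonneg _) hN
  have hq := quad_ne_zero he
  have hK : 0 ≤ K := (norm_nonneg _).trans (hb 0)
  have hXc := continuous_ratio he
  have hQc := continuous_quad e
  set w : ℝ × E → ℂ := fun z => ((‖quad e z‖ ^ (-N) : ℝ) : ℂ) with hw
  have hwc : Continuous w := by
    refine Complex.continuous_ofReal.comp (hQc.norm.rpow_const fun z => Or.inl ?_)
    exact (norm_pos_iff.2 (hq z)).ne'
  have hwb : ∀ z, ‖w z‖ ≤ C ^ N * ‖quad ((1, 0) : ℝ × E) z‖ ^ (-N) := by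
    intro z
    rw [hw]
    simp only [Complex.norm_real]
    rw [Real.norm_of_nonneg (by positivity)]
    exact norm_quad_rpow_neg_le hN0.le hC (hQ z)
  -- Up to the factor `-N`, `R1` and `R2` are the logarithmic derivatives of the weight under the
  -- dilation and under translation along `n = (e.1, -e.2)`.
  set R1 : ℝ × E → ℂ := fun z => (((2 - 2 * ratio e z).re : ℝ) : ℂ) with hR1
  set R2 : ℝ × E → ℂ := fun z => (((-2 * Complex.I * ratio e z).re : ℝ) : ℂ) with hR2
  have hR1c : Continuous R1 := by
    refine Complex.continuous_ofReal.comp (Complex.continuous_re.comp ?_); fun_prop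
  have hR2c : Continuous R2 := by
    refine Complex.continuous_ofReal.comp (Complex.continuous_re.comp ?_); fun_prop
  have hR1b : ∀ z, ‖R1 z‖ ≤ 2 + 2 * C := by
    intro z
    rw [hR1]; simp only [Complex.norm_real]
    refine (Complex.abs_re_le_norm _).trans ((norm_sub_le _ _).trans ?_)
    rw [norm_mul, RCLike.norm_ofNat]
    linarith [hX z]
  have hR2b : ∀ z, ‖R2 z‖ ≤ 2 + 2 * C := by
    intro z
    rw [hR2]; simp only [Complex.norm_real]
    refine (Complex.abs_re_le_norm _).trans ?_
    rw [norm_mul, norm_mul, norm_neg, RCLike.norm_ofNat, Complex.norm_I]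
    linarith [hX z]
  set a : ℝ × E → ℂ := fun z => hE z - N * h z * R1 z with ha
  set b : ℝ × E → ℂ := fun z => hn z - N * h z * R2 z with hbdef
  set K' := K + N * K * (2 + 2 * C) with hK'
  have hKK' : K ≤ K' := by
    have : 0 ≤ N * K * (2 + 2 * C) := by positivity
    linarith
  have hNn : ‖(N : ℂ)‖ = N := by rw [Complex.norm_real, Real.norm_of_nonneg hN0.le]
  have hab : ∀ z, ‖a z‖ ≤ K' := fun z => by
    refine (norm_sub_le _ _).trans (add_le_add (hEb z) ?_)
    rw [norm_mul, norm_mul, hNn]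
    gcongr
    · exact hb z
    · exact hR1b z
  have hbb : ∀ z, ‖b z‖ ≤ K' := fun z => by
    refine (norm_sub_le _ _).trans (add_le_add (hnb z) ?_)
    rw [norm_mul, norm_mul, hNn]
    gcongr
    · exact hb z
    · exact hR2b z
  have hac : Continuous a := by fun_prop
  have hbc : Continuous b := by fun_prop
  have hbd : ∀ g : ℝ × E → ℂ, (∀ z, ‖g z‖ ≤ K') → ∀ z,
      ‖g z * w z‖ ≤ K' * C ^ N * ‖quad ((1, 0) : ℝ × E) z‖ ^ (-N) := by
    intro g hg z
    rw [norm_mul, mul_assoc]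
    exact mul_le_mul (hg z) (hwb z) (norm_nonneg _) (hK.trans hKK')
  have h1 := integral_dilation_derivative hN hd (hc.mul hwc) (hac.mul hwc)
    (hbd h fun z => (hb z).trans hKK') (hbd a hab) (fun z => by
      have := hasDerivAt_mul_norm_rpow N (hEd z) (hasDerivAt_quad_smul e z) (by simpa using hq z)
      refine this.congr_deriv ?_
      simp only [one_smul, ha, hw, hR1, Pi.mul_apply]
      congr 5
      unfold ratio
      rw [sub_div, mul_div_cancel_right₀ _ (hq z), mul_div_assoc])
  have h2 := integral_translation_derivative (e.1, -e.2) hN hd (hc.mul hwc) (hbc.mul hwc)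
    (hbd h fun z => (hb z).trans hKK') (hbd b hbb) (fun z => by
      have := hasDerivAt_mul_norm_rpow N (hnd z) (hasDerivAt_quad_add e z) (by simpa using hq z)
      refine this.congr_deriv ?_
      simp only [zero_smul, add_zero, hbdef, hw, hR2, Pi.mul_apply]
      congr 5
      unfold ratio
      rw [mul_div_assoc])
  have i1 := integrable_mul_norm_quad he hN hd hac hab
  have i2 := integrable_mul_norm_quad he hN hd hbc hbb
  have i3 := integrable_mul_norm_quad he hN hd hc hb
  simp only [Pi.mul_apply] at h1 h2
  -- The complex combinations turn the real parts back into `ratio` or its conjugate, so the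
  -- integrated identities are rational expressions in `ratio` and `quad`.
  have hr : ∀ z, R1 z - Complex.I * R2 z = 2 - 2 * ratio e z := by
    intro z
    apply Complex.ext <;> simp [hR1, hR2]
  have hr' : ∀ z, R1 z + Complex.I * R2 z = 2 - 2 * (starRingEnd ℂ) (ratio e z) := by
    intro z
    apply Complex.ext <;> simp [hR1, hR2]
  constructor
  · have h3 := integral_add_mul_add_mul i1 i2 i3 (-Complex.I) ((finrank ℝ E : ℂ) + 1)
    rw [h1, h2, mul_zero, add_zero, neg_mul, neg_add_cancel] at h3
    rw [← h3]
    congr 1; ext z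
    rw [← hr]; simp only [ha, hbdef]; ring
  · have h3 := integral_add_mul_add_mul i1 i2 i3 Complex.I ((finrank ℝ E : ℂ) + 1)
    rw [h1, h2, mul_zero, add_zero, neg_mul, neg_add_cancel] at h3
    rw [← h3]
    congr 1; ext z
    rw [← hr']; simp only [ha, hbdef]; ring

/-- The moments of `ratio` and `mass / quad` with respect to `|quad|^(-N)` and the three linear
relations that determine them. -/
lemma exists_moments {e : ℝ × E} (he : ‖e.2‖ < e.1) {N : ℝ} (hN : (finrank ℝ E : ℝ) < N)
    (hd : 1 ≤ finrank ℝ E) : ∃ m₁ m₂ m₃ : ℂ,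
    (∀ c₀ c₁ c₂ c₃ : ℂ, ∫ z, (c₀ + c₁ * ratio e z + c₂ * ratio e z ^ 2 + c₃ * (mass e / quad e z)) *
      ((‖quad e z‖ ^ (-N) : ℝ) : ℂ) =
        c₀ * (∫ z, ‖quad e z‖ ^ (-N) : ℝ) + c₁ * m₁ + c₂ * m₂ + c₃ * m₃) ∧
    (finrank ℝ E + 1 - 2 * N) * (∫ z, ‖quad e z‖ ^ (-N) : ℝ) + 2 * N * m₁ = 0 ∧
    (finrank ℝ E - 2 * N) * m₁ - 2 * m₃ + (4 + 2 * N) * m₂ = 0 ∧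
    (2 * N - 4) * (2 * m₃ - m₁) + (finrank ℝ E + 1 - 2 * N) *
      ((∫ z, ‖quad e z‖ ^ (-N) : ℝ) + 4 * m₃ - 4 * m₁) = 0 := by
  obtain ⟨C, hC, hI, hX, -⟩ := exists_norm_inv_quad_le he
  have hm := mass_pos he
  have hq := quad_ne_zero he
  have hXc := continuous_ratio he
  have hQc := continuous_quad e
  have hMc : Continuous fun z => (mass e : ℂ) / quad e z := continuous_const.div hQc hq
  have hMb : ∀ z, ‖(mass e : ℂ) / quad e z‖ ≤ mass e * C := fun z => by
    rw [div_eq_mul_inv, norm_mul, Complex.norm_real, Real.norm_of_nonneg hm.le]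
    exact mul_le_mul_of_nonneg_left (hI z) hm.le
  have hX2b : ∀ z, ‖ratio e z ^ 2‖ ≤ C ^ 2 := fun z => by
    rw [norm_pow]; exact pow_le_pow_left₀ (norm_nonneg _) (hX z) 2
  have i0 : Integrable fun z => ((‖quad e z‖ ^ (-N) : ℝ) : ℂ) :=
    (integrable_norm_quad he hN hd).ofReal
  have i1 := integrable_mul_norm_quad he hN hd hXc hX
  have i2 := integrable_mul_norm_quad he hN hd (h := fun z => ratio e z ^ 2) (hXc.pow 2) hX2b
  have i3 := integrable_mul_norm_quad he hN hd hMc hMb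
  have hlin : ∀ c₀ c₁ c₂ c₃ : ℂ, ∫ z, (c₀ + c₁ * ratio e z + c₂ * ratio e z ^ 2 +
      c₃ * (mass e / quad e z)) * ((‖quad e z‖ ^ (-N) : ℝ) : ℂ) =
        c₀ * (∫ z, ‖quad e z‖ ^ (-N) : ℝ) + c₁ * (∫ z, ratio e z * ((‖quad e z‖ ^ (-N) : ℝ) : ℂ)) +
        c₂ * (∫ z, ratio e z ^ 2 * ((‖quad e z‖ ^ (-N) : ℝ) : ℂ)) +
        c₃ * ∫ z, (mass e : ℂ) / quad e z * ((‖quad e z‖ ^ (-N) : ℝ) : ℂ) := by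
    intro c₀ c₁ c₂ c₃
    have i01 : Integrable fun z => c₀ * ((‖quad e z‖ ^ (-N) : ℝ) : ℂ) +
        c₁ * (ratio e z * ((‖quad e z‖ ^ (-N) : ℝ) : ℂ)) := (i0.const_mul _).add (i1.const_mul _)
    have h := integral_add_mul_add_mul i01 i2 i3 c₂ c₃
    rw [integral_add (i0.const_mul _) (i1.const_mul _), integral_const_mul, integral_const_mul] at h
    rw [← integral_complex_ofReal, ← h]
    congr 1; ext z; ring
  refine ⟨_, _, _, hlin, ?_, ?_, ?_⟩
  -- The three test functions are `1`, `ratio` and `conj quad / quad`; the first two use the field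
  -- `z·∇ - i ∂_n`, the third uses `z·∇ + i ∂_n`.
  · have h := (integral_weighted_dilation he hN hd (h := fun _ => 1) (hE := fun _ => 0)
      (hn := fun _ => 0) (K := 1) (by fun_prop) (by fun_prop) (by fun_prop) (by simp) (by simp)
      (by simp) (fun z => hasDerivAt_const _ _) (fun z => hasDerivAt_const _ _)).1
    have h2 := hlin (finrank ℝ E + 1 - 2 * N) (2 * N) 0 0
    simp only [zero_mul, add_zero] at h2
    rw [← h2, ← h]
    congr 1; ext z; ring
  · have h := (integral_weighted_dilation he hN hd (h := ratio e)
      (hE := fun z => -ratio e z - mass e / quad e z + 2 * ratio e z ^ 2)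
      (hn := fun z => -Complex.I * (mass e / quad e z) + 2 * Complex.I * ratio e z ^ 2)
      (K := C + mass e * C + 2 * C ^ 2) hXc (by fun_prop) (by fun_prop)
      (fun z => (hX z).trans (by nlinarith [mul_pos hm hC])) (fun z => ?_) (fun z => ?_)
      (fun z => ?_) (fun z => ?_)).1
    · have h2 := hlin 0 (finrank ℝ E - 2 * N) (4 + 2 * N) (-2)
      have h3 : ((finrank ℝ E : ℂ) - 2 * N) * (∫ z, ratio e z * ((‖quad e z‖ ^ (-N) : ℝ) : ℂ)) -
          2 * (∫ z, (mass e : ℂ) / quad e z * ((‖quad e z‖ ^ (-N) : ℝ) : ℂ)) +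
          (4 + 2 * N) * (∫ z, ratio e z ^ 2 * ((‖quad e z‖ ^ (-N) : ℝ) : ℂ)) =
          ∫ z, (0 + (finrank ℝ E - 2 * N) * ratio e z + (4 + 2 * N) * ratio e z ^ 2 +
            -2 * (mass e / quad e z)) * ((‖quad e z‖ ^ (-N) : ℝ) : ℂ) := by
        rw [h2]; ring
      refine h3.trans (Eq.trans ?_ h)
      congr 1; ext z
      linear_combination (-2 * ratio e z ^ 2 + (mass e / quad e z)) *
        ((‖quad e z‖ ^ (-N) : ℝ) : ℂ) * (-Complex.I_sq)
    · refine (norm_add_le _ _).trans (add_le_add ((norm_sub_le _ _).trans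
        (add_le_add ?_ (hMb z))) ?_)
      · rw [norm_neg]; exact hX z
      · rw [norm_mul, RCLike.norm_ofNat]
        exact mul_le_mul_of_nonneg_left (hX2b z) (by norm_num)
    · refine (norm_add_le _ _).trans ?_
      rw [norm_mul, norm_mul, norm_mul, norm_neg, Complex.norm_I, RCLike.norm_ofNat]
      linarith [hMb z, hX2b z]
    · refine ((hasDerivAt_num_smul e z).fun_div (hasDerivAt_quad_smul e z)
        (by simpa using hq z)).congr_deriv ?_
      have := hq z
      simp only [one_smul, ratio]
      field_simp
      ring
    · refine ((hasDerivAt_num_add e z).fun_div (hasDerivAt_quad_add e z)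
        (by simpa using hq z)).congr_deriv ?_
      have := hq z
      simp only [zero_smul, add_zero, ratio]
      field_simp
      ring
  -- The field `z·∇ + i ∂_n` multiplies `conj quad / quad` by `-4 conj ratio`. Since `conj quad ·
  -- conj ratio = 2 mass e - quad · ratio`, no conjugate survives and the relation closes on the
  -- same moments.
  · have hP : ∀ z, (starRingEnd ℂ) (quad e z) / quad e z =
        1 + 4 * (mass e / quad e z) - 4 * ratio e z := by
      intro z
      have := hq z
      unfold ratio
      field_simp
      simp only [quad, map_sub, map_mul, map_ofNat, Complex.conj_ofReal, Complex.conj_I]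
      push_cast
      ring
    have hPX : ∀ z, (starRingEnd ℂ) (quad e z) / quad e z * (starRingEnd ℂ) (ratio e z) =
        2 * (mass e / quad e z) - ratio e z := by
      intro z
      have h1 := hq z
      have h2 : (starRingEnd ℂ) (quad e z) ≠ 0 := by simpa using h1
      unfold ratio
      rw [map_div₀]
      field_simp
      simp
      ring
    have hPb : ∀ z, ‖(starRingEnd ℂ) (quad e z) / quad e z‖ ≤ 1 := fun z => by
      rw [norm_div, RCLike.norm_conj, div_self (norm_ne_zero_iff.2 (hq z))]
    have hXs : ∀ z, ‖2 * ratio e z - 2 * (starRingEnd ℂ) (ratio e z)‖ ≤ 4 * C := fun z => by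
      refine (norm_sub_le _ _).trans ?_
      rw [norm_mul, norm_mul, RCLike.norm_conj, RCLike.norm_ofNat]
      linarith [hX z]
    have hXs' : ∀ z, ‖2 * Complex.I * (ratio e z + (starRingEnd ℂ) (ratio e z))‖ ≤ 4 * C := by
      intro z
      rw [norm_mul, norm_mul, Complex.norm_I, RCLike.norm_ofNat]
      have := norm_add_le (ratio e z) ((starRingEnd ℂ) (ratio e z))
      rw [RCLike.norm_conj] at this
      linarith [hX z]
    have hPc : Continuous fun z => (starRingEnd ℂ) (quad e z) / quad e z :=
      (Complex.continuous_conj.comp hQc).div hQc hq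
    have hcc : Continuous fun z => (starRingEnd ℂ) (ratio e z) := Complex.continuous_conj.comp hXc
    have hconj : ∀ {f : ℝ → ℂ} {f' : ℂ} {s : ℝ}, HasDerivAt f f' s →
        HasDerivAt (fun s => (starRingEnd ℂ) (f s)) ((starRingEnd ℂ) f') s := fun hf => by
      simpa using hf.star
    have h := (integral_weighted_dilation he hN hd
      (h := fun z => (starRingEnd ℂ) (quad e z) / quad e z)
      (hE := fun z => (starRingEnd ℂ) (quad e z) / quad e z *
        (2 * ratio e z - 2 * (starRingEnd ℂ) (ratio e z)))
      (hn := fun z => (starRingEnd ℂ) (quad e z) / quad e z *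
        (2 * Complex.I * (ratio e z + (starRingEnd ℂ) (ratio e z))))
      (K := 1 + 4 * C) hPc (by fun_prop) (by fun_prop)
      (fun z => (hPb z).trans (by linarith)) (fun z => ?_) (fun z => ?_)
      (fun z => ?_) (fun z => ?_)).2
    · have h2 := hlin (finrank ℝ E + 1 - 2 * N) (-(2 * N - 4) - 4 * (finrank ℝ E + 1 - 2 * N)) 0
        (2 * (2 * N - 4) + 4 * (finrank ℝ E + 1 - 2 * N))
      refine (Eq.trans (by ring) h2.symm).trans (Eq.trans ?_ h)
      congr 1; ext z
      congr 1
      linear_combination (-(2 * N - 4) : ℂ) * hPX z - (finrank ℝ E + 1 - 2 * N : ℂ) * hP z -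
        2 * ((starRingEnd ℂ) (quad e z) / quad e z) *
        (ratio e z + (starRingEnd ℂ) (ratio e z)) * Complex.I_sq
    · rw [norm_mul]
      nlinarith [hPb z, hXs z, norm_nonneg ((starRingEnd ℂ) (quad e z) / quad e z),
        norm_nonneg (2 * ratio e z - 2 * (starRingEnd ℂ) (ratio e z))]
    · rw [norm_mul]
      nlinarith [hPb z, hXs' z, norm_nonneg ((starRingEnd ℂ) (quad e z) / quad e z),
        norm_nonneg (2 * Complex.I * (ratio e z + (starRingEnd ℂ) (ratio e z)))]
    · refine ((hconj (hasDerivAt_quad_smul e z)).fun_div (hasDerivAt_quad_smul e z)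
        (by simpa using hq z)).congr_deriv ?_
      have h1 := hq z
      have h2 : (starRingEnd ℂ) (quad e z) ≠ 0 := by simpa using h1
      simp only [one_smul, ratio, map_div₀, map_sub, map_mul, map_ofNat, Complex.conj_ofReal,
        Complex.conj_I]
      field_simp
      ring
    · refine ((hconj (hasDerivAt_quad_add e z)).fun_div (hasDerivAt_quad_add e z)
        (by simpa using hq z)).congr_deriv ?_
      have h1 := hq z
      have h2 : (starRingEnd ℂ) (quad e z) ≠ 0 := by simpa using h1
      simp only [zero_smul, add_zero, ratio, map_div₀, map_sub, map_mul, map_neg, map_ofNat,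
        Complex.conj_ofReal, Complex.conj_I]
      field_simp
      ring

/-- The second moment pairing occurring in the Euler-Lagrange equation determines the exponent. -/
lemma eq_of_second_moment {e : ℝ × E} (he : ‖e.2‖ < e.1) {N : ℝ} (hN : (finrank ℝ E : ℝ) < N)
    (hd : 1 ≤ finrank ℝ E)
    (h : (∫ z, ((finrank ℝ E + 1) * ratio e z ^ 2 - mass e / quad e z) *
      ((‖quad e z‖ ^ (-N) : ℝ) : ℂ)).re =
      finrank ℝ E * ((2 * N - finrank ℝ E - 1) / (2 * N)) ^ 2 * ∫ z, ‖quad e z‖ ^ (-N)) :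
    N = finrank ℝ E + 1 := by
  obtain ⟨m₁, m₂, m₃, hlin, h1, h2, h3⟩ := exists_moments he hN hd
  have hi := hlin 0 0 (finrank ℝ E + 1) (-1)
  have hi' : ∫ z, ((finrank ℝ E + 1) * ratio e z ^ 2 - mass e / quad e z) *
      ((‖quad e z‖ ^ (-N) : ℝ) : ℂ) = (finrank ℝ E + 1) * m₂ - m₃ := by
    rw [show (finrank ℝ E + 1) * m₂ - m₃ = 0 * ((∫ z, ‖quad e z‖ ^ (-N) : ℝ) : ℂ) + 0 * m₁ +
      (finrank ℝ E + 1) * m₂ + -1 * m₃ by ring, ← hi]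
    congr 1; ext z; ring
  rw [hi'] at h
  have hm0 : 0 < ∫ z, ‖quad e z‖ ^ (-N) := by
    have hc : Continuous fun z => ‖quad e z‖ ^ (-N) :=
      (continuous_quad e).norm.rpow_const fun z => Or.inl (norm_pos_iff.2 (quad_ne_zero he z)).ne'
    refine integral_pos_of_integrable_nonneg_nonzero (x := 0) hc (integrable_norm_quad he hN hd)
      (fun z => by positivity) ?_
    exact (Real.rpow_pos_of_pos (norm_pos_iff.2 (quad_ne_zero he 0)) _).ne'
  set m := ∫ z, ‖quad e z‖ ^ (-N) with hm
  generalize finrank ℝ E = d at *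
  have e1 := congrArg Complex.re h1
  have e2 := congrArg Complex.re h2
  have e3 := congrArg Complex.re h3
  simp at e1 e2 e3 h
  have hd1 : (1:ℝ) ≤ d := by exact_mod_cast hd
  generalize m₁.re = a at *
  generalize m₂.re = b at *
  generalize m₃.re = c at *
  have hNpos : 0 < 2 * N := by linarith
  have hk : (2 * N - d - 1) / (2 * N) * (2 * N) = 2 * N - d - 1 := div_mul_cancel₀ _ hNpos.ne'
  have hkpos : 0 < (2 * N - d - 1) / (2 * N) := by
    apply div_pos _ hNpos; linarith
  generalize (2 * N - d - 1) / (2 * N) = k at *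
  have ha : a = k * m := by
    apply mul_left_cancel₀ hNpos.ne'
    linear_combination e1 - m * hk
  -- With `a`, `b`, `c` the real parts of the moments of `ratio`, `ratio²` and `mass/quad`,
  -- eliminating `b` and `c` from the relations and the hypothesis leaves `d a (N - (d+1)) = 0`.
  -- Here `a = k m` is positive.
  have hc : (d - 1 - N) * c = (d - N) * a := by
    linear_combination e3 / 4 - e1 / 4
  have key : d * a * (N - (d + 1)) = 0 := by
    linear_combination (-1 / 2) * (N * (4 + 2 * N) * h - N * (d + 1) * e2 - 2 * N * hc -
      N * (4 + 2 * N) * d * k * ha + (2 + N) * d * a * hk)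
  have ha0 : 0 < a := by rw [ha]; positivity
  have := (mul_eq_zero.1 key).resolve_left (by positivity)
  linarith

end Spacetime

/-! ### Admissibility, and the exponent forced by the Euler-Lagrange equation. -/

section HalfWave

variable {d : ℕ}

local notation "𝔼" => EuclideanSpace ℝ (Fin d)

/-- Real parts of the parameters give a vector `e` of the open forward cone; imaginary parts only
translate the wave by `z₀`. -/
lemma IsFoschian.exists_expo {F : 𝔼 → ℂ} (hF : IsFoschian F) :
    ∃ (e z₀ : ℝ × 𝔼) (c : ℂ), ‖e.2‖ < e.1 ∧
      F =ᵐ[volume] fun ξ => (‖ξ‖ : ℂ)⁻¹ * Complex.exp (expo e z₀ ξ + c) := by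
  obtain ⟨A, c, b, hA, hF⟩ := hF
  refine ⟨(-A.re, WithLp.toLp 2 fun j => (b j).re), (A.im, WithLp.toLp 2 fun j => (b j).im), c,
    ?_, ?_⟩
  · rw [EuclideanSpace.norm_eq]
    simpa [sq_abs] using hA
  · filter_upwards [hF] with ξ hξ
    rw [hξ]
    congr 3
    simp only [expo, rho, phase, PiLp.inner_apply]
    apply Complex.ext
    · simp [Complex.mul_re, mul_comm, add_comm]
    · simp [Complex.mul_im, mul_comm]

lemma coneTransform_eq (φ : SchwartzMap (ℝ × 𝔼) ℂ) (ξ : 𝔼) :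
    coneTransform φ ξ = ∫ z, Complex.exp (Complex.I * (phase z ξ : ℂ)) * φ z := rfl

lemma isHalfWave_of_integrable {G : 𝔼 → ℂ} (hG : Integrable G) :
    IsHalfWave G fun z => (((2 * Real.pi) ^ d)⁻¹ : ℝ) *
      ∫ ξ, G ξ * Complex.exp (Complex.I * (phase z ξ : ℂ)) := by
  intro φ
  have hφ : Integrable (fun z => φ z) := φ.integrable
  have h1 : Integrable (fun y : (ℝ × 𝔼) × 𝔼 =>
      G y.2 * Complex.exp (Complex.I * (phase y.1 y.2 : ℂ)) * φ y.1)
      ((volume : Measure (ℝ × 𝔼)).prod (volume : Measure 𝔼)) := by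
    have h2 : Integrable (fun y : (ℝ × 𝔼) × 𝔼 => φ y.1 * G y.2)
      ((volume : Measure (ℝ × 𝔼)).prod (volume : Measure 𝔼)) := hφ.mul_prod hG
    have h3 : Continuous fun y : (ℝ × 𝔼) × 𝔼 =>
        Complex.exp (Complex.I * (phase y.1 y.2 : ℂ)) := by
      unfold phase; fun_prop
    refine (h2.bdd_mul (c := 1) h3.aestronglyMeasurable (Filter.Eventually.of_forall fun y => ?_)).congr
      (Filter.Eventually.of_forall fun y => ?_)
    · rw [mul_comm, Complex.norm_exp_ofReal_mul_I]
    · simp only; ring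
  calc ∫ z, (((2 * Real.pi) ^ d)⁻¹ : ℝ) *
        (∫ ξ, G ξ * Complex.exp (Complex.I * (phase z ξ : ℂ))) * φ z
      = (((2 * Real.pi) ^ d)⁻¹ : ℝ) *
        ∫ z, ∫ ξ, G ξ * Complex.exp (Complex.I * (phase z ξ : ℂ)) * φ z := by
        rw [← integral_const_mul]
        congr 1; ext z
        rw [integral_mul_const, mul_assoc]
    _ = (((2 * Real.pi) ^ d)⁻¹ : ℝ) *
        ∫ ξ, ∫ z, G ξ * Complex.exp (Complex.I * (phase z ξ : ℂ)) * φ z := by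
        rw [integral_integral_swap h1]
    _ = _ := by
        congr 2; ext ξ
        rw [coneTransform_eq, ← integral_const_mul]
        congr 1; ext z; ring

lemma IsHalfWave.congr {G G' : 𝔼 → ℂ} {v v' : ℝ × 𝔼 → ℂ} (h : IsHalfWave G v)
    (hG : G =ᵐ[volume] G') (hv : v =ᵐ[volume] v') : IsHalfWave G' v' := by
  intro φ
  have h1 : ∫ z, v' z * φ z = ∫ z, v z * φ z := by
    refine integral_congr_ae ?_
    filter_upwards [hv] with z hz; rw [hz]
  have h2 : ∫ ξ, G' ξ * coneTransform φ ξ = ∫ ξ, G ξ * coneTransform φ ξ := by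
    refine integral_congr_ae ?_
    filter_upwards [hG] with z hz; rw [hz]
  rw [h1, h2, h φ]

lemma integrable_freqMeasure_iff {B : Type*} [NormedAddCommGroup B] [NormedSpace ℝ B] {p : ℝ}
    {f : 𝔼 → B} :
    Integrable f (freqMeasure d p) ↔ Integrable fun ξ => (‖ξ‖ ^ (p - 1)) • f ξ := by
  unfold freqMeasure
  rw [integrable_withDensity_iff_integrable_smul₀']
  · refine integrable_congr (Filter.Eventually.of_forall fun ξ => ?_)
    simp only
    rw [ENNReal.toReal_ofReal (by positivity)]
  · fun_prop
  · exact Filter.Eventually.of_forall fun ξ => ENNReal.ofReal_lt_top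

/-- The weight `|ξ|^(p-1)` against `|ξ|^(-p)` leaves `|ξ|⁻¹` for every `p`, which is locally
integrable since `d ≥ 2`. -/
lemma memLp_freq_of_le (hd : 2 ≤ d) {p σ K : ℝ} (hp : 1 < p) (hσ : 0 < σ) {G : 𝔼 → ℂ}
    (hG : AEStronglyMeasurable G volume)
    (hb : ∀ᵐ ξ, ‖G ξ‖ ≤ K * (‖ξ‖⁻¹ * Real.exp (-(σ * ‖ξ‖)))) :
    MemLp G (ENNReal.ofReal p) (freqMeasure d p) := by
  have : Nontrivial 𝔼 := Module.nontrivial_of_finrank_pos (R := ℝ) (by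
    rw [finrank_euclideanSpace_fin]; omega)
  have hac : freqMeasure d p ≪ volume := withDensity_absolutelyContinuous _ _
  have hp0 : 0 < p := by linarith
  rw [← integrable_norm_rpow_iff (hG.mono_ac hac) (by simpa using hp0) ENNReal.ofReal_ne_top,
    ENNReal.toReal_ofReal hp0.le]
  have hm : AEStronglyMeasurable (fun ξ => ‖G ξ‖ ^ p) (volume : Measure 𝔼) :=
    (hG.norm.aemeasurable.pow_const p).aestronglyMeasurable
  refine integrable_freqMeasure_iff.2 ?_
  have hw := (integrable_norm_pow_inv_exp (E := 𝔼) (by rw [finrank_euclideanSpace_fin]; exact hd)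
    0 (mul_pos hp0 hσ)).const_mul (|K| ^ p)
  refine hw.mono' ?_ ?_
  · exact (by fun_prop : Measurable fun ξ : 𝔼 => ‖ξ‖ ^ (p - 1)).aestronglyMeasurable.mul hm
  · filter_upwards [hb, Measure.ae_ne volume (0:𝔼)] with ξ hξ hξ0
    have hn : 0 < ‖ξ‖ := norm_pos_iff.2 hξ0
    rw [smul_eq_mul, Real.norm_of_nonneg (by positivity)]
    have h3 : ‖G ξ‖ ^ p ≤ |K| ^ p * (‖ξ‖ ^ (-p) * Real.exp (-(p * σ * ‖ξ‖))) := by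
      calc ‖G ξ‖ ^ p ≤ (|K| * (‖ξ‖⁻¹ * Real.exp (-(σ * ‖ξ‖)))) ^ p := by
            apply Real.rpow_le_rpow (norm_nonneg _) _ hp0.le
            exact hξ.trans (by gcongr; exact le_abs_self K)
        _ = _ := by
            rw [Real.mul_rpow (by positivity) (by positivity),
              Real.mul_rpow (by positivity) (by positivity), Real.inv_rpow hn.le,
              Real.rpow_neg hn.le, ← Real.exp_mul]
            congr 3; ring_nf
    calc _ ≤ ‖ξ‖ ^ (p - 1) * (|K| ^ p * (‖ξ‖ ^ (-p) * Real.exp (-(p * σ * ‖ξ‖)))) := by gcongr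
      _ = |K| ^ p * ((‖ξ‖ ^ (p - 1) * ‖ξ‖ ^ (-p)) * Real.exp (-(p * σ * ‖ξ‖))) := by ring
      _ = _ := by
        rw [← Real.rpow_add hn, show p - 1 + -p = -1 by ring, Real.rpow_neg_one, pow_zero, mul_one]

lemma memLp_wave_of_le (hd : 2 ≤ d) {q K : ℝ} (hq : 0 < q)
    (hN : (d : ℝ) < q * ((d : ℝ) - 1) / 2) {e : ℝ × 𝔼} (he : ‖e.2‖ < e.1) (z₀ : ℝ × 𝔼)
    {v : ℝ × 𝔼 → ℂ} (hv : AEStronglyMeasurable v volume)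
    (hb : ∀ z, ‖v z‖ ≤ K * ‖quad e (z + z₀)‖ ^ (-(((d : ℝ) - 1) / 2))) :
    MemLp v (ENNReal.ofReal q) volume := by
  rw [← integrable_norm_rpow_iff hv (by simpa using hq) ENNReal.ofReal_ne_top,
    ENNReal.toReal_ofReal hq.le]
  have h1 := (integrable_norm_quad he (N := q * ((d : ℝ) - 1) / 2)
    (by rwa [finrank_euclideanSpace_fin]) (by rw [finrank_euclideanSpace_fin]; omega)).comp_add_right z₀
  refine (h1.const_mul (|K| ^ q)).mono' (hv.norm.aemeasurable.pow_const q).aestronglyMeasurable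
    (Filter.Eventually.of_forall fun z => ?_)
  rw [Real.norm_of_nonneg (by positivity)]
  calc ‖v z‖ ^ q ≤ (|K| * ‖quad e (z + z₀)‖ ^ (-(((d : ℝ) - 1) / 2))) ^ q := by
        apply Real.rpow_le_rpow (norm_nonneg _) _ hq.le
        exact (hb z).trans (by gcongr; exact le_abs_self K)
    _ = _ := by
        rw [Real.mul_rpow (by positivity) (by positivity), ← Real.rpow_mul (norm_nonneg _)]
        congr 2; ring

/-- Multiples `P F` of an `𝔉`-function are admissible once the wave has the decay of the
wave of `F`. -/
lemma isAdmissible_mul (hd : 2 ≤ d) {p q K : ℝ} (hp : 1 < p) (hq : 0 < q)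
    (hN : (d : ℝ) < q * ((d : ℝ) - 1) / 2) {e : ℝ × 𝔼} (he : ‖e.2‖ < e.1) (z₀ : ℝ × 𝔼) (c : ℂ)
    {P : 𝔼 → ℂ} (hP : Continuous P) (hPb : ∀ ξ, ‖P ξ‖ ≤ K * Real.exp (rho e ξ / 2))
    (hb : ∀ z, ‖∫ ξ, (‖ξ‖ : ℂ)⁻¹ * P ξ * Complex.exp (expo e z ξ)‖ ≤
      K * ‖quad e z‖ ^ (-(((d : ℝ) - 1) / 2)))
    {G : 𝔼 → ℂ} (hG : G =ᵐ[volume] fun ξ => (‖ξ‖ : ℂ)⁻¹ * P ξ * Complex.exp (expo e z₀ ξ + c)) :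
    IsAdmissible p q G fun z => (((2 * Real.pi) ^ d)⁻¹ : ℝ) * Complex.exp c *
      ∫ ξ, (‖ξ‖ : ℂ)⁻¹ * P ξ * Complex.exp (expo e (z + z₀) ξ) := by
  have : Nontrivial 𝔼 := Module.nontrivial_of_finrank_pos (R := ℝ) (by
    rw [finrank_euclideanSpace_fin]; omega)
  have hE := continuous_expo e z₀
  have hσ : 0 < (e.1 - ‖e.2‖) / 2 := half_pos (sub_pos.2 he)
  have hmi : Measurable fun ξ : 𝔼 => (‖ξ‖ : ℂ)⁻¹ := by fun_prop
  have hG0m : AEStronglyMeasurable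
      (fun ξ : 𝔼 => (‖ξ‖ : ℂ)⁻¹ * P ξ * Complex.exp (expo e z₀ ξ + c)) volume :=
    ((hmi.mul hP.measurable).mul (by fun_prop)).aestronglyMeasurable
  have hK : 0 ≤ K := by
    have := (norm_nonneg _).trans (hPb 0)
    exact nonneg_of_mul_nonneg_left this (Real.exp_pos _)
  have hG0b : ∀ ξ : 𝔼, ‖(‖ξ‖ : ℂ)⁻¹ * P ξ * Complex.exp (expo e z₀ ξ + c)‖ ≤
      (K * Real.exp c.re) * (‖ξ‖⁻¹ * Real.exp (-((e.1 - ‖e.2‖) / 2 * ‖ξ‖))) := by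
    intro ξ
    rw [norm_mul, norm_mul, norm_inv, Complex.norm_real, norm_norm, Complex.exp_add, norm_mul,
      norm_exp_expo, Complex.norm_exp c]
    calc _ ≤ ‖ξ‖⁻¹ * (K * Real.exp (rho e ξ / 2)) * (Real.exp (-rho e ξ) * Real.exp c.re) := by
          gcongr; exact hPb ξ
      _ = (K * Real.exp c.re) * (‖ξ‖⁻¹ * (Real.exp (rho e ξ / 2) * Real.exp (-rho e ξ))) := by ring
      _ ≤ _ := by
        rw [← Real.exp_add]
        have := rho_lower e ξ
        gcongr
        linarith
  refine ⟨?_, ?_, ?_⟩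
  · refine memLp_freq_of_le hd hp hσ (hG0m.congr hG.symm) (K := K * Real.exp c.re) ?_
    filter_upwards [hG] with ξ hξ
    rw [hξ]; exact hG0b ξ
  · refine memLp_wave_of_le hd hq hN he z₀ (K := ((2 * Real.pi) ^ d)⁻¹ * Real.exp c.re * K) ?_ ?_
    · refine AEStronglyMeasurable.const_mul ?_ _
      refine StronglyMeasurable.aestronglyMeasurable ?_
      refine StronglyMeasurable.integral_prod_right (f := fun (z : ℝ × 𝔼) (ξ : 𝔼) =>
        (‖ξ‖ : ℂ)⁻¹ * P ξ * Complex.exp (expo e (z + z₀) ξ)) ?_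
      refine Measurable.stronglyMeasurable ?_
      have h1 : Continuous fun y : (ℝ × 𝔼) × 𝔼 => Complex.exp (expo e (y.1 + z₀) y.2) := by
        unfold expo rho phase; fun_prop
      exact ((hmi.comp measurable_snd).mul (hP.measurable.comp measurable_snd)).mul h1.measurable
    · intro z
      rw [norm_mul, norm_mul, Complex.norm_real, Real.norm_of_nonneg (by positivity),
        Complex.norm_exp, mul_assoc _ K]
      gcongr
      exact hb _
  · have hint : Integrable fun ξ : 𝔼 => (‖ξ‖ : ℂ)⁻¹ * P ξ * Complex.exp (expo e z₀ ξ + c) := by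
      refine ((integrable_norm_pow_inv_exp (E := 𝔼) (by rw [finrank_euclideanSpace_fin]; exact hd)
        0 hσ).const_mul (K * Real.exp c.re)).mono' hG0m (Filter.Eventually.of_forall fun ξ => ?_)
      simpa using hG0b ξ
    refine (isHalfWave_of_integrable hint).congr hG.symm (Filter.Eventually.of_forall fun z => ?_)
    simp only
    rw [mul_assoc, ← integral_const_mul (Complex.exp c)]
    congr 2; ext ξ
    rw [add_comm z z₀]
    have := expo_add_smul e z₀ 0 z 1 ξ
    rw [smul_zero, add_zero, one_smul] at this
    rw [this]
    have h0 : expo 0 z ξ = Complex.I * phase z ξ := by simp [expo, rho]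
    rw [h0]
    simp only [Complex.exp_add, Complex.ofReal_one, one_mul]
    ring

/-- Smooth compactly supported functions are Schwartz, and `q ≥ 1` makes both waves locally
integrable, so the distributional identity determines the wave. This allows the unspecified wave in
`IsCriticalPoint` to be replaced by `foschiWave`. -/
lemma IsAdmissible.ae_eq {p q : ℝ} (hq : 1 ≤ q) {G : 𝔼 → ℂ} {v v' : ℝ × 𝔼 → ℂ}
    (h : IsAdmissible p q G v) (h' : IsAdmissible p q G v') : v =ᵐ[volume] v' := by
  have hq' : 1 ≤ ENNReal.ofReal q := by simpa using hq
  refine ae_eq_of_integral_contDiff_smul_eq (h.memLp_wave.locallyIntegrable hq')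
    (h'.memLp_wave.locallyIntegrable hq') fun g hg hgc => ?_
  have hc : HasCompactSupport fun z => (g z : ℂ) := hgc.comp_left (g := Complex.ofReal) (by simp)
  have hs : ContDiff ℝ ∞ fun z => (g z : ℂ) := Complex.ofRealCLM.contDiff.comp hg
  have h1 := h.isHalfWave (hc.toSchwartzMap hs)
  have h2 := h'.isHalfWave (hc.toSchwartzMap hs)
  rw [← h2] at h1
  simpa [Complex.real_smul, mul_comm] using h1

lemma norm_rpow_sub_two_mul {q : ℝ} (hq : 0 < q) (u : ℂ) :
    ((‖u‖ ^ (q - 2) : ℝ) : ℂ) * (starRingEnd ℂ) u * u = ((‖u‖ ^ q : ℝ) : ℂ) := by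
  rw [mul_assoc, Complex.conj_mul', ← Complex.ofReal_pow, ← Complex.ofReal_mul]
  congr 1
  rcases eq_or_ne u 0 with rfl | hu
  · simp [Real.zero_rpow hq.ne']
  · have : 0 < ‖u‖ := norm_pos_iff.2 hu
    rw [← Real.rpow_natCast, ← Real.rpow_add this]
    congr 1; push_cast; ring

/-- The wave of an `𝔉`-function. -/
noncomputable def foschiWave (e z₀ : ℝ × 𝔼) (c : ℂ) (z : ℝ × 𝔼) : ℂ :=
  (((2 * Real.pi) ^ d)⁻¹ : ℝ) * Complex.exp c * coneInt e (z + z₀)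

lemma norm_foschiWave (hd : 2 ≤ d) {e : ℝ × 𝔼} (he : ‖e.2‖ < e.1) (z₀ : ℝ × 𝔼) (c : ℂ) :
    ∃ κ : ℝ, 0 < κ ∧ ∀ z, ‖foschiWave e z₀ c z‖ =
      κ * ‖quad e (z + z₀)‖ ^ (-(((d : ℝ) - 1) / 2)) := by
  obtain ⟨C, hC, h⟩ := norm_coneInt (E := 𝔼) (by rwa [finrank_euclideanSpace_fin]) he
  rw [finrank_euclideanSpace_fin] at h
  refine ⟨((2 * Real.pi) ^ d)⁻¹ * Real.exp c.re * C, by positivity, fun z => ?_⟩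
  rw [foschiWave, norm_mul, norm_mul, Complex.norm_real, Real.norm_of_nonneg (by positivity),
    Complex.norm_exp, h]
  ring

lemma isAdmissible_foschiWave (hd : 2 ≤ d) {p q : ℝ} (hp : 1 < p) (hq : 0 < q)
    (hN : (d : ℝ) < q * ((d : ℝ) - 1) / 2) {e : ℝ × 𝔼} (he : ‖e.2‖ < e.1) (z₀ : ℝ × 𝔼) (c : ℂ)
    {F : 𝔼 → ℂ} (hF : F =ᵐ[volume] fun ξ => (‖ξ‖ : ℂ)⁻¹ * Complex.exp (expo e z₀ ξ + c)) :
    IsAdmissible p q F (foschiWave e z₀ c) := by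
  obtain ⟨C, hC, h⟩ := norm_coneInt (E := 𝔼) (by rwa [finrank_euclideanSpace_fin]) he
  rw [finrank_euclideanSpace_fin] at h
  have := isAdmissible_mul hd hp hq hN he z₀ c (P := fun _ => 1) (K := 1 + C) continuous_const
    (fun ξ => ?_) (fun z => ?_) (G := F) (by simpa using hF)
  · refine (congrArg (IsAdmissible p q F) ?_).mp this
    ext z
    simp only [foschiWave, coneInt, mul_one]
  · have h1 := (mul_nonneg (sub_pos.2 he).le (norm_nonneg ξ)).trans (rho_lower e ξ)
    have h2 : 1 ≤ Real.exp (rho e ξ / 2) := Real.one_le_exp (by linarith)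
    rw [norm_one]; nlinarith
  · have := (h z).le
    simp only [mul_one]
    refine this.trans ?_
    gcongr
    linarith

lemma rho_sq_mul_wave (hd : 2 ≤ d) {e : ℝ × 𝔼} (he : ‖e.2‖ < e.1) (z : ℝ × 𝔼) :
    ∫ ξ, (‖ξ‖ : ℂ)⁻¹ * (rho e ξ : ℂ) ^ 2 * Complex.exp (expo e z ξ) =
      ((d : ℂ) - 1) * ((d + 1) * ratio e z ^ 2 - mass e / quad e z) * coneInt e z := by
  have := integral_rho_sq_mul (E := 𝔼) (by rwa [finrank_euclideanSpace_fin]) he z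
  rw [finrank_euclideanSpace_fin] at this
  rw [this, ratio]

/-- This is the second test function for the Euler-Lagrange equation. The factor in front of
`foschiWave` is bounded, so the decay of the wave is unchanged. -/
lemma isAdmissible_rho_sq (hd : 2 ≤ d) {p q : ℝ} (hp : 1 < p) (hq : 0 < q)
    (hN : (d : ℝ) < q * ((d : ℝ) - 1) / 2) {e : ℝ × 𝔼} (he : ‖e.2‖ < e.1) (z₀ : ℝ × 𝔼) (c : ℂ) :
    IsAdmissible p q (fun ξ => (‖ξ‖ : ℂ)⁻¹ * (rho e ξ : ℂ) ^ 2 * Complex.exp (expo e z₀ ξ + c))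
      fun z => ((d : ℂ) - 1) * ((d + 1) * ratio e (z + z₀) ^ 2 - mass e / quad e (z + z₀)) *
        foschiWave e z₀ c z := by
  obtain ⟨C, hC, h⟩ := norm_coneInt (E := 𝔼) (by rwa [finrank_euclideanSpace_fin]) he
  rw [finrank_euclideanSpace_fin] at h
  obtain ⟨B, hB, hI, hX, -⟩ := exists_norm_inv_quad_le he
  have hm := mass_pos he
  have hd1 : (0:ℝ) ≤ (d:ℝ) - 1 := by
    have : (2:ℝ) ≤ d := by exact_mod_cast hd
    linarith
  set M := ((d : ℝ) - 1) * ((d + 1) * B ^ 2 + mass e * B) with hM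
  have hM0 : 0 ≤ M := by positivity
  have hrc := continuous_rho e
  have := isAdmissible_mul hd hp hq hN he z₀ c (P := fun ξ => (rho e ξ : ℂ) ^ 2) (K := 8 + M * C)
    (by fun_prop) (fun ξ => ?_) (fun z => ?_) (G := _) (Filter.EventuallyEq.refl _ _)
  · refine (congrArg (IsAdmissible p q _) ?_).mp this
    ext z
    rw [rho_sq_mul_wave hd he, foschiWave]
    ring
  · have h1 := (mul_nonneg (sub_pos.2 he).le (norm_nonneg ξ)).trans (rho_lower e ξ)
    -- The quadratic term of the exponential series at `rho / 2` is `rho² / 8`, whence the `8` in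
    -- the constant `K`.
    have h2 := Real.pow_div_factorial_le_exp (rho e ξ / 2) (by linarith) 2
    rw [norm_pow, Complex.norm_real, Real.norm_of_nonneg h1]
    have h3 : rho e ξ ^ 2 ≤ 8 * Real.exp (rho e ξ / 2) := by
      norm_num at h2; nlinarith
    have h4 : 0 ≤ M * C * Real.exp (rho e ξ / 2) := by positivity
    linarith
  · rw [rho_sq_mul_wave hd he, norm_mul, h]
    have h1 : ‖((d : ℂ) - 1) * ((d + 1) * ratio e z ^ 2 - mass e / quad e z)‖ ≤ M := by
      have e1 : ‖(d : ℂ) - 1‖ = (d : ℝ) - 1 := by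
        have : (d : ℂ) - 1 = ((d - 1 : ℝ) : ℂ) := by push_cast; rfl
        rw [this, Complex.norm_real, Real.norm_of_nonneg hd1]
      have e2 : ‖(d : ℂ) + 1‖ = (d : ℝ) + 1 := by
        have : (d : ℂ) + 1 = ((d + 1 : ℝ) : ℂ) := by push_cast; rfl
        rw [this, Complex.norm_real, Real.norm_of_nonneg (by positivity)]
      rw [norm_mul, e1, hM]
      gcongr
      refine (norm_sub_le _ _).trans ?_
      rw [norm_mul, e2, norm_pow, div_eq_mul_inv, norm_mul, Complex.norm_real,
        Real.norm_of_nonneg hm.le]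
      gcongr
      · exact hX z
      · exact hI z
    rw [← mul_assoc]
    gcongr
    nlinarith

/-- The left-hand side of the Euler-Lagrange equation for a multiple of the wave. -/
lemma integral_foschiWave_mul {q κ : ℝ} (hq : 0 < q) {e z₀ : ℝ × 𝔼} {c : ℂ} (hκ0 : 0 ≤ κ)
    (hκ : ∀ z, ‖foschiWave e z₀ c z‖ = κ * ‖quad e (z + z₀)‖ ^ (-(((d : ℝ) - 1) / 2)))
    (r : ℝ × 𝔼 → ℂ) :
    ∫ z, ((‖foschiWave e z₀ c z‖ ^ (q - 2) : ℝ) : ℂ) * (starRingEnd ℂ) (foschiWave e z₀ c z) *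
        (r (z + z₀) * foschiWave e z₀ c z) =
      ((κ ^ q : ℝ) : ℂ) * ∫ z, r z * ((‖quad e z‖ ^ (-(q * ((d : ℝ) - 1) / 2)) : ℝ) : ℂ) := by
  rw [← integral_add_right_eq_self
    (fun z => r z * ((‖quad e z‖ ^ (-(q * ((d : ℝ) - 1) / 2)) : ℝ) : ℂ)) z₀, ← integral_const_mul]
  congr 1; ext z
  have h1 := norm_rpow_sub_two_mul hq (foschiWave e z₀ c z)
  have h2 : ‖foschiWave e z₀ c z‖ ^ q =
      κ ^ q * ‖quad e (z + z₀)‖ ^ (-(q * ((d : ℝ) - 1) / 2)) := by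
    rw [hκ, Real.mul_rpow hκ0 (by positivity), ← Real.rpow_mul (norm_nonneg _)]
    congr 2; ring
  rw [h2] at h1
  push_cast at h1 ⊢
  linear_combination r (z + z₀) * h1

/-- The right-hand side of the Euler-Lagrange equation for a multiple of an `𝔉`-function. -/
lemma integral_freq_mul (hd : 2 ≤ d) {p : ℝ} (hp : 1 < p) {e z₀ : ℝ × 𝔼} {c : ℂ}
    {F G : 𝔼 → ℂ} (hF : F =ᵐ[volume] fun ξ => (‖ξ‖ : ℂ)⁻¹ * Complex.exp (expo e z₀ ξ + c))
    (P : 𝔼 → ℂ)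
    (hG : G =ᵐ[volume] fun ξ => (‖ξ‖ : ℂ)⁻¹ * P ξ * Complex.exp (expo e z₀ ξ + c)) :
    ∫ ξ, ((‖F ξ‖ ^ (p - 2) : ℝ) : ℂ) * (starRingEnd ℂ) (F ξ) * G ξ * ((‖ξ‖ ^ (p - 1) : ℝ) : ℂ) =
      (Real.exp (p * c.re) : ℂ) *
        ∫ ξ, (‖ξ‖ : ℂ)⁻¹ * P ξ * Complex.exp (expo (p • e) 0 ξ) := by
  have : Nontrivial 𝔼 := Module.nontrivial_of_finrank_pos (R := ℝ) (by
    rw [finrank_euclideanSpace_fin]; omega)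
  rw [← integral_const_mul]
  refine integral_congr_ae ?_
  filter_upwards [hF, hG, Measure.ae_ne volume (0:𝔼)] with ξ h1 h2 h0
  have hn : 0 < ‖ξ‖ := norm_pos_iff.2 h0
  have h3 := norm_rpow_sub_two_mul (q := p) (by linarith) (F ξ)
  have h4 : G ξ = P ξ * F ξ := by rw [h1, h2]; ring
  have h5 : ‖F ξ‖ ^ p * ‖ξ‖ ^ (p - 1) = ‖ξ‖⁻¹ * (Real.exp (p * c.re) * Real.exp (-(p * rho e ξ))) := by
    rw [h1, norm_mul, norm_inv, Complex.norm_real, norm_norm, Complex.exp_add, norm_mul,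
      norm_exp_expo, Complex.norm_exp, Real.mul_rpow (by positivity) (by positivity),
      ← Real.exp_add, ← Real.exp_mul, ← Real.exp_add, Real.inv_rpow hn.le, ← Real.rpow_neg hn.le,
      mul_right_comm, ← Real.rpow_add hn, show -p + (p - 1) = -1 by ring, Real.rpow_neg_one]
    congr 2; ring
  have h6 : Complex.exp (expo (p • e) 0 ξ) = ((Real.exp (-(p * rho e ξ)) : ℝ) : ℂ) := by
    rw [Complex.ofReal_exp]
    congr 1
    simp [expo, rho_smul_left, phase]
  have h7 := congrArg (fun x : ℝ => (x : ℂ)) h5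
  rw [h6, h4]
  push_cast at h3 h7 ⊢
  linear_combination P ξ * ((‖ξ‖ ^ (p - 1) : ℝ) : ℂ) * h3 + P ξ * h7

/-- An `𝔉`-function that is a critical point forces the exponent `q = 2 (d + 1) / (d - 1)`. -/
lemma exponent_of_isCriticalPoint (hd : 2 ≤ d) {p q : ℝ} (hp : 1 < p) (hq : 1 ≤ q)
    (hN : (d : ℝ) < q * ((d : ℝ) - 1) / 2) (hpq : q * ((d : ℝ) - 1) * (p - 1) = (d + 1) * p)
    {F : 𝔼 → ℂ} (hF : IsFoschian F) (hcrit : IsCriticalPoint p q F) :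
    q * ((d : ℝ) - 1) / 2 = d + 1 := by
  have hq0 : 0 < q := by linarith
  obtain ⟨e, z₀, c, he, hFe⟩ := hF.exists_expo
  obtain ⟨u, hu, lam, hEL⟩ := hcrit
  obtain ⟨κ, hκ0, hκ⟩ := norm_foschiWave hd he z₀ c
  have hadm := isAdmissible_foschiWave hd hp hq0 hN he z₀ c hFe
  have hadm2 := isAdmissible_rho_sq hd hp hq0 hN he z₀ c
  have hae := hu.ae_eq hq hadm
  have hp0 : 0 < p := by linarith
  have hd1 : (0:ℝ) < (d:ℝ) - 1 := by
    have : (2:ℝ) ≤ d := by exact_mod_cast hd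
    linarith
  have hpe : ‖(p • e).2‖ < (p • e).1 := by
    simp only [Prod.smul_fst, Prod.smul_snd, norm_smul, Real.norm_eq_abs, abs_of_pos hp0,
      smul_eq_mul]
    gcongr
  have hEL' : ∀ G v, IsAdmissible p q G v → EulerLagrange p q lam F (foschiWave e z₀ c) G v := by
    intro G v hv
    have h1 := hEL G v hv
    unfold EulerLagrange at h1 ⊢
    rw [← h1]
    congr 1
    refine integral_congr_ae ?_
    filter_upwards [hae] with z hz
    rw [hz]
  have h1 := hEL' _ _ hadm
  have h2 := hEL' _ _ hadm2
  unfold EulerLagrange at h1 h2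
  set N := q * ((d : ℝ) - 1) / 2 with hNdef
  have l1 := integral_foschiWave_mul hq0 hκ0.le hκ (fun _ => 1)
  have l2 := integral_foschiWave_mul hq0 hκ0.le hκ
    (fun z => ((d : ℂ) - 1) * ((d + 1) * ratio e z ^ 2 - mass e / quad e z))
  have r1 := integral_freq_mul hd hp hFe (fun _ => 1) (by simpa using hFe)
  have r2 := integral_freq_mul hd hp hFe (fun ξ => (rho e ξ : ℂ) ^ 2)
    (Filter.EventuallyEq.refl _ _)
  simp only [one_mul, ← hNdef] at l1 l2
  rw [l1, r1] at h1
  rw [l2, r2] at h2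
  have hJ := integral_inv_mul_exp_neg_rho_pos (E := 𝔼) (by rwa [finrank_euclideanSpace_fin]) hpe
  have hJ1 : ∫ ξ : 𝔼, (‖ξ‖ : ℂ)⁻¹ * 1 * Complex.exp (expo (p • e) 0 ξ) = coneInt (p • e) 0 := by
    simp [coneInt]
  -- At `z = 0` both `ratio` and `mass / quad` equal `1`, so the general formula for the wave of
  -- `rho²` gives the constant `(d-1)((d+1) - 1) = d(d-1)`; the `p²` comes from `rho (p • e) = p *
  -- rho e`.
  have hJ2 : ∫ ξ : 𝔼, (‖ξ‖ : ℂ)⁻¹ * (rho e ξ : ℂ) ^ 2 * Complex.exp (expo (p • e) 0 ξ) =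
      ((d * ((d : ℝ) - 1) / p ^ 2 : ℝ) : ℂ) * coneInt (p • e) 0 := by
    have h3 := rho_sq_mul_wave hd hpe 0
    have hm : (mass (p • e) : ℂ) ≠ 0 := by exact_mod_cast (mass_pos hpe).ne'
    have h4 : ratio (p • e) 0 = 1 := by
      simp [ratio, quad, ell, show mass (0 : ℝ × 𝔼) = 0 by simp [mass], hm]
    have h5 : (mass (p • e) : ℂ) / quad (p • e) 0 = 1 := by
      simp [quad, ell, show mass (0 : ℝ × 𝔼) = 0 by simp [mass], hm]
    rw [h4, h5] at h3
    have hpc : (p : ℂ) ≠ 0 := by exact_mod_cast hp0.ne'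
    have h6 : ∫ ξ : 𝔼, (‖ξ‖ : ℂ)⁻¹ * (rho (p • e) ξ : ℂ) ^ 2 * Complex.exp (expo (p • e) 0 ξ) =
        (p : ℂ) ^ 2 *
          ∫ ξ : 𝔼, (‖ξ‖ : ℂ)⁻¹ * (rho e ξ : ℂ) ^ 2 * Complex.exp (expo (p • e) 0 ξ) := by
      rw [← integral_const_mul]
      congr 1; ext ξ
      rw [rho_smul_left]; push_cast; ring
    rw [h6] at h3
    push_cast
    rw [div_mul_eq_mul_div, eq_div_iff (by positivity)]
    linear_combination h3
  rw [hJ1, coneInt_zero] at h1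
  rw [hJ2, coneInt_zero] at h2
  set J := ∫ ξ : 𝔼, ‖ξ‖⁻¹ * Real.exp (-rho (p • e) ξ) with hJdef
  rw [integral_complex_ofReal] at h1
  have hsplit : ∫ z, ((d : ℂ) - 1) * ((d + 1) * ratio e z ^ 2 - mass e / quad e z) *
      ((‖quad e z‖ ^ (-N) : ℝ) : ℂ) = (((d : ℝ) - 1 : ℝ) : ℂ) *
      ∫ z, ((d + 1) * ratio e z ^ 2 - mass e / quad e z) * ((‖quad e z‖ ^ (-N) : ℝ) : ℂ) := by
    rw [← integral_const_mul]
    congr 1; ext z; push_cast; ring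
  rw [hsplit, Complex.re_ofReal_mul, Complex.re_ofReal_mul, ← Complex.ofReal_mul,
    ← Complex.ofReal_mul, Complex.ofReal_re] at h2
  rw [← Complex.ofReal_mul, ← Complex.ofReal_mul, Complex.ofReal_re, Complex.ofReal_re] at h1
  have key := eq_of_second_moment he (N := N) (by rwa [finrank_euclideanSpace_fin])
    (by rw [finrank_euclideanSpace_fin]; omega)
  rw [finrank_euclideanSpace_fin] at key
  apply key
  -- This is the scaling relation between `p` and `q`, rewritten in terms of `N`.
  have hpinv : (2 * N - d - 1) / (2 * N) = 1 / p := by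
    have : 0 < 2 * N := by
      have := (Nat.cast_nonneg d : (0:ℝ) ≤ d); linarith
    rw [div_eq_div_iff this.ne' hp0.ne', hNdef]
    linear_combination hpq
  rw [hpinv]
  have hκq : 0 < κ ^ q := by positivity
  have h3 : κ ^ q * (((d : ℝ) - 1) * (∫ z, ((d + 1) * ratio e z ^ 2 - mass e / quad e z) *
      ((‖quad e z‖ ^ (-N) : ℝ) : ℂ)).re) =
      κ ^ q * (((d : ℝ) - 1) * (d * (1 / p) ^ 2 * ∫ z, ‖quad e z‖ ^ (-N))) := by
    rw [h2]
    linear_combination (-(d * ((d : ℝ) - 1) / p ^ 2)) * h1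
  exact mul_left_cancel₀ hd1.ne' (mul_left_cancel₀ hκq.ne' h3)

end HalfWave

/-! ### Kernels holomorphic in the forward tube. -/

section Hardy

variable {E : Type*} [NormedAddCommGroup E] [InnerProductSpace ℝ E]

/-- The derivative of `quad` under a shift of its first argument along the reflection of `n`. -/
noncomputable def dquad (n e z : ℝ × E) : ℂ :=
  2 * ((ell n e : ℂ) - Complex.I * ((n.1 * z.1 - inner ℝ n.2 z.2 : ℝ) : ℂ))

lemma quad_add_reflect (n e z : ℝ × E) (s : ℝ) : quad (e + s • ((n.1, -n.2) : ℝ × E)) z =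
    quad e z + s * dquad n e z + s ^ 2 * mass n := by
  simp only [quad, dquad, mass, ell, Prod.fst_add, Prod.snd_add, Prod.smul_fst, Prod.smul_snd,
    smul_eq_mul, smul_neg, ← sub_eq_add_neg, norm_sub_sq_real, inner_sub_left, inner_smul_left,
    inner_smul_right, norm_smul, Real.norm_eq_abs, mul_pow, sq_abs, RCLike.conj_to_real,
    real_inner_comm e.2 n.2]
  push_cast; ring

/-- This is `quad_add_reflect` with `s` replaced by `-i s`: a real shift of `z` along `n` acts as an
imaginary shift of `e` along the reflected vector. It is the Cauchy-Riemann relation that moves the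
contour into the tube. -/
lemma quad_add_smul (n e z : ℝ × E) (s : ℝ) : quad e (z + s • n) =
    quad e z - Complex.I * s * dquad n e z - s ^ 2 * mass n := by
  simp only [quad, dquad, mass, ell, Prod.fst_add, Prod.snd_add, Prod.smul_fst, Prod.smul_snd,
    smul_eq_mul, norm_add_sq_real, inner_add_right,
    inner_smul_right, norm_smul, Real.norm_eq_abs, mul_pow, sq_abs,
    real_inner_comm n.2 z.2, real_inner_comm e.2 n.2]
  push_cast
  linear_combination (-(2 * (s * (n.1 * z.1 - (inner ℝ n.2 z.2 : ℝ)))) : ℂ) * Complex.I_sq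

lemma dquad_add_reflect (n e z : ℝ × E) (s : ℝ) : dquad n (e + s • ((n.1, -n.2) : ℝ × E)) z =
    dquad n e z + 2 * s * mass n := by
  simp only [dquad, mass, ell, Prod.fst_add, Prod.snd_add, Prod.smul_fst, Prod.smul_snd,
    smul_eq_mul, smul_neg, inner_add_right, inner_neg_right,
    inner_smul_right, real_inner_self_eq_norm_sq]
  push_cast; ring

lemma hasDerivAt_ofReal (s : ℝ) : HasDerivAt (fun s : ℝ => (s : ℂ)) 1 s := by
  simpa using (hasDerivAt_id s).ofReal_comp

lemma hasDerivAt_quad_add_reflect (n e z : ℝ × E) (s : ℝ) :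
    HasDerivAt (fun s : ℝ => quad (e + s • ((n.1, -n.2) : ℝ × E)) z)
      (dquad n (e + s • ((n.1, -n.2) : ℝ × E)) z) s := by
  simp only [quad_add_reflect, dquad_add_reflect]
  have h := hasDerivAt_ofReal s
  refine ((((h.mul_const (dquad n e z)).const_add _)).fun_add
    ((h.fun_pow 2).mul_const (mass n : ℂ))).congr_deriv ?_
  norm_num

lemma hasDerivAt_quad_add_smul (n e z : ℝ × E) :
    HasDerivAt (fun s : ℝ => quad e (z + s • n)) (-Complex.I * dquad n e z) 0 := by
  simp only [quad_add_smul]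
  have h := hasDerivAt_ofReal 0
  refine ((((h.const_mul Complex.I).mul_const (dquad n e z)).const_sub (quad e z)).fun_sub
    ((h.fun_pow 2).mul_const (mass n : ℂ))).congr_deriv ?_
  norm_num

lemma continuous_dquad (n e : ℝ × E) : Continuous (dquad n e) := by
  unfold dquad; fun_prop

lemma abs_add_norm_le_norm_quad_reference (z : ℝ × E) :
    |z.1| + ‖z.2‖ ≤ ‖quad ((1, 0) : ℝ × E) z‖ := by
  apply le_of_sq_le_sq _ (norm_nonneg _)
  rw [norm_quad_reference_sq]
  nlinarith [sq_nonneg (|z.1| - ‖z.2‖), sq_abs z.1,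
    mul_nonneg (sq_nonneg (z.1 - ‖z.2‖)) (sq_nonneg (z.1 + ‖z.2‖))]

lemma norm_dquad_le {n : ℝ × E} (h1 : |n.1| ≤ 1) (h2 : ‖n.2‖ ≤ 1) (e z : ℝ × E) :
    ‖dquad n e z‖ ≤ 2 * (|e.1| + ‖e.2‖ + 1) * ‖quad ((1, 0) : ℝ × E) z‖ := by
  have key : ∀ y : ℝ × E, |n.1 * y.1| ≤ |y.1| ∧ |(inner ℝ n.2 y.2 : ℝ)| ≤ ‖y.2‖ := by
    intro y
    constructor
    · rw [abs_mul]; nlinarith [abs_nonneg y.1]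
    · exact (abs_real_inner_le_norm _ _).trans (by nlinarith [norm_nonneg y.2])
  have h3 := abs_add_norm_le_norm_quad_reference z
  have h4 := one_le_norm_quad_reference z
  rw [dquad, norm_mul, Complex.norm_ofNat, mul_assoc]
  refine mul_le_mul_of_nonneg_left ?_ (by norm_num)
  refine (norm_sub_le _ _).trans ?_
  rw [norm_mul, Complex.norm_I, one_mul, Complex.norm_real, Complex.norm_real, Real.norm_eq_abs,
    Real.norm_eq_abs, ell]
  have h5 := abs_add_le (n.1 * e.1) (inner ℝ n.2 e.2)
  have h6 := abs_sub (n.1 * z.1) (inner ℝ n.2 z.2)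
  have := (key e).1; have := (key e).2; have := (key z).1; have := (key z).2
  nlinarith [abs_nonneg e.1, norm_nonneg e.2]

/-- A product of inverse powers of two forms `quad`, holomorphic in the forward tube. -/
noncomputable def hardyKernel (k : ℕ) (e e' z : ℝ × E) : ℂ := (quad e z * quad e' z ^ k)⁻¹

/-- The logarithmic derivative of `hardyKernel`, up to sign. -/
noncomputable def hardyRatio (k : ℕ) (n e e' z : ℝ × E) : ℂ :=
  dquad n e z / quad e z + k * (dquad n e' z / quad e' z)

lemma hasDerivAt_inv_mul_pow {a b : ℝ → ℂ} {a' b' : ℂ} {x : ℝ} (k : ℕ) (ha : HasDerivAt a a' x)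
    (hb : HasDerivAt b b' x) (ha0 : a x ≠ 0) (hb0 : b x ≠ 0) :
    HasDerivAt (fun x => (a x * b x ^ k)⁻¹)
      (-(a x * b x ^ k)⁻¹ * (a' / a x + k * (b' / b x))) x := by
  refine ((ha.fun_mul (hb.fun_pow k)).fun_inv (mul_ne_zero ha0 (pow_ne_zero k hb0))).congr_deriv ?_
  rcases k with - | k
  · simp; field_simp
  · field_simp
    simp only [Nat.add_sub_cancel]
    ring

lemma continuous_hardyKernel (k : ℕ) {e e' : ℝ × E} (he : ‖e.2‖ < e.1) (he' : ‖e'.2‖ < e'.1) :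
    Continuous (hardyKernel k e e') := by
  have h1 := continuous_quad e
  have h2 := continuous_quad e'
  exact (h1.mul (h2.pow k)).inv₀ fun z =>
    mul_ne_zero (quad_ne_zero he z) (pow_ne_zero k (quad_ne_zero he' z))

lemma continuous_hardyRatio (k : ℕ) (n : ℝ × E) {e e' : ℝ × E} (he : ‖e.2‖ < e.1)
    (he' : ‖e'.2‖ < e'.1) : Continuous (hardyRatio k n e e') := by
  exact ((continuous_dquad n e).div (continuous_quad e) (quad_ne_zero he)).add
    (continuous_const.mul ((continuous_dquad n e').div (continuous_quad e') (quad_ne_zero he')))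

lemma norm_hardyKernel_le {k : ℕ} {e e' z : ℝ × E} {K : ℝ} (hK : 0 < K)
    (h : ‖quad ((1, 0) : ℝ × E) z‖ ≤ K * ‖quad e z‖)
    (h' : ‖quad ((1, 0) : ℝ × E) z‖ ≤ K * ‖quad e' z‖) :
    ‖hardyKernel k e e' z‖ ≤ K ^ (k + 1) * ‖quad ((1, 0) : ℝ × E) z‖ ^ (-((k : ℝ) + 1)) := by
  have h1 := one_le_norm_quad_reference z
  set R := ‖quad ((1, 0) : ℝ × E) z‖
  have e1 : R ^ (-((k : ℝ) + 1)) = (R ^ (k + 1))⁻¹ := by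
    rw [Real.rpow_neg (by positivity), ← Nat.cast_succ, Real.rpow_natCast]
  have hp : 0 < ‖quad e z‖ := pos_of_mul_pos_right (lt_of_lt_of_le (by linarith) h) hK.le
  have hp' : 0 < ‖quad e' z‖ := pos_of_mul_pos_right (lt_of_lt_of_le (by linarith) h') hK.le
  rw [e1, hardyKernel, norm_inv, norm_mul, norm_pow, ← div_eq_mul_inv,
    inv_le_comm₀ (by positivity) (by positivity), inv_div, div_le_iff₀ (by positivity)]
  calc R ^ (k + 1) = R * R ^ k := by ring
    _ ≤ (K * ‖quad e z‖) * (K * ‖quad e' z‖) ^ k := by gcongr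
    _ = _ := by ring

lemma norm_dquad_div_le {n e z : ℝ × E} {K A : ℝ} (hK : 0 < K) (h1 : |n.1| ≤ 1) (h2 : ‖n.2‖ ≤ 1)
    (h : ‖quad ((1, 0) : ℝ × E) z‖ ≤ K * ‖quad e z‖) (hA : |e.1| + ‖e.2‖ ≤ A) :
    ‖dquad n e z / quad e z‖ ≤ 2 * (A + 1) * K := by
  have h3 := one_le_norm_quad_reference z
  have hp : 0 < ‖quad e z‖ := pos_of_mul_pos_right (lt_of_lt_of_le (by linarith) h) hK.le
  have hA0 : 0 ≤ A := le_trans (by positivity) hA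
  rw [norm_div, div_le_iff₀ hp]
  calc _ ≤ 2 * (|e.1| + ‖e.2‖ + 1) * ‖quad ((1, 0) : ℝ × E) z‖ := norm_dquad_le h1 h2 e z
    _ ≤ 2 * (A + 1) * (K * ‖quad e z‖) := by gcongr
    _ = _ := by ring

lemma norm_hardyRatio_le {k : ℕ} {n e e' z : ℝ × E} {K A : ℝ} (hK : 0 < K) (h1 : |n.1| ≤ 1)
    (h2 : ‖n.2‖ ≤ 1) (h : ‖quad ((1, 0) : ℝ × E) z‖ ≤ K * ‖quad e z‖)
    (h' : ‖quad ((1, 0) : ℝ × E) z‖ ≤ K * ‖quad e' z‖) (hA : |e.1| + ‖e.2‖ ≤ A)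
    (hA' : |e'.1| + ‖e'.2‖ ≤ A) :
    ‖hardyRatio k n e e' z‖ ≤ (1 + k) * (2 * (A + 1) * K) := by
  refine (norm_add_le _ _).trans ?_
  rw [norm_mul, RCLike.norm_natCast]
  have := norm_dquad_div_le hK h1 h2 h hA
  have := mul_le_mul_of_nonneg_left (norm_dquad_div_le hK h1 h2 h' hA') (Nat.cast_nonneg (α := ℝ) k)
  linarith

/-- A forward shift does not shrink the gap `e.1 - ‖e.2‖`, while a backward one loses at most `2
|σ|`. Slightly negative `σ` must be allowed in order to differentiate at `σ = 0`. -/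
lemma shift_gap {e n : ℝ × E} (h1 : n.1 = 1) (h2 : ‖n.2‖ ≤ 1) {σ : ℝ} {s : ℝ}
    (hs : 2 * s ≤ e.1 - ‖e.2‖) (hσ : -(s / 2) ≤ σ) (hs0 : 0 < s) :
    s ≤ (e + σ • ((n.1, -n.2) : ℝ × E)).1 - ‖(e + σ • ((n.1, -n.2) : ℝ × E)).2‖ := by
  have h3 : ‖e.2 + σ • -n.2‖ ≤ ‖e.2‖ + |σ| * ‖n.2‖ := by
    refine (norm_add_le _ _).trans ?_
    rw [norm_smul, norm_neg, Real.norm_eq_abs]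
  simp only [Prod.fst_add, Prod.snd_add, Prod.smul_fst, Prod.smul_snd, smul_eq_mul, h1]
  have h4 : |σ| * ‖n.2‖ ≤ |σ| := by nlinarith [abs_nonneg σ]
  rcases abs_cases σ with h | h <;> linarith

variable [FiniteDimensional ℝ E] [MeasurableSpace E] [BorelSpace E]

open Module

lemma norm_exp_neg_I_mul (x : ℝ) : ‖Complex.exp (-Complex.I * x)‖ = 1 := by
  rw [show -Complex.I * (x : ℂ) = ((-x : ℝ) : ℂ) * Complex.I by push_cast; ring,
    Complex.norm_exp_ofReal_mul_I]

/-- The Fourier transform of `hardyKernel`. -/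
noncomputable def hardyFourier (k : ℕ) (e e' η : ℝ × E) : ℂ :=
  ∫ z, hardyKernel k e e' z * Complex.exp (-Complex.I * (ell η z : ℝ))

/-- The integral of the derivative along `n` of the kernel times the character vanishes. The kernel
contributes `i * hardyRatio` and the character `-i * ell η n`. The condition `k ≥ d` makes the decay
exponent `k + 1` integrable. -/
lemma integral_hardyRatio (hd : 1 ≤ finrank ℝ E) {k : ℕ} (hk : finrank ℝ E ≤ k) {n e e' : ℝ × E}
    (he : ‖e.2‖ < e.1) (he' : ‖e'.2‖ < e'.1) (h1 : |n.1| ≤ 1) (h2 : ‖n.2‖ ≤ 1) (η : ℝ × E) :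
    ∫ z, hardyKernel k e e' z * hardyRatio k n e e' z *
      Complex.exp (-Complex.I * (ell η z : ℝ)) = (ell η n : ℂ) * hardyFourier k e e' η := by
  obtain ⟨K₁, hK₁, -, -, hQ₁⟩ := exists_norm_inv_quad_le he
  obtain ⟨K₂, hK₂, -, -, hQ₂⟩ := exists_norm_inv_quad_le he'
  set K := max K₁ K₂ with hKdef
  have hK : 0 < K := lt_max_of_lt_left hK₁
  have hQ : ∀ z, ‖quad ((1, 0) : ℝ × E) z‖ ≤ K * ‖quad e z‖ := fun z =>
    (hQ₁ z).trans (by gcongr; exact le_max_left _ _)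
  have hQ' : ∀ z, ‖quad ((1, 0) : ℝ × E) z‖ ≤ K * ‖quad e' z‖ := fun z =>
    (hQ₂ z).trans (by gcongr; exact le_max_right _ _)
  set A := max (|e.1| + ‖e.2‖) (|e'.1| + ‖e'.2‖) with hA
  have hA0 : 0 ≤ A := le_max_of_le_left (by positivity)
  have hN : (finrank ℝ E : ℝ) < (k : ℝ) + 1 := by
    have : (finrank ℝ E : ℝ) ≤ k := by exact_mod_cast hk
    linarith
  have hcK := continuous_hardyKernel k he he'
  have hcR := continuous_hardyRatio k n he he'
  have hce : Continuous fun z => Complex.exp (-Complex.I * (ell η z : ℝ)) := by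
    have := continuous_ell η; fun_prop
  have hKb : ∀ z, ‖hardyKernel k e e' z‖ ≤ K ^ (k + 1) *
      ‖quad ((1, 0) : ℝ × E) z‖ ^ (-((k : ℝ) + 1)) := fun z => norm_hardyKernel_le hK (hQ z) (hQ' z)
  have hRb : ∀ z, ‖hardyRatio k n e e' z‖ ≤ (1 + k) * (2 * (A + 1) * K) := fun z =>
    norm_hardyRatio_le hK h1 h2 (hQ z) (hQ' z) (le_max_left _ _) (le_max_right _ _)
  set B := (1 + k) * (2 * (A + 1) * K) with hB
  have hB0 : 0 ≤ B := by positivity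
  have hw := integrable_norm_quad_reference hN hd
  have i1 : Integrable fun z => hardyKernel k e e' z * Complex.exp (-Complex.I * (ell η z : ℝ)) := by
    refine (hw.const_mul (K ^ (k + 1))).mono' (hcK.mul hce).aestronglyMeasurable
      (Filter.Eventually.of_forall fun z => ?_)
    rw [norm_mul, norm_exp_neg_I_mul, mul_one]; exact hKb z
  have i2 : Integrable fun z => hardyKernel k e e' z * hardyRatio k n e e' z *
      Complex.exp (-Complex.I * (ell η z : ℝ)) := by
    refine (hw.const_mul (K ^ (k + 1) * B)).mono' ((hcK.mul hcR).mul hce).aestronglyMeasurable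
      (Filter.Eventually.of_forall fun z => ?_)
    rw [norm_mul, norm_exp_neg_I_mul, mul_one, norm_mul]
    calc _ ≤ (K ^ (k + 1) * ‖quad ((1, 0) : ℝ × E) z‖ ^ (-((k : ℝ) + 1))) * B := by
          gcongr
          · exact hKb z
          · exact hRb z
      _ = _ := by ring
  have key := integral_translation_derivative
    (φ := fun z => hardyKernel k e e' z * Complex.exp (-Complex.I * (ell η z : ℝ)))
    (b := fun z => Complex.I * (hardyKernel k e e' z * hardyRatio k n e e' z *
      Complex.exp (-Complex.I * (ell η z : ℝ))) + (-Complex.I * (ell η n : ℝ)) *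
      (hardyKernel k e e' z * Complex.exp (-Complex.I * (ell η z : ℝ))))
    (K := K ^ (k + 1) * (1 + B + |ell η n|)) n hN hd (hcK.mul hce) (by fun_prop) ?_ ?_ ?_
  · rw [integral_add (i2.const_mul _) (i1.const_mul _), integral_const_mul, integral_const_mul] at key
    have hI := Complex.I_ne_zero
    have : Complex.I * ((∫ z, hardyKernel k e e' z * hardyRatio k n e e' z *
      Complex.exp (-Complex.I * (ell η z : ℝ))) - (ell η n : ℂ) * hardyFourier k e e' η) = 0 := by
      rw [hardyFourier]; linear_combination key
    exact sub_eq_zero.1 ((mul_eq_zero.1 this).resolve_left hI)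
  · intro z
    rw [norm_mul, norm_exp_neg_I_mul, mul_one]
    refine (hKb z).trans ?_
    gcongr
    have : 0 < K ^ (k + 1) := by positivity
    nlinarith [abs_nonneg (ell η n), mul_nonneg this.le hB0, mul_nonneg this.le (abs_nonneg (ell η n))]
  · intro z
    have hR0 : 0 ≤ ‖quad ((1, 0) : ℝ × E) z‖ ^ (-((k : ℝ) + 1)) := by positivity
    set R := ‖quad ((1, 0) : ℝ × E) z‖ ^ (-((k : ℝ) + 1))
    refine (norm_add_le _ _).trans ?_
    simp only [norm_mul, norm_exp_neg_I_mul, mul_one, Complex.norm_I, norm_neg, one_mul,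
      Complex.norm_real, Real.norm_eq_abs]
    have h3 : ‖hardyKernel k e e' z‖ * ‖hardyRatio k n e e' z‖ ≤ (K ^ (k + 1) * R) * B :=
      mul_le_mul (hKb z) (hRb z) (norm_nonneg _) (by positivity)
    have h4 := mul_le_mul_of_nonneg_left (hKb z) (abs_nonneg (ell η n))
    have h5 : 0 ≤ K ^ (k + 1) * R := by positivity
    change _ ≤ K ^ (k + 1) * R at h5
    nlinarith
  · intro z
    have e1 : HasDerivAt (fun s : ℝ => hardyKernel k e e' (z + s • n))
        (Complex.I * (hardyKernel k e e' z * hardyRatio k n e e' z)) 0 := by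
      have := hasDerivAt_inv_mul_pow k (hasDerivAt_quad_add_smul n e z)
        (hasDerivAt_quad_add_smul n e' z) (quad_ne_zero he _) (quad_ne_zero he' _)
      refine this.congr_deriv ?_
      simp only [zero_smul, add_zero, hardyKernel, hardyRatio]
      ring
    have e2 : HasDerivAt (fun s : ℝ => Complex.exp (-Complex.I * (ell η (z + s • n) : ℝ)))
        (Complex.exp (-Complex.I * (ell η z : ℝ)) * (-Complex.I * (ell η n : ℝ))) 0 := by
      have h3 : (fun s : ℝ => -Complex.I * ((ell η (z + s • n) : ℝ) : ℂ)) =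
          fun s : ℝ => -Complex.I * (ell η z : ℝ) + s * (-Complex.I * (ell η n : ℝ)) := by
        ext s
        simp only [ell, Prod.fst_add, Prod.snd_add, Prod.smul_fst, Prod.smul_snd, smul_eq_mul,
          inner_add_right, inner_smul_right]
        push_cast; ring
      have h4 : HasDerivAt (fun s : ℝ => -Complex.I * ((ell η (z + s • n) : ℝ) : ℂ))
          (-Complex.I * (ell η n : ℝ)) 0 := by
        rw [h3]
        refine (((hasDerivAt_ofReal 0).mul_const _).const_add _).congr_deriv (by ring)
      simpa using h4.cexp
    refine (e1.fun_mul e2).congr_deriv ?_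
    simp only [zero_smul, add_zero]
    ring

end Hardy

/-! ### Fourier support in the forward light cone. -/

section Hardy

variable {E : Type*} [NormedAddCommGroup E] [InnerProductSpace ℝ E]
variable [FiniteDimensional ℝ E] [MeasurableSpace E] [BorelSpace E]

open Module

/-- The quadratic growth of the lower bound for `quad` along a shift. -/
lemma exists_norm_quad_shift_le {n e : ℝ × E} (he : ‖e.2‖ < e.1) (h1 : n.1 = 1) (h2 : ‖n.2‖ ≤ 1) :
    ∃ C s : ℝ, 0 < C ∧ 0 < s ∧ ∀ σ, -s ≤ σ →
      ‖(e + σ • ((n.1, -n.2) : ℝ × E)).2‖ < (e + σ • ((n.1, -n.2) : ℝ × E)).1 ∧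
      ∀ z, ‖quad ((1, 0) : ℝ × E) z‖ ≤
        C * (1 + e.1 + σ) ^ 2 * ‖quad (e + σ • ((n.1, -n.2) : ℝ × E)) z‖ := by
  have hs : 0 < (e.1 - ‖e.2‖) / 2 := half_pos (sub_pos.2 he)
  set s := (e.1 - ‖e.2‖) / 2 with hsdef
  obtain ⟨C, hC, h⟩ := exists_norm_quad_le (E := E) hs
  refine ⟨C, s / 2, hC, by positivity, fun σ hσ => ?_⟩
  have hg := shift_gap (e := e) h1 h2 (by linarith) hσ hs
  refine ⟨by linarith, fun z => ?_⟩
  have := h _ hg z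
  simpa [h1, add_assoc] using this

lemma exists_norm_quad_shift_le₂ {n e e' : ℝ × E} (he : ‖e.2‖ < e.1) (he' : ‖e'.2‖ < e'.1)
    (h1 : n.1 = 1) (h2 : ‖n.2‖ ≤ 1) :
    ∃ C A s : ℝ, 0 < C ∧ 0 < A ∧ 0 < s ∧ s ≤ A / 2 ∧ ∀ σ, -s ≤ σ →
      (‖(e + σ • ((n.1, -n.2) : ℝ × E)).2‖ < (e + σ • ((n.1, -n.2) : ℝ × E)).1 ∧
      ‖(e' + σ • ((n.1, -n.2) : ℝ × E)).2‖ < (e' + σ • ((n.1, -n.2) : ℝ × E)).1) ∧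
      ∀ z, ‖quad ((1, 0) : ℝ × E) z‖ ≤
        C * (A + σ) ^ 2 * ‖quad (e + σ • ((n.1, -n.2) : ℝ × E)) z‖ ∧
        ‖quad ((1, 0) : ℝ × E) z‖ ≤
        C * (A + σ) ^ 2 * ‖quad (e' + σ • ((n.1, -n.2) : ℝ × E)) z‖ := by
  obtain ⟨C, s, hC, hs, h⟩ := exists_norm_quad_shift_le he h1 h2
  obtain ⟨C', s', hC', hs', h'⟩ := exists_norm_quad_shift_le he' h1 h2
  have hα : 0 < e.1 := lt_of_le_of_lt (norm_nonneg _) he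
  have hα' : 0 < e'.1 := lt_of_le_of_lt (norm_nonneg _) he'
  refine ⟨max C C', 1 + e.1 + e'.1, min (min s s') (1 / 2), lt_max_of_lt_left hC, by linarith,
    by positivity, ?_, fun σ hσ => ?_⟩
  · exact (min_le_right _ _).trans (by linarith)
  have hσ1 : -s ≤ σ := by
    have := (min_le_left (min s s') (1/2)).trans (min_le_left _ _); linarith
  have hσ2 : -s' ≤ σ := by
    have := (min_le_left (min s s') (1/2)).trans (min_le_right _ _); linarith
  have hσ3 : -(1/2) ≤ σ := by
    have := (min_le_right (min s s') (1/2)); linarith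
  refine ⟨⟨(h σ hσ1).1, (h' σ hσ2).1⟩, fun z => ⟨((h σ hσ1).2 z).trans ?_, ((h' σ hσ2).2 z).trans ?_⟩⟩
  · have : 0 ≤ 1 + e.1 + σ := by linarith
    exact mul_le_mul_of_nonneg_right (mul_le_mul (le_max_left _ _)
      (pow_le_pow_left₀ this (by linarith) 2) (by positivity) (le_max_of_le_left hC.le)) (norm_nonneg _)
  · have : 0 ≤ 1 + e'.1 + σ := by linarith
    exact mul_le_mul_of_nonneg_right (mul_le_mul (le_max_right _ _)
      (pow_le_pow_left₀ this (by linarith) 2) (by positivity) (le_max_of_le_left hC.le)) (norm_nonneg _)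

/-- Moving both poles by `σ` along the reflected direction multiplies the Fourier transform by `exp
(-σ * ell η n)`; this is the differential equation behind that contour shift, with
`integral_hardyRatio` evaluating the derivative. -/
lemma hasDerivAt_hardyFourier (hd : 1 ≤ finrank ℝ E) {k : ℕ} (hk : finrank ℝ E ≤ k)
    {n e e' : ℝ × E} (he : ‖e.2‖ < e.1) (he' : ‖e'.2‖ < e'.1) (h1 : n.1 = 1) (h2 : ‖n.2‖ ≤ 1)
    (η : ℝ × E) {σ : ℝ} (hσ : 0 ≤ σ) :
    HasDerivAt (fun σ : ℝ => hardyFourier k (e + σ • ((n.1, -n.2) : ℝ × E))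
      (e' + σ • ((n.1, -n.2) : ℝ × E)) η)
      (-(ell η n : ℂ) * hardyFourier k (e + σ • ((n.1, -n.2) : ℝ × E))
      (e' + σ • ((n.1, -n.2) : ℝ × E)) η) σ := by
  obtain ⟨C, A, s, hC, hA, hs, hsA, h⟩ := exists_norm_quad_shift_le₂ he he' h1 h2
  have hN : (finrank ℝ E : ℝ) < (k : ℝ) + 1 := by
    have : (finrank ℝ E : ℝ) ≤ k := by exact_mod_cast hk
    linarith
  have hw := integrable_norm_quad_reference (E := E) hN hd
  have hce : Continuous fun z => Complex.exp (-Complex.I * (ell η z : ℝ)) := by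
    have := continuous_ell η; fun_prop
  set K := C * (A + (σ + 1)) ^ 2 with hK
  have hK0 : 0 < K := by positivity
  have hQ : ∀ τ ∈ Set.Ioo (-s) (σ + 1), ∀ z,
      ‖quad ((1, 0) : ℝ × E) z‖ ≤ K * ‖quad (e + τ • ((n.1, -n.2) : ℝ × E)) z‖ ∧
      ‖quad ((1, 0) : ℝ × E) z‖ ≤ K * ‖quad (e' + τ • ((n.1, -n.2) : ℝ × E)) z‖ := by
    intro τ hτ z
    have h3 := (h τ hτ.1.le).2 z
    have h4 : 0 ≤ A + τ := by linarith [hτ.1]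
    have h5 := hτ.2.le
    have h6 : C * (A + τ) ^ 2 ≤ K := by rw [hK]; gcongr
    exact ⟨h3.1.trans (by gcongr), h3.2.trans (by gcongr)⟩
  have hn1 : |n.1| ≤ 1 := by rw [h1, abs_one]
  set B := (|e.1| + ‖e.2‖) + (|e'.1| + ‖e'.2‖) + 2 * (s + σ + 1) with hB
  have hBb : ∀ y : ℝ × E, |y.1| + ‖y.2‖ ≤ (|e.1| + ‖e.2‖) + (|e'.1| + ‖e'.2‖) →
      ∀ τ ∈ Set.Ioo (-s) (σ + 1), |(y + τ • ((n.1, -n.2) : ℝ × E)).1| +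
        ‖(y + τ • ((n.1, -n.2) : ℝ × E)).2‖ ≤ B := by
    intro y hy τ hτ
    simp only [Prod.fst_add, Prod.snd_add, Prod.smul_fst, Prod.smul_snd, smul_eq_mul, h1, mul_one]
    have h3 := abs_add_le y.1 τ
    have h4 := norm_add_le y.2 (τ • -n.2)
    rw [norm_smul, norm_neg, Real.norm_eq_abs] at h4
    have h5 : |τ| ≤ s + σ + 1 := abs_le.2 ⟨by linarith [hτ.1], by linarith [hτ.2]⟩
    have h6 : |τ| * ‖n.2‖ ≤ |τ| := by nlinarith [abs_nonneg τ]
    linarith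
  have hB1 := hBb e (by linarith [abs_nonneg e'.1, norm_nonneg e'.2])
  have hB2 := hBb e' (by linarith [abs_nonneg e.1, norm_nonneg e.2])
  have hσI : σ ∈ Set.Ioo (-s) (σ + 1) := ⟨by linarith, by linarith⟩
  have key := hasDerivAt_integral_of_dominated_loc_of_deriv_le
    (μ := (volume : Measure (ℝ × E))) (𝕜 := ℝ)
    (F := fun σ z => hardyKernel k (e + σ • ((n.1, -n.2) : ℝ × E))
      (e' + σ • ((n.1, -n.2) : ℝ × E)) z * Complex.exp (-Complex.I * (ell η z : ℝ)))
    (F' := fun σ z => -(hardyKernel k (e + σ • ((n.1, -n.2) : ℝ × E))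
      (e' + σ • ((n.1, -n.2) : ℝ × E)) z * hardyRatio k n (e + σ • ((n.1, -n.2) : ℝ × E))
      (e' + σ • ((n.1, -n.2) : ℝ × E)) z * Complex.exp (-Complex.I * (ell η z : ℝ))))
    (x₀ := σ) (s := Set.Ioo (-s) (σ + 1))
    (bound := fun z => K ^ (k + 1) * ‖quad ((1, 0) : ℝ × E) z‖ ^ (-((k : ℝ) + 1)) *
      ((1 + k) * (2 * (B + 1) * K)))
    (isOpen_Ioo.mem_nhds hσI) ?_ ?_ ?_ ?_ ?_ ?_
  · refine key.2.congr_deriv ?_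
    rw [integral_neg, integral_hardyRatio hd hk (h σ (by linarith)).1.1 (h σ (by linarith)).1.2
      hn1 h2 η, neg_mul]
  · filter_upwards [isOpen_Ioo.mem_nhds hσI] with τ hτ
    exact ((continuous_hardyKernel k (h τ hτ.1.le).1.1 (h τ hτ.1.le).1.2).mul
      hce).aestronglyMeasurable
  · refine (hw.const_mul (K ^ (k + 1))).mono' ((continuous_hardyKernel k (h σ (by linarith)).1.1
      (h σ (by linarith)).1.2).mul hce).aestronglyMeasurable (Filter.Eventually.of_forall fun z => ?_)
    rw [norm_mul, norm_exp_neg_I_mul, mul_one]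
    exact norm_hardyKernel_le hK0 (hQ σ hσI z).1 (hQ σ hσI z).2
  · exact (((continuous_hardyKernel k (h σ (by linarith)).1.1 (h σ (by linarith)).1.2).mul
      (continuous_hardyRatio k n (h σ (by linarith)).1.1 (h σ (by linarith)).1.2)).mul
      hce).neg.aestronglyMeasurable
  · refine Filter.Eventually.of_forall fun z τ hτ => ?_
    rw [norm_neg, norm_mul, norm_exp_neg_I_mul, mul_one, norm_mul]
    exact mul_le_mul (norm_hardyKernel_le hK0 (hQ τ hτ z).1 (hQ τ hτ z).2)
      (norm_hardyRatio_le hK0 hn1 h2 (hQ τ hτ z).1 (hQ τ hτ z).2 (hB1 τ hτ) (hB2 τ hτ))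
      (norm_nonneg _) (by positivity)
  · exact (hw.const_mul _).mul_const _
  · refine Filter.Eventually.of_forall fun z τ hτ => ?_
    have := hasDerivAt_inv_mul_pow k (hasDerivAt_quad_add_reflect n e z τ)
        (hasDerivAt_quad_add_reflect n e' z τ) (quad_ne_zero (h τ hτ.1.le).1.1 z)
        (quad_ne_zero (h τ hτ.1.le).1.2 z)
    refine (this.mul_const (Complex.exp (-Complex.I * (ell η z : ℝ)))).congr_deriv ?_
    simp only [hardyKernel, hardyRatio]
    ring

/-- The Fourier transform of `hardyKernel` is supported in the forward light cone. -/
lemma hardyFourier_eq_zero (hd : 1 ≤ finrank ℝ E) {k : ℕ} (hk : finrank ℝ E ≤ k)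
    {e e' η : ℝ × E} (he : ‖e.2‖ < e.1) (he' : ‖e'.2‖ < e'.1) (hη : η.1 < ‖η.2‖) :
    hardyFourier k e e' η = 0 := by
  -- This null direction makes `ell η n = η.1 - ‖η.2‖` negative. When `η.2 = 0` the convention `0⁻¹
  -- = 0` gives `n = (1, 0)`, and the formula still holds.
  set n : ℝ × E := (1, -((‖η.2‖)⁻¹ • η.2)) with hn
  have h1 : n.1 = 1 := rfl
  have h2 : ‖n.2‖ ≤ 1 := by
    simp only [hn, norm_neg, norm_smul, norm_inv, norm_norm]
    exact inv_mul_le_one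
  have h3 : ell η n = η.1 - ‖η.2‖ := by
    simp only [ell, hn, inner_neg_right, inner_smul_right, real_inner_self_eq_norm_sq, mul_one]
    rcases eq_or_ne ‖η.2‖ 0 with h | h
    · simp [h]
    · field_simp; ring
  set c := ‖η.2‖ - η.1 with hc
  have hc0 : 0 < c := sub_pos.2 hη
  have h3' : ell η n = -c := by rw [h3, hc]; ring
  set Φ : ℝ → ℂ := fun σ => hardyFourier k (e + σ • ((n.1, -n.2) : ℝ × E))
    (e' + σ • ((n.1, -n.2) : ℝ × E)) η with hΦ
  have hder : ∀ σ : ℝ, 0 ≤ σ → HasDerivAt (fun σ : ℝ => Complex.exp (-(c : ℂ) * σ) * Φ σ) 0 σ := by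
    intro σ hσ
    have h4 := hasDerivAt_hardyFourier hd hk he he' h1 h2 η hσ
    have h5 : HasDerivAt (fun σ : ℝ => Complex.exp (-(c : ℂ) * σ))
        (Complex.exp (-(c : ℂ) * σ) * (-(c : ℂ) * 1)) σ :=
      ((hasDerivAt_ofReal σ).const_mul (-(c : ℂ))).cexp
    refine (h5.fun_mul h4).congr_deriv ?_
    rw [h3']
    push_cast; ring
  have hconst : ∀ σ : ℝ, 0 ≤ σ → Φ 0 = Complex.exp (-(c : ℂ) * σ) * Φ σ := by
    intro σ hσ
    have := constant_of_has_deriv_right_zero (a := 0) (b := σ)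
      (f := fun σ : ℝ => Complex.exp (-(c : ℂ) * σ) * Φ σ)
      (fun x hx => (hder x hx.1).continuousAt.continuousWithinAt)
      (fun x hx => (hder x hx.1).hasDerivWithinAt) σ ⟨hσ, le_rfl⟩
    simpa using this.symm
  have hΦ0 : Φ 0 = hardyFourier k e e' η := by simp only [hΦ, zero_smul, add_zero]
  obtain ⟨C, A, s, hC, hA, hs, hsA, h⟩ := exists_norm_quad_shift_le₂ he he' h1 h2
  have hN : (finrank ℝ E : ℝ) < (k : ℝ) + 1 := by
    have : (finrank ℝ E : ℝ) ≤ k := by exact_mod_cast hk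
    linarith
  have hw := integrable_norm_quad_reference (E := E) hN hd
  set J := ∫ z : ℝ × E, ‖quad ((1, 0) : ℝ × E) z‖ ^ (-((k : ℝ) + 1)) with hJ
  have hbound : ∀ σ : ℝ, 0 ≤ σ → ‖Φ σ‖ ≤ (C * (A + σ) ^ 2) ^ (k + 1) * J := by
    intro σ hσ
    have hK : 0 < C * (A + σ) ^ 2 := by positivity
    rw [hJ, ← integral_const_mul]
    refine norm_integral_le_of_norm_le (hw.const_mul _) (Filter.Eventually.of_forall fun z => ?_)
    rw [norm_mul, norm_exp_neg_I_mul, mul_one]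
    have := (h σ (by linarith)).2 z
    exact norm_hardyKernel_le hK this.1 this.2
  -- By the differential equation `Φ σ` equals `exp (c σ) Φ 0`, yet it grows at most polynomially
  -- because the lower bound for `quad` degrades only polynomially in `σ`. The two are compatible
  -- only if `Φ 0 = 0`.
  have hle : ∀ σ : ℝ, 0 ≤ σ → ‖Φ 0‖ ≤ (C ^ (k + 1) * J * (c ^ (2 * (k + 1)))⁻¹ * Real.exp (c * A)) *
      ((c * (A + σ)) ^ (2 * (k + 1)) * Real.exp (-(c * (A + σ)))) := by
    intro σ hσ
    have e1 : Real.exp (-(c * (A + σ))) = Real.exp (-(c * A)) * Real.exp (-c * σ) := by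
      rw [← Real.exp_add]; ring_nf
    have e2 : Real.exp (c * A) * Real.exp (-(c * A)) = 1 := by
      rw [← Real.exp_add, add_neg_cancel, Real.exp_zero]
    have e3 : ‖Complex.exp (-(c : ℂ) * σ)‖ = Real.exp (-c * σ) := by
      rw [Complex.norm_exp]; congr 1; simp
    calc ‖Φ 0‖ = Real.exp (-c * σ) * ‖Φ σ‖ := by rw [hconst σ hσ, norm_mul, e3]
      _ ≤ Real.exp (-c * σ) * ((C * (A + σ) ^ 2) ^ (k + 1) * J) := by
        gcongr; exact hbound σ hσ
      _ = (C ^ (k + 1) * J * ((c ^ (2 * (k + 1)))⁻¹ * c ^ (2 * (k + 1))) *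
          (Real.exp (c * A) * Real.exp (-(c * A)))) * ((A + σ) ^ (2 * (k + 1)) *
            Real.exp (-c * σ)) := by
        rw [e2, inv_mul_cancel₀ (by positivity), mul_pow, ← pow_mul]; ring
      _ = _ := by rw [e1, mul_pow]; ring
  have hlim : Filter.Tendsto (fun σ : ℝ => (C ^ (k + 1) * J * (c ^ (2 * (k + 1)))⁻¹ *
      Real.exp (c * A)) * ((c * (A + σ)) ^ (2 * (k + 1)) * Real.exp (-(c * (A + σ)))))
      Filter.atTop (nhds 0) := by
    have h5 : Filter.Tendsto (fun σ : ℝ => c * (A + σ)) Filter.atTop Filter.atTop :=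
      (Filter.tendsto_atTop_add_const_left _ A Filter.tendsto_id).const_mul_atTop hc0
    have h6 := (Real.tendsto_pow_mul_exp_neg_atTop_nhds_zero (2 * (k + 1))).comp h5
    simpa using h6.const_mul (C ^ (k + 1) * J * (c ^ (2 * (k + 1)))⁻¹ * Real.exp (c * A))
  have h7 : ‖Φ 0‖ ≤ 0 := ge_of_tendsto hlim
    ((Filter.eventually_ge_atTop 0).mono hle)
  rw [← hΦ0]
  exact norm_le_zero_iff.1 h7

end Hardy

/-! ### The Cauchy–Szegő kernel of the light cone. -/

section Szego

open Module

lemma integrable_exp_neg_mul_norm {V : Type*} [NormedAddCommGroup V] [NormedSpace ℝ V]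
    [FiniteDimensional ℝ V] [MeasurableSpace V] [BorelSpace V] [Nontrivial V] (μ : Measure V)
    [μ.IsAddHaarMeasure] {σ : ℝ} (hσ : 0 < σ) :
    Integrable (fun x : V => Real.exp (-(σ * ‖x‖))) μ := by
  rw [integrable_fun_norm_addHaar μ (f := fun r => Real.exp (-(σ * r)))]
  have h := integrableOn_rpow_mul_exp_neg_mul_rpow (p := 1) (b := σ)
    (s := ((finrank ℝ V - 1 : ℕ) : ℝ))
    (by have : (0:ℝ) ≤ ((finrank ℝ V - 1 : ℕ) : ℝ) := Nat.cast_nonneg _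
        linarith) one_pos hσ
  refine h.congr_fun (fun r hr => ?_) measurableSet_Ioi
  simp only [Real.rpow_one, Real.rpow_natCast, smul_eq_mul, neg_mul]

variable {E : Type*} [NormedAddCommGroup E] [InnerProductSpace ℝ E]

/-- The Minkowski pairing. -/
noncomputable def minkowski (e η : ℝ × E) : ℝ := e.1 * η.1 - inner ℝ e.2 η.2

lemma minkowski_add (e η ζ : ℝ × E) : minkowski e (η + ζ) = minkowski e η + minkowski e ζ := by
  simp only [minkowski, Prod.fst_add, Prod.snd_add, inner_add_right]; ring

lemma minkowski_cone (e : ℝ × E) (ξ : E) : minkowski e (‖ξ‖, ξ) = rho e ξ := rfl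

lemma ell_cone (z : ℝ × E) (ξ : E) : ell ((‖ξ‖, ξ) : ℝ × E) z = phase z ξ := by
  simp only [ell, phase, real_inner_comm ξ z.2]; ring

lemma ell_add_left (η ζ z : ℝ × E) : ell (η + ζ) z = ell η z + ell ζ z := by
  simp only [ell, Prod.fst_add, Prod.snd_add, inner_add_left]; ring

lemma continuous_minkowski (e : ℝ × E) : Continuous (minkowski e) := by
  unfold minkowski; fun_prop

/-- The closed forward light cone. -/
def lightCone (E : Type*) [NormedAddCommGroup E] : Set (ℝ × E) := {η | ‖η.2‖ ≤ η.1}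

lemma isClosed_lightCone : IsClosed (lightCone E) :=
  isClosed_le (by fun_prop) (by fun_prop)

lemma add_mem_lightCone {η ζ : ℝ × E} (hη : η ∈ lightCone E) (hζ : ζ ∈ lightCone E) :
    η + ζ ∈ lightCone E :=
  (norm_add_le _ _).trans (add_le_add hη hζ)

lemma le_minkowski {e η : ℝ × E} (he : ‖e.2‖ < e.1) (hη : η ∈ lightCone E) :
    (e.1 - ‖e.2‖) / 2 * ‖η.1‖ + (e.1 - ‖e.2‖) / 2 * ‖η.2‖ ≤ minkowski e η := by
  have h1 : ‖η.2‖ ≤ η.1 := hη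
  have h2 : 0 ≤ η.1 := (norm_nonneg _).trans h1
  have h3 := real_inner_le_norm e.2 η.2
  rw [Real.norm_of_nonneg h2, minkowski]
  nlinarith [norm_nonneg e.2, mul_le_mul_of_nonneg_left h1 (norm_nonneg e.2),
    mul_le_mul_of_nonneg_left h1 (sub_pos.2 he).le]

variable [FiniteDimensional ℝ E] [MeasurableSpace E] [BorelSpace E]

lemma integrable_exp_neg_minkowski [Nontrivial E] {e : ℝ × E} (he : ‖e.2‖ < e.1) :
    Integrable (fun η : ℝ × E => Real.exp (-minkowski e η)) (volume.restrict (lightCone E)) := by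
  have hσ : 0 < (e.1 - ‖e.2‖) / 2 := half_pos (sub_pos.2 he)
  have h1 : Integrable (fun η : ℝ × E => Real.exp (-((e.1 - ‖e.2‖) / 2 * ‖η.1‖)) *
      Real.exp (-((e.1 - ‖e.2‖) / 2 * ‖η.2‖))) (volume : Measure (ℝ × E)) :=
    (integrable_exp_neg_mul_norm (volume : Measure ℝ) hσ).mul_prod
      (integrable_exp_neg_mul_norm (volume : Measure E) hσ)
  have hc := continuous_minkowski e
  refine (h1.restrict).mono' (by fun_prop) ?_
  filter_upwards [ae_restrict_mem isClosed_lightCone.measurableSet] with η hη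
  rw [Real.norm_of_nonneg (by positivity), ← Real.exp_add]
  have := le_minkowski he hη
  gcongr
  linarith

/-- The Cauchy–Szegő kernel of the tube over the light cone. -/
noncomputable def szego (e z : ℝ × E) : ℂ :=
  ∫ η in lightCone E, (Real.exp (-minkowski e η) : ℂ) * Complex.exp (Complex.I * (ell η z : ℝ))

lemma norm_exp_I_mul (x : ℝ) : ‖Complex.exp (Complex.I * x)‖ = 1 := by
  rw [mul_comm, Complex.norm_exp_ofReal_mul_I]

lemma integrable_szego [Nontrivial E] {e : ℝ × E} (he : ‖e.2‖ < e.1) (z : ℝ × E) :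
    Integrable (fun η : ℝ × E => (Real.exp (-minkowski e η) : ℂ) *
      Complex.exp (Complex.I * (ell η z : ℝ))) (volume.restrict (lightCone E)) := by
  refine (integrable_exp_neg_minkowski he).mono' ?_ (Filter.Eventually.of_forall fun η => ?_)
  · have h1 := continuous_minkowski e
    have h2 : Continuous fun η : ℝ × E => ell η z := by unfold ell; fun_prop
    exact Continuous.aestronglyMeasurable (by fun_prop)
  · rw [norm_mul, norm_exp_I_mul, mul_one, Complex.norm_real, Real.norm_of_nonneg (by positivity)]

/-- For fixed `ξ` the time frequency runs over `[‖ξ‖, ∞)`, and integrating the exponential leaves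
its boundary value on the cone divided by `e.1 - i z.1`. -/
lemma szego_eq [Nontrivial E] {e : ℝ × E} (he : ‖e.2‖ < e.1) (z : ℝ × E) :
    szego e z = ((e.1 : ℂ) - Complex.I * z.1)⁻¹ * ∫ ξ : E, Complex.exp (expo e z ξ) := by
  have hm := (isClosed_lightCone (E := E)).measurableSet
  have hi := integrable_szego he z
  rw [← IntegrableOn, ← integrable_indicator_iff hm] at hi
  rw [szego, ← integral_indicator hm, Measure.volume_eq_prod, integral_prod_symm _ hi,
    ← integral_const_mul]
  congr 1; ext ξ
  set a : ℂ := -((e.1 : ℂ) - Complex.I * z.1) with ha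
  have har : a.re < 0 := by
    have := lt_of_le_of_lt (norm_nonneg _) he
    simpa [ha] using this
  have h1 : (fun τ : ℝ => (lightCone E).indicator (fun η : ℝ × E =>
      (Real.exp (-minkowski e η) : ℂ) * Complex.exp (Complex.I * (ell η z : ℝ))) (τ, ξ)) =
      (Set.Ici ‖ξ‖).indicator fun τ : ℝ => Complex.exp (a * τ) *
        Complex.exp ((inner ℝ e.2 ξ : ℝ) + Complex.I * (inner ℝ z.2 ξ : ℝ)) := by
    ext τ
    by_cases h : ‖ξ‖ ≤ τ
    · rw [Set.indicator_of_mem (show (τ, ξ) ∈ lightCone E from h),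
        Set.indicator_of_mem (show τ ∈ Set.Ici ‖ξ‖ from h), Complex.ofReal_exp, ← Complex.exp_add,
        ← Complex.exp_add]
      congr 1
      simp only [minkowski, ell, ha, real_inner_comm ξ z.2]
      push_cast; ring
    · rw [Set.indicator_of_notMem (show (τ, ξ) ∉ lightCone E from h),
        Set.indicator_of_notMem (show τ ∉ Set.Ici ‖ξ‖ from h)]
  have ha0 : (e.1 : ℂ) - Complex.I * z.1 ≠ 0 := by
    intro h0; rw [ha, h0] at har; simp at har
  rw [h1, integral_indicator measurableSet_Ici, integral_Ici_eq_integral_Ioi, integral_mul_const,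
    integral_exp_mul_complex_Ioi har, div_mul_eq_mul_div, neg_mul, ← Complex.exp_add, ha, neg_div_neg_eq,
    div_eq_inv_mul]
  congr 2
  simp only [expo, rho, phase]
  push_cast; ring

/-- The factor `e.1 - i z.1` produced by the time integration cancels against
`quad_mul_integral_exp`. The quotient by `quad` is what allows the dual wave at `p = 2` to be
recognised as containing a Szegő kernel. -/
lemma szego_eq_coneInt (hd : 2 ≤ finrank ℝ E) {e : ℝ × E} (he : ‖e.2‖ < e.1) (z : ℝ × E) :
    szego e z = ((finrank ℝ E : ℂ) - 1) * (coneInt e z / quad e z) := by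
  have : Nontrivial E := Module.nontrivial_of_finrank_pos (R := ℝ) (by omega)
  have h1 := quad_mul_integral_exp hd he z
  have h2 := quad_ne_zero he z
  have h3 := fst_sub_I_ne_zero he z
  rw [szego_eq he z]
  field_simp
  linear_combination h1

/-- The cone transform of a product of a function with spectrum in the forward cone and a
conjugate Szegő kernel is an exponential. -/
lemma integral_hardyKernel_mul_szego (hd : 2 ≤ finrank ℝ E) {k : ℕ} (hk : finrank ℝ E ≤ k)
    {e e₁ e₂ : ℝ × E} (he : ‖e.2‖ < e.1) (he₁ : ‖e₁.2‖ < e₁.1) (he₂ : ‖e₂.2‖ < e₂.1) (ξ : E) :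
    ∫ z, Complex.exp (Complex.I * (phase z ξ : ℝ)) *
      (hardyKernel k e₁ e₂ z * (starRingEnd ℂ) (szego e z)) =
    (∫ η in lightCone E, (Real.exp (-minkowski e η) : ℂ) * hardyFourier k e₁ e₂ η) *
      (Real.exp (-rho e ξ) : ℂ) := by
  have : Nontrivial E := Module.nontrivial_of_finrank_pos (R := ℝ) (by omega)
  have hm := (isClosed_lightCone (E := E)).measurableSet
  have hcK := continuous_hardyKernel k he₁ he₂
  have hN : (finrank ℝ E : ℝ) < (k : ℝ) + 1 := by
    have : (finrank ℝ E : ℝ) ≤ k := by exact_mod_cast hk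
    linarith
  have hKi : Integrable (hardyKernel k e₁ e₂) := by
    obtain ⟨K₁, hK₁, -, -, hQ₁⟩ := exists_norm_inv_quad_le he₁
    obtain ⟨K₂, hK₂, -, -, hQ₂⟩ := exists_norm_inv_quad_le he₂
    refine ((integrable_norm_quad_reference hN (by omega)).const_mul (max K₁ K₂ ^ (k + 1))).mono'
      hcK.aestronglyMeasurable (Filter.Eventually.of_forall fun z =>
        norm_hardyKernel_le (lt_max_of_lt_left hK₁) ((hQ₁ z).trans ?_) ((hQ₂ z).trans ?_))
    · gcongr; exact le_max_left _ _
    · gcongr; exact le_max_right _ _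
  set ζ : ℝ × E := (‖ξ‖, ξ) with hζ
  have hζm : ζ ∈ lightCone E := show ‖ξ‖ ≤ ‖ξ‖ from le_rfl
  have hmk := continuous_minkowski e
  have hint : Integrable (Function.uncurry fun (z η : ℝ × E) => (Real.exp (-minkowski e η) : ℂ) *
      (hardyKernel k e₁ e₂ z * Complex.exp (-Complex.I * (ell (η - ζ) z : ℝ))))
      ((volume : Measure (ℝ × E)).prod (volume.restrict (lightCone E))) := by
    have h1 := hKi.mul_prod ((integrable_exp_neg_minkowski he).ofReal (𝕜 := ℂ))
    have h3 : Continuous fun y : (ℝ × E) × (ℝ × E) =>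
        Complex.exp (-Complex.I * (ell (y.2 - ζ) y.1 : ℝ)) := by
      unfold ell; fun_prop
    refine (h1.bdd_mul (c := 1) h3.aestronglyMeasurable (Filter.Eventually.of_forall fun y => ?_)).congr
      (Filter.Eventually.of_forall fun y => ?_)
    · rw [norm_exp_neg_I_mul]
    · simp only [Function.uncurry]
      simp only [Complex.coe_algebraMap]
      ring
  calc ∫ z, Complex.exp (Complex.I * (phase z ξ : ℝ)) *
        (hardyKernel k e₁ e₂ z * (starRingEnd ℂ) (szego e z))
      = ∫ z, ∫ η in lightCone E, (Real.exp (-minkowski e η) : ℂ) *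
        (hardyKernel k e₁ e₂ z * Complex.exp (-Complex.I * (ell (η - ζ) z : ℝ))) := by
        congr 1; ext z
        rw [szego, ← integral_conj, ← integral_const_mul, ← integral_const_mul]
        congr 1; ext η
        have h4 : ell (η - ζ) z = ell η z - phase z ξ := by
          rw [← ell_cone z ξ, eq_sub_iff_add_eq, ← ell_add_left, sub_add_cancel]
        have h5 : (starRingEnd ℂ) (Complex.exp (Complex.I * (ell η z : ℝ))) =
            Complex.exp (-Complex.I * (ell η z : ℝ)) := by
          rw [← Complex.exp_conj]; simp
        have h6 : Complex.exp (-Complex.I * (ell (η - ζ) z : ℝ)) =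
            Complex.exp (Complex.I * (phase z ξ : ℝ)) * Complex.exp (-Complex.I * (ell η z : ℝ)) := by
          rw [← Complex.exp_add, h4]; push_cast; congr 1; ring
        rw [h6, map_mul, h5, Complex.conj_ofReal]
        ring
    _ = ∫ η in lightCone E, (Real.exp (-minkowski e η) : ℂ) * hardyFourier k e₁ e₂ (η - ζ) := by
        rw [integral_integral_swap hint]
        congr 1; ext η
        rw [integral_const_mul, hardyFourier]
    -- The substitution `η ↦ η + ζ` turns the domain into the cone shifted by `-ζ`. It contains the
    -- cone, since `ζ` lies in the cone, and the remainder contributes nothing because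
    -- `hardyFourier` vanishes off the cone.
    _ = ∫ η, (lightCone E).indicator (fun η => (Real.exp (-minkowski e (η + ζ)) : ℂ) *
          hardyFourier k e₁ e₂ η) η := by
        rw [← integral_indicator hm, ← integral_add_right_eq_self _ ζ]
        congr 1; ext η
        by_cases h : η ∈ lightCone E
        · rw [Set.indicator_of_mem h, Set.indicator_of_mem (add_mem_lightCone h hζm),
            add_sub_cancel_right]
        · rw [Set.indicator_of_notMem h]
          have h0 : hardyFourier k e₁ e₂ η = 0 :=
            hardyFourier_eq_zero (by omega) hk he₁ he₂ (not_le.1 h)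
          by_cases h' : η + ζ ∈ lightCone E
          · rw [Set.indicator_of_mem h', add_sub_cancel_right, h0, mul_zero]
          · rw [Set.indicator_of_notMem h']
    _ = _ := by
        rw [integral_indicator hm, ← integral_mul_const]
        congr 1; ext η
        rw [minkowski_add, hζ, minkowski_cone, neg_add, Real.exp_add]
        push_cast; ring

end Szego

/-! ### Decay of cone transforms and integrability of the pairings. -/

section ExtendedHalfWave

variable {d : ℕ}

local notation "𝔼" => EuclideanSpace ℝ (Fin d)

lemma continuous_exp_phase (ξ : 𝔼) :
    Continuous fun z : ℝ × 𝔼 => Complex.exp (Complex.I * (phase z ξ : ℝ)) := by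
  unfold phase; fun_prop

/-- On the cone the time frequency is `‖ξ‖`, so integrating by parts in time alone gives decay in
every direction of `ξ`. -/
lemma coneTransform_lineDeriv (φ : SchwartzMap (ℝ × 𝔼) ℂ) (ξ : 𝔼) :
    coneTransform (LineDeriv.lineDerivOp ((1, 0) : ℝ × 𝔼) φ) ξ =
      -(Complex.I * ‖ξ‖) * coneTransform φ ξ := by
  simp only [coneTransform_eq, SchwartzMap.lineDerivOp_apply_eq_fderiv]
  have hlin : ∀ z : ℝ × 𝔼, HasFDerivAt (fun z : ℝ × 𝔼 => ((phase z ξ : ℝ) : ℂ))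
      (Complex.ofRealCLM.comp (‖ξ‖ • ContinuousLinearMap.fst ℝ ℝ 𝔼 +
        (innerSL ℝ ξ).comp (ContinuousLinearMap.snd ℝ ℝ 𝔼))) z := by
    intro z
    have := (Complex.ofRealCLM.comp (‖ξ‖ • ContinuousLinearMap.fst ℝ ℝ 𝔼 +
        (innerSL ℝ ξ).comp (ContinuousLinearMap.snd ℝ ℝ 𝔼))).hasFDerivAt (x := z)
    refine this.congr_of_eventuallyEq (Filter.Eventually.of_forall fun y => ?_)
    simp [phase, real_inner_comm ξ y.2, mul_comm]
  have hexp : ∀ z : ℝ × 𝔼, HasFDerivAt (fun z : ℝ × 𝔼 => Complex.exp (Complex.I * (phase z ξ : ℝ)))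
      (Complex.exp (Complex.I * (phase z ξ : ℝ)) • (Complex.I • (Complex.ofRealCLM.comp
        (‖ξ‖ • ContinuousLinearMap.fst ℝ ℝ 𝔼 +
        (innerSL ℝ ξ).comp (ContinuousLinearMap.snd ℝ ℝ 𝔼))))) z := fun z =>
    ((hlin z).const_mul Complex.I).cexp
  have hfd : ∀ z : ℝ × 𝔼, fderiv ℝ (fun z : ℝ × 𝔼 => Complex.exp (Complex.I * (phase z ξ : ℝ))) z
      (1, 0) = Complex.I * ‖ξ‖ * Complex.exp (Complex.I * (phase z ξ : ℝ)) := by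
    intro z
    rw [(hexp z).fderiv]
    simp; ring
  have hb : ∀ {f : ℝ × 𝔼 → ℂ}, Integrable f →
      Integrable fun z => Complex.exp (Complex.I * (phase z ξ : ℝ)) * f z := fun hf =>
    hf.bdd_mul (c := 1) (continuous_exp_phase ξ).aestronglyMeasurable
      (Filter.Eventually.of_forall fun z => (norm_exp_I_mul _).le)
  have i1 : Integrable fun z => Complex.exp (Complex.I * (phase z ξ : ℝ)) * φ z := hb φ.integrable
  have i2 : Integrable fun z => Complex.exp (Complex.I * (phase z ξ : ℝ)) *
      fderiv ℝ φ z (1, 0) := by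
    have := (LineDeriv.lineDerivOp ((1, 0) : ℝ × 𝔼) φ).integrable (μ := volume)
    refine hb (this.congr (Filter.Eventually.of_forall fun z => ?_))
    exact SchwartzMap.lineDerivOp_apply_eq_fderiv _ _ _
  have key := integral_mul_fderiv_eq_neg_fderiv_mul_of_integrable (μ := (volume : Measure (ℝ × 𝔼)))
    (f := fun z => Complex.exp (Complex.I * (phase z ξ : ℝ))) (g := φ) (v := (1, 0)) ?_ i2 i1
    (fun z _ => (hexp z).differentiableAt) (fun z _ => φ.differentiableAt)
  · rw [key, neg_mul, ← integral_const_mul]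
    congr 2; ext z
    rw [hfd]; ring
  · simp only [hfd, mul_assoc]
    exact (i1.const_mul _).const_mul _

lemma norm_coneTransform_le (φ : SchwartzMap (ℝ × 𝔼) ℂ) (ξ : 𝔼) :
    ‖coneTransform φ ξ‖ ≤ ∫ z, ‖φ z‖ := by
  rw [coneTransform_eq]
  refine norm_integral_le_of_norm_le φ.integrable.norm (Filter.Eventually.of_forall fun z => ?_)
  rw [norm_mul, norm_exp_I_mul, one_mul]

lemma exists_pow_mul_coneTransform_le (m : ℕ) : ∀ φ : SchwartzMap (ℝ × 𝔼) ℂ,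
    ∃ C : ℝ, ∀ ξ, ‖ξ‖ ^ m * ‖coneTransform φ ξ‖ ≤ C := by
  induction m with
  | zero => exact fun φ => ⟨_, fun ξ => by simpa using norm_coneTransform_le φ ξ⟩
  | succ m ih =>
    intro φ
    obtain ⟨C, hC⟩ := ih (LineDeriv.lineDerivOp ((1, 0) : ℝ × 𝔼) φ)
    refine ⟨C, fun ξ => ?_⟩
    have := hC ξ
    rw [coneTransform_lineDeriv, norm_mul, norm_neg, norm_mul, Complex.norm_I, one_mul,
      Complex.norm_real, norm_norm] at this
    rw [pow_succ, mul_assoc]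
    exact this

lemma exists_coneTransform_decay (m : ℕ) (φ : SchwartzMap (ℝ × 𝔼) ℂ) :
    ∃ C : ℝ, ∀ ξ, ‖coneTransform φ ξ‖ * (1 + ‖ξ‖) ^ m ≤ C := by
  obtain ⟨C, hC⟩ := exists_pow_mul_coneTransform_le 0 φ
  obtain ⟨C', hC'⟩ := exists_pow_mul_coneTransform_le m φ
  refine ⟨2 ^ (m - 1) * (C + C'), fun ξ => ?_⟩
  have h1 := add_pow_le zero_le_one (norm_nonneg ξ) m
  have h2 := hC ξ
  have h3 := hC' ξ
  rw [one_pow] at h1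
  rw [pow_zero, one_mul] at h2
  calc _ ≤ ‖coneTransform φ ξ‖ * (2 ^ (m - 1) * (1 + ‖ξ‖ ^ m)) := by gcongr
    _ = 2 ^ (m - 1) * (‖coneTransform φ ξ‖ + ‖ξ‖ ^ m * ‖coneTransform φ ξ‖) := by ring
    _ ≤ _ := by gcongr

lemma volume_absolutelyContinuous_freqMeasure (hd : 1 ≤ d) (p : ℝ) :
    (volume : Measure 𝔼) ≪ freqMeasure d p := by
  have : Nontrivial 𝔼 := Module.nontrivial_of_finrank_pos (R := ℝ) (by
    rw [finrank_euclideanSpace_fin]; omega)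
  refine withDensity_absolutelyContinuous' (by fun_prop) ?_
  filter_upwards [Measure.ae_ne volume (0:𝔼)] with ξ hξ
  have : 0 < ‖ξ‖ := norm_pos_iff.2 hξ
  simpa using Real.rpow_pos_of_pos this _

/-- Use `|G H| ≤ |ξ| |G|² + |ξ|⁻¹ |H|²`. The first term is integrable because the frequency weight
is `|ξ|` for `p = 2`. The second is dominated near the origin by `|ξ|⁻¹ exp (-|ξ|)` and away from it
by a power of decay `d + 1`. -/
lemma integrable_mul_of_decay (hd : 2 ≤ d) {G H : 𝔼 → ℂ}
    (hG : MemLp G (ENNReal.ofReal 2) (freqMeasure d 2)) (hH : AEStronglyMeasurable H volume) {C : ℝ}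
    (hC : ∀ ξ, ‖H ξ‖ * (1 + ‖ξ‖) ^ (d + 1) ≤ C) : Integrable fun ξ => G ξ * H ξ := by
  have : Nontrivial 𝔼 := Module.nontrivial_of_finrank_pos (R := ℝ) (by
    rw [finrank_euclideanSpace_fin]; omega)
  have hGm : AEStronglyMeasurable G volume :=
    hG.1.mono_ac (volume_absolutelyContinuous_freqMeasure (by omega) 2)
  have i1 : Integrable fun ξ : 𝔼 => ‖ξ‖ * ‖G ξ‖ ^ 2 := by
    have h1 := hG.integrable_norm_rpow (by simp) ENNReal.ofReal_ne_top
    have h2 := integrable_freqMeasure_iff.1 h1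
    refine h2.congr (Filter.Eventually.of_forall fun ξ => ?_)
    simp only [ENNReal.toReal_ofReal zero_le_two, smul_eq_mul, Real.rpow_two]
    norm_num
  have i2 := integrable_norm_pow_inv_exp (E := 𝔼) (by rwa [finrank_euclideanSpace_fin]) 0 one_pos
  have i3 : Integrable fun ξ : 𝔼 => (1 + ‖ξ‖) ^ (-((d : ℝ) + 1)) :=
    integrable_one_add_norm (by rw [finrank_euclideanSpace_fin]; linarith)
  refine (i1.add (((i2.const_mul (Real.exp 1)).add i3).const_mul (C ^ 2))).mono' (hGm.mul hH) ?_
  filter_upwards [Measure.ae_ne volume (0:𝔼)] with ξ hξ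
  have hn : 0 < ‖ξ‖ := norm_pos_iff.2 hξ
  have h1 : ‖H ξ‖ ^ 2 * ((1 + ‖ξ‖) ^ (d + 1)) ^ 2 ≤ C ^ 2 := by
    rw [← mul_pow]
    exact pow_le_pow_left₀ (by positivity) (hC ξ) 2
  set W := (1 + ‖ξ‖) ^ (d + 1) with hW
  have hW1 : 1 ≤ W := one_le_pow₀ (by linarith)
  have h2 : (1 + ‖ξ‖) ^ (-((d : ℝ) + 1)) = W⁻¹ := by
    rw [Real.rpow_neg (by positivity), ← Nat.cast_succ, Real.rpow_natCast]
  have h3 : ‖ξ‖⁻¹ * (W ^ 2)⁻¹ ≤ Real.exp 1 * (‖ξ‖⁻¹ * Real.exp (-‖ξ‖)) + W⁻¹ := by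
    rcases le_total ‖ξ‖ 1 with h | h
    · have e1 : 1 ≤ Real.exp 1 * Real.exp (-‖ξ‖) := by
        rw [← Real.exp_add]; exact Real.one_le_exp (by linarith)
      have e2 : (W ^ 2)⁻¹ ≤ 1 := inv_le_one_of_one_le₀ (one_le_pow₀ hW1)
      calc ‖ξ‖⁻¹ * (W ^ 2)⁻¹ ≤ ‖ξ‖⁻¹ * (Real.exp 1 * Real.exp (-‖ξ‖)) := by
            gcongr; exact e2.trans e1
        _ = Real.exp 1 * (‖ξ‖⁻¹ * Real.exp (-‖ξ‖)) := by ring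
        _ ≤ _ := le_add_of_nonneg_right (by positivity)
    · have e1 : ‖ξ‖⁻¹ ≤ 1 := inv_le_one_of_one_le₀ h
      have e2 : (W ^ 2)⁻¹ ≤ W⁻¹ := by
        gcongr; nlinarith
      calc ‖ξ‖⁻¹ * (W ^ 2)⁻¹ ≤ 1 * W⁻¹ := by gcongr
        _ = W⁻¹ := one_mul _
        _ ≤ _ := le_add_of_nonneg_left (by positivity)
  have h4 : ‖ξ‖⁻¹ * ‖H ξ‖ ^ 2 ≤ C ^ 2 * (‖ξ‖⁻¹ * (W ^ 2)⁻¹) := by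
    have : ‖H ξ‖ ^ 2 ≤ C ^ 2 * (W ^ 2)⁻¹ := by
      rw [← div_eq_mul_inv, le_div_iff₀ (by positivity)]; exact h1
    calc _ ≤ ‖ξ‖⁻¹ * (C ^ 2 * (W ^ 2)⁻¹) := by gcongr
      _ = _ := by ring
  have h5 : ‖G ξ‖ * ‖H ξ‖ ≤ ‖ξ‖ * ‖G ξ‖ ^ 2 + ‖ξ‖⁻¹ * ‖H ξ‖ ^ 2 := by
    have e1 : ‖ξ‖ * ‖ξ‖⁻¹ = 1 := mul_inv_cancel₀ hn.ne'
    have e2 : 0 < ‖ξ‖⁻¹ := by positivity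
    have e3 : ‖ξ‖ * ‖G ξ‖ ^ 2 + ‖ξ‖⁻¹ * ‖H ξ‖ ^ 2 - 2 * (‖G ξ‖ * ‖H ξ‖) =
        ‖ξ‖ * (‖G ξ‖ - ‖ξ‖⁻¹ * ‖H ξ‖) ^ 2 := by
      field_simp; ring
    have e4 : 0 ≤ ‖ξ‖ * (‖G ξ‖ - ‖ξ‖⁻¹ * ‖H ξ‖) ^ 2 := by positivity
    have e5 : 0 ≤ ‖G ξ‖ * ‖H ξ‖ := by positivity
    linarith
  simp only [Pi.add_apply, pow_zero, mul_one, one_mul, h2, norm_mul]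
  refine h5.trans ?_
  exact add_le_add le_rfl (h4.trans (mul_le_mul_of_nonneg_left h3 (sq_nonneg C)))

/-- Waves in `L^q` pair integrably with functions of the decay of the dual power. -/
lemma integrable_wave_mul_quad (hd : 2 ≤ d) {q M : ℝ} (hq : 1 < q)
    (hN : (d : ℝ) < q * ((d : ℝ) - 1) / 2) (hM : (q - 1) * ((d : ℝ) - 1) / 2 ≤ M)
    {v : ℝ × 𝔼 → ℂ} (hv : MemLp v (ENNReal.ofReal q) volume) :
    Integrable fun z => ‖v z‖ * ‖quad ((1, 0) : ℝ × 𝔼) z‖ ^ (-M) := by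
  have hq0 : 0 < q := by linarith
  have i1 : Integrable fun z => ‖v z‖ ^ q := by
    have := hv.integrable_norm_rpow (by simpa using hq0) ENNReal.ofReal_ne_top
    rwa [ENNReal.toReal_ofReal hq0.le] at this
  have i2 := integrable_norm_quad_reference (E := 𝔼) (N := q * ((d : ℝ) - 1) / 2)
    (by rwa [finrank_euclideanSpace_fin]) (by rw [finrank_euclideanSpace_fin]; omega)
  have hc := continuous_quad ((1, 0) : ℝ × 𝔼)
  refine (i1.add i2).mono' (hv.1.norm.mul (Measurable.aestronglyMeasurable (by fun_prop)))
    (Filter.Eventually.of_forall fun z => ?_)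
  have hR := one_le_norm_quad_reference z
  set R := ‖quad ((1, 0) : ℝ × 𝔼) z‖
  have hR0 : 0 < R := by linarith
  rw [Real.norm_of_nonneg (by positivity)]
  set b := R ^ (-(((d : ℝ) - 1) / 2)) with hb
  have hb0 : 0 < b := Real.rpow_pos_of_pos hR0 _
  have h1 : R ^ (-M) ≤ b ^ (q - 1) := by
    rw [hb, ← Real.rpow_mul hR0.le]
    exact Real.rpow_le_rpow_of_exponent_le hR (by linarith)
  have h2 : R ^ (-(q * ((d : ℝ) - 1) / 2)) = b ^ q := by
    rw [hb, ← Real.rpow_mul hR0.le]; congr 1; ring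
  change _ ≤ ‖v z‖ ^ q + R ^ (-(q * ((d : ℝ) - 1) / 2))
  rw [h2]
  have hmul : ∀ x : ℝ, 0 ≤ x → x * x ^ (q - 1) = x ^ q := by
    intro x hx
    rcases hx.eq_or_lt with rfl | hx
    · rw [Real.zero_rpow hq0.ne', zero_mul]
    · rw [← Real.rpow_one_add' hx.le (by linarith)]; congr 1; ring
  refine (mul_le_mul_of_nonneg_left h1 (norm_nonneg _)).trans ?_
  -- A crude form of Young's inequality: `‖v‖ * b^(q-1)` is at most the `q`-th power of the larger
  -- of `‖v‖` and `b`.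
  rcases le_total ‖v z‖ b with h | h
  · calc _ ≤ b * b ^ (q - 1) := by gcongr
      _ = b ^ q := hmul b hb0.le
      _ ≤ _ := le_add_of_nonneg_left (by positivity)
  · calc _ ≤ ‖v z‖ * ‖v z‖ ^ (q - 1) := by
          gcongr
      _ = ‖v z‖ ^ q := hmul _ (norm_nonneg _)
      _ ≤ _ := le_add_of_nonneg_right (by positivity)

lemma coneTransform_compSubConst (φ : SchwartzMap (ℝ × 𝔼) ℂ) (y : ℝ × 𝔼) (ξ : 𝔼) :
    coneTransform (SchwartzMap.compSubConstCLM ℂ y φ) ξ =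
      Complex.exp (Complex.I * (phase y ξ : ℝ)) * coneTransform φ ξ := by
  rw [coneTransform_eq, coneTransform_eq, ← integral_const_mul, ← integral_add_right_eq_self _ y]
  congr 1; ext z
  have : phase (z + y) ξ = phase z ξ + phase y ξ := by
    simp only [phase, Prod.fst_add, Prod.snd_add, inner_add_left]; ring
  rw [SchwartzMap.compSubConstCLM_apply, add_sub_cancel_right, this]
  push_cast
  rw [mul_add, Complex.exp_add]
  ring

end ExtendedHalfWave

/-! ### Testing half-waves against continuous functions of finite decay. -/

section ExtendedHalfWave

variable {d : ℕ}

local notation "𝔼" => EuclideanSpace ℝ (Fin d)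

lemma phase_add (z y : ℝ × 𝔼) (ξ : 𝔼) : phase (z + y) ξ = phase z ξ + phase y ξ := by
  simp only [phase, Prod.fst_add, Prod.snd_add, inner_add_left]; ring

/-- The half-wave identity averaged over translates of a Schwartz function. -/
lemma IsHalfWave.average {G : 𝔼 → ℂ} {v φ : ℝ × 𝔼 → ℂ} (h : IsHalfWave G v)
    (ψ : SchwartzMap (ℝ × 𝔼) ℂ) (hG : Integrable fun ξ => G ξ * coneTransform ψ ξ)
    (hφ : Integrable φ)
    (hv : Integrable (Function.uncurry fun y z : ℝ × 𝔼 => φ y * (v z * ψ (z - y)))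
      (volume.prod volume)) :
    ∫ z, v z * ∫ y, ψ (z - y) * φ y = (((2 * Real.pi) ^ d)⁻¹ : ℝ) *
      ∫ ξ, G ξ * coneTransform ψ ξ * ∫ z, Complex.exp (Complex.I * (phase z ξ : ℝ)) * φ z := by
  have hint : Integrable (Function.uncurry fun (y : ℝ × 𝔼) (ξ : 𝔼) => φ y *
      (G ξ * (Complex.exp (Complex.I * (phase y ξ : ℝ)) * coneTransform ψ ξ)))
      (volume.prod volume) := by
    have h1 := hφ.mul_prod hG
    have h3 : Continuous fun y : (ℝ × 𝔼) × 𝔼 => Complex.exp (Complex.I * (phase y.1 y.2 : ℝ)) := by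
      unfold phase; fun_prop
    refine (h1.bdd_mul (c := 1) h3.aestronglyMeasurable (Filter.Eventually.of_forall fun y =>
      (norm_exp_I_mul _).le)).congr (Filter.Eventually.of_forall fun y => ?_)
    simp only [Function.uncurry]; ring
  calc ∫ z, v z * ∫ y, ψ (z - y) * φ y
      = ∫ z, ∫ y, φ y * (v z * ψ (z - y)) := by
        congr 1; ext z
        rw [← integral_const_mul]
        congr 1; ext y; ring
    _ = ∫ y, ∫ z, φ y * (v z * ψ (z - y)) := (integral_integral_swap hv).symm
    _ = ∫ y, (((2 * Real.pi) ^ d)⁻¹ : ℝ) * ∫ ξ, φ y *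
          (G ξ * (Complex.exp (Complex.I * (phase y ξ : ℝ)) * coneTransform ψ ξ)) := by
        congr 1; ext y
        have h1 := h (SchwartzMap.compSubConstCLM ℂ y ψ)
        simp only [SchwartzMap.compSubConstCLM_apply, coneTransform_compSubConst] at h1
        rw [integral_const_mul, h1, integral_const_mul]
        ring
    _ = (((2 * Real.pi) ^ d)⁻¹ : ℝ) * ∫ ξ, ∫ y, φ y *
          (G ξ * (Complex.exp (Complex.I * (phase y ξ : ℝ)) * coneTransform ψ ξ)) := by
        rw [integral_const_mul, integral_integral_swap hint]
    _ = _ := by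
        congr 2; ext ξ
        rw [← integral_const_mul]
        congr 1; ext y; ring

/-- A smooth bump supported in the ball of radius `1 / (n + 1)`. -/
noncomputable def shrinkingBump (d n : ℕ) : ContDiffBump (0 : ℝ × EuclideanSpace ℝ (Fin d)) where
  rIn := 1 / (2 * ((n : ℝ) + 1))
  rOut := 1 / ((n : ℝ) + 1)
  rIn_pos := by positivity
  rIn_lt_rOut := by
    have : (0:ℝ) < (n : ℝ) + 1 := by positivity
    apply one_div_lt_one_div_of_lt this; linarith

lemma norm_quad_reference_rpow_le_add {z y : ℝ × 𝔼} {M : ℝ} (hM : 0 ≤ M) (hy : ‖y‖ ≤ 1) :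
    ‖quad ((1, 0) : ℝ × 𝔼) (z + y)‖ ^ (-M) ≤ 10 ^ M * ‖quad ((1, 0) : ℝ × 𝔼) z‖ ^ (-M) := by
  have h2 := norm_quad_reference_le_add (z := z) (y := y)
    ((norm_fst_le y).trans hy) ((norm_snd_le y).trans hy)
  have h3 := one_le_norm_quad_reference z
  have h4 := one_le_norm_quad_reference (z + y)
  rw [Real.rpow_neg (by positivity), Real.rpow_neg (by positivity), ← div_eq_mul_inv,
    inv_le_comm₀ (by positivity) (by positivity), inv_div, div_le_iff₀ (by positivity),
    ← Real.mul_rpow (by positivity) (by positivity), mul_comm _ (10:ℝ)]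
  exact Real.rpow_le_rpow (by positivity) h2 hM

/-- The half-wave identity for continuous test functions with sufficient decay. -/
theorem IsAdmissible.integral_mul (hd : 2 ≤ d) {q M : ℝ} (hq : 1 < q)
    (hN : (d : ℝ) < q * ((d : ℝ) - 1) / 2) (hM : (q - 1) * ((d : ℝ) - 1) / 2 ≤ M)
    (hdM : (d : ℝ) < M) {G : 𝔼 → ℂ} {v φ : ℝ × 𝔼 → ℂ} (h : IsAdmissible 2 q G v)
    (hφ : Continuous φ) {B : ℝ} (hB : ∀ z, ‖φ z‖ ≤ B * ‖quad ((1, 0) : ℝ × 𝔼) z‖ ^ (-M))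
    {H : 𝔼 → ℂ} (hHc : Continuous H)
    (hH : ∀ ξ, ∫ z, Complex.exp (Complex.I * (phase z ξ : ℝ)) * φ z = H ξ) {C : ℝ}
    (hHC : ∀ ξ, ‖H ξ‖ * (1 + ‖ξ‖) ^ (d + 1) ≤ C) :
    ∫ z, v z * φ z = (((2 * Real.pi) ^ d)⁻¹ : ℝ) * ∫ ξ, G ξ * H ξ := by
  have hM0 : 0 ≤ M := (Nat.cast_nonneg d).trans hdM.le
  have hvq := integrable_wave_mul_quad hd hq hN hM h.memLp_wave
  have hvm := h.memLp_wave.1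
  have hw := integrable_norm_quad_reference (E := 𝔼) (N := M)
    (by rwa [finrank_euclideanSpace_fin]) (by rw [finrank_euclideanSpace_fin]; omega)
  have hB0 : 0 ≤ B := by
    have h1 := (norm_nonneg _).trans (hB 0)
    have h2 : 0 < ‖quad ((1, 0) : ℝ × 𝔼) 0‖ ^ (-M) :=
      Real.rpow_pos_of_pos (by linarith [one_le_norm_quad_reference (0 : ℝ × 𝔼)]) _
    exact nonneg_of_mul_nonneg_left h1 h2
  have hφi : Integrable φ :=
    (hw.const_mul B).mono' hφ.aestronglyMeasurable (Filter.Eventually.of_forall hB)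
  have hGH := integrable_mul_of_decay hd h.memLp_freq hHc.aestronglyMeasurable hHC
  -- The test function is not Schwartz, so it is mollified. The half-wave identity holds for the
  -- average of translates of each bump, and both sides converge as the bumps shrink.
  set b : ℕ → ContDiffBump (0 : ℝ × 𝔼) := fun n => shrinkingBump d n with hb
  set ρ : ℕ → ℝ × 𝔼 → ℝ := fun n => (b n).normed volume with hρ
  have hρc : ∀ n, HasCompactSupport fun z => ((ρ n z : ℝ) : ℂ) := fun n =>
    ((b n).hasCompactSupport_normed).comp_left (g := Complex.ofReal) (by simp)
  have hρs : ∀ n, ContDiff ℝ ∞ fun z => ((ρ n z : ℝ) : ℂ) := fun n =>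
    Complex.ofRealCLM.contDiff.comp (b n).contDiff_normed
  set ψ : ℕ → SchwartzMap (ℝ × 𝔼) ℂ := fun n => (hρc n).toSchwartzMap (hρs n) with hψ
  have hψa : ∀ n z, ψ n z = (ρ n z : ℂ) := fun n z => rfl
  have hρ0 : ∀ n z, 0 ≤ ρ n z := fun n z => (b n).nonneg_normed z
  have hρ1 : ∀ n, ∫ z, ρ n z = 1 := fun n => (b n).integral_normed
  have hρi : ∀ n, Integrable (ρ n) := fun n => (b n).integrable_normed
  have hρcont : ∀ n, Continuous (ρ n) := fun n => (b n).continuous_normed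
  have hsupp : ∀ n z, ρ n z ≠ 0 → ‖z‖ ≤ 1 := by
    intro n z hz
    have h1 : z ∈ Function.support ((b n).normed volume) := hz
    rw [(b n).support_normed_eq, mem_ball_zero_iff] at h1
    refine h1.le.trans ?_
    change 1 / ((n : ℝ) + 1) ≤ 1
    rw [div_le_one (by positivity)]
    linarith [Nat.cast_nonneg (α := ℝ) n]
  have hR0 : ∀ z : ℝ × 𝔼, 0 ≤ ‖quad ((1, 0) : ℝ × 𝔼) z‖ ^ (-M) := fun z => by positivity
  -- Only `y` within distance `1` of `z` matter, so the decay of `φ` at `y` transfers to `z` with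
  -- the factor `10 ^ M`.
  have hloc : ∀ n z y, ‖ρ n (z - y)‖ * ‖φ y‖ ≤
      ρ n (z - y) * (B * 10 ^ M * ‖quad ((1, 0) : ℝ × 𝔼) z‖ ^ (-M)) := by
    intro n z y
    rw [Real.norm_of_nonneg (hρ0 _ _)]
    by_cases h0 : ρ n (z - y) = 0
    · rw [h0, zero_mul, zero_mul]
    · refine mul_le_mul_of_nonneg_left ?_ (hρ0 _ _)
      have h1 := norm_quad_reference_rpow_le_add (z := z) (y := y - z) hM0 (by
        rw [norm_sub_rev]; exact hsupp n _ h0)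
      rw [add_sub_cancel] at h1
      calc _ ≤ B * ‖quad ((1, 0) : ℝ × 𝔼) y‖ ^ (-M) := hB y
        _ ≤ B * (10 ^ M * ‖quad ((1, 0) : ℝ × 𝔼) z‖ ^ (-M)) := by gcongr
        _ = _ := by ring
  have hstep : ∀ n, ∫ z, v z * ∫ y, ψ n (z - y) * φ y = (((2 * Real.pi) ^ d)⁻¹ : ℝ) *
      ∫ ξ, G ξ * coneTransform (ψ n) ξ * H ξ := by
    intro n
    obtain ⟨C', hC'⟩ := exists_coneTransform_decay (d + 1) (ψ n)
    have hcm : AEStronglyMeasurable (coneTransform (ψ n)) volume := by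
      refine StronglyMeasurable.aestronglyMeasurable ?_
      refine StronglyMeasurable.integral_prod_right (f := fun (ξ : 𝔼) (z : ℝ × 𝔼) =>
        Complex.exp (Complex.I * ((z.1 * ‖ξ‖ + inner ℝ z.2 ξ : ℝ) : ℂ)) * ψ n z) ?_
      refine Continuous.stronglyMeasurable ?_
      have := (ψ n).continuous
      simp only [Function.uncurry_def]
      fun_prop
    have h1 := h.isHalfWave.average (ψ n)
      (integrable_mul_of_decay hd h.memLp_freq hcm hC') hφi ?_
    · simpa only [hH] using h1
    · have h2 : Integrable (fun z => ‖v z‖ * (B * 10 ^ M * ‖quad ((1, 0) : ℝ × 𝔼) z‖ ^ (-M))) := by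
        refine (hvq.const_mul (B * 10 ^ M)).congr (Filter.Eventually.of_forall fun z => ?_)
        simp only; ring
      have h3 : Integrable fun w => ρ n (-w) := (hρi n).comp_neg
      have h4 := h2.convolution_integrand (ContinuousLinearMap.mul ℝ ℝ) h3
      have h5 := hρcont n
      refine h4.mono' ?_ (Filter.Eventually.of_forall fun p => ?_)
      · refine (hφ.comp continuous_fst).aestronglyMeasurable.mul (hvm.comp_snd.mul ?_)
        have h6 : Continuous fun p : (ℝ × 𝔼) × (ℝ × 𝔼) => ψ n (p.2 - p.1) :=
          (ψ n).continuous.comp (by fun_prop)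
        exact h6.aestronglyMeasurable
      · simp only [Function.uncurry, ContinuousLinearMap.mul_apply', neg_sub]
        rw [norm_mul, norm_mul, hψa, Complex.norm_real]
        have := mul_le_mul_of_nonneg_left (hloc n p.2 p.1) (norm_nonneg (v p.2))
        linarith
  have hrad : Filter.Tendsto (fun n => (b n).rOut) Filter.atTop (nhds 0) :=
    tendsto_one_div_add_atTop_nhds_zero_nat
  have hconv : ∀ (g : ℝ × 𝔼 → ℂ), Continuous g → ∀ z,
      Filter.Tendsto (fun n => ∫ y, (ρ n (z - y) : ℂ) * g y) Filter.atTop (nhds (g z)) := by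
    intro g hg z
    have h1 := ContDiffBump.convolution_tendsto_right_of_continuous (μ := volume) hrad hg z
    refine h1.congr fun n => ?_
    rw [convolution_def, ← integral_sub_left_eq_self _ volume z]
    congr 1; ext y
    simp only [sub_sub_cancel, ContinuousLinearMap.lsmul_apply, Complex.real_smul, hρ]
  have hleft : Filter.Tendsto (fun n => ∫ z, v z * ∫ y, ψ n (z - y) * φ y) Filter.atTop
      (nhds (∫ z, v z * φ z)) := by
    refine tendsto_integral_of_dominated_convergence
      (fun z => B * 10 ^ M * (‖v z‖ * ‖quad ((1, 0) : ℝ × 𝔼) z‖ ^ (-M))) (fun n => ?_)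
      (hvq.const_mul _) (fun n => Filter.Eventually.of_forall fun z => ?_)
      (Filter.Eventually.of_forall fun z => ?_)
    · refine hvm.mul (StronglyMeasurable.aestronglyMeasurable ?_)
      refine StronglyMeasurable.integral_prod_right
        (f := fun (z y : ℝ × 𝔼) => ψ n (z - y) * φ y) ?_
      refine Continuous.stronglyMeasurable ?_
      have := (ψ n).continuous
      simp only [Function.uncurry_def]
      fun_prop
    · rw [norm_mul]
      have h1 : ‖∫ y, ψ n (z - y) * φ y‖ ≤
          ∫ y, ρ n (z - y) * (B * 10 ^ M * ‖quad ((1, 0) : ℝ × 𝔼) z‖ ^ (-M)) := by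
        refine norm_integral_le_of_norm_le (((hρi n).comp_sub_left z).mul_const _)
          (Filter.Eventually.of_forall fun y => ?_)
        rw [norm_mul, hψa, Complex.norm_real]
        exact hloc n z y
      rw [integral_mul_const, integral_sub_left_eq_self (ρ n) volume z, hρ1, one_mul] at h1
      calc _ ≤ ‖v z‖ * (B * 10 ^ M * ‖quad ((1, 0) : ℝ × 𝔼) z‖ ^ (-M)) := by gcongr
        _ = _ := by ring
    · exact (hconv φ hφ z).const_mul (v z)
  have hright : Filter.Tendsto (fun n => (((2 * Real.pi) ^ d)⁻¹ : ℝ) *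
      ∫ ξ, G ξ * coneTransform (ψ n) ξ * H ξ) Filter.atTop
      (nhds ((((2 * Real.pi) ^ d)⁻¹ : ℝ) * ∫ ξ, G ξ * H ξ)) := by
    refine Filter.Tendsto.const_mul _ ?_
    refine tendsto_integral_of_dominated_convergence (fun ξ => ‖G ξ * H ξ‖) (fun n => ?_)
      hGH.norm (fun n => Filter.Eventually.of_forall fun ξ => ?_)
      (Filter.Eventually.of_forall fun ξ => ?_)
    · have hcm : StronglyMeasurable (coneTransform (ψ n)) := by
        refine StronglyMeasurable.integral_prod_right (f := fun (ξ : 𝔼) (z : ℝ × 𝔼) =>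
          Complex.exp (Complex.I * ((z.1 * ‖ξ‖ + inner ℝ z.2 ξ : ℝ) : ℂ)) * ψ n z) ?_
        refine Continuous.stronglyMeasurable ?_
        have := (ψ n).continuous
        simp only [Function.uncurry_def]
        fun_prop
      refine (hGH.1.mul hcm.aestronglyMeasurable).congr (Filter.Eventually.of_forall fun ξ => ?_)
      simp only [Pi.mul_apply]; ring
    · have h1 := norm_coneTransform_le (ψ n) ξ
      have h2 : ∫ z, ‖ψ n z‖ = 1 := by
        rw [← hρ1 n]
        congr 1; ext z
        rw [hψa, Complex.norm_real, Real.norm_of_nonneg (hρ0 n z)]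
      rw [h2] at h1
      rw [mul_right_comm, norm_mul]
      exact mul_le_of_le_one_right (norm_nonneg _) h1
    -- The cone transform of the bump is the bump tested on a character, hence tends to the value
    -- `1` of that character at the origin.
    · have h1 := hconv (fun y => Complex.exp (Complex.I * (phase (-y) ξ : ℝ))) (by
        unfold phase; fun_prop) 0
      have h2 : ∀ n, ∫ y, (ρ n (0 - y) : ℂ) * Complex.exp (Complex.I * (phase (-y) ξ : ℝ)) =
          coneTransform (ψ n) ξ := by
        intro n
        rw [coneTransform_eq, ← integral_neg_eq_self
          (fun z => Complex.exp (Complex.I * (phase z ξ : ℝ)) * ψ n z)]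
        congr 1; ext y
        rw [zero_sub, hψa, mul_comm]
      simp only [h2] at h1
      have h3 : Complex.exp (Complex.I * (phase (-(0 : ℝ × 𝔼)) ξ : ℝ)) = 1 := by
        simp [phase]
      rw [h3] at h1
      simpa using (h1.const_mul (G ξ)).mul_const (H ξ)
  exact tendsto_nhds_unique hleft (by simpa only [hstep] using hright)

end ExtendedHalfWave

/-! ### The dual wave at `q = 2(d+1)/(d-1)` and criticality for `p = 2`. -/

section Critical

variable {d : ℕ}

local notation "𝔼" => EuclideanSpace ℝ (Fin d)

lemma exists_norm_quad_reference_le_add (y : ℝ × 𝔼) : ∃ L : ℝ, 0 < L ∧ ∀ z,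
    ‖quad ((1, 0) : ℝ × 𝔼) z‖ ≤ L * ‖quad ((1, 0) : ℝ × 𝔼) (z + y)‖ := by
  set a := |y.1| + ‖y.2‖ with ha
  have ha0 : 0 ≤ a := by positivity
  refine ⟨2 * (1 + a ^ 2), by positivity, fun z => ?_⟩
  apply le_of_sq_le_sq _ (by positivity)
  have key : ∀ s t : ℝ, |s - t| ≤ a → 1 + s ^ 2 ≤ 2 * (1 + a ^ 2) * (1 + t ^ 2) := by
    intro s t h
    have h1 : (s - t) ^ 2 ≤ a ^ 2 := by
      rw [← sq_abs]; exact pow_le_pow_left₀ (abs_nonneg _) h 2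
    nlinarith [sq_nonneg (s - 2 * t), mul_nonneg (sq_nonneg a) (sq_nonneg t)]
  have h1 := norm_sub_norm_le z.2 (z + y).2
  have h2 := norm_sub_norm_le (z + y).2 z.2
  have e1 : z.2 - (z + y).2 = -y.2 := by simp
  have e2 : (z + y).2 - z.2 = y.2 := by simp
  rw [e1, norm_neg] at h1
  rw [e2] at h2
  have h3 := abs_le.1 (le_refl |y.1|)
  have e3 : (z + y).1 = z.1 + y.1 := rfl
  have k1 := key (z.1 - ‖z.2‖) ((z + y).1 - ‖(z + y).2‖)
    (abs_le.2 ⟨by rw [e3]; linarith, by rw [e3]; linarith⟩)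
  have k2 := key (z.1 + ‖z.2‖) ((z + y).1 + ‖(z + y).2‖)
    (abs_le.2 ⟨by rw [e3]; linarith, by rw [e3]; linarith⟩)
  rw [mul_pow, norm_quad_reference_sq, norm_quad_reference_sq]
  calc _ ≤ (2 * (1 + a ^ 2) * (1 + ((z + y).1 - ‖(z + y).2‖) ^ 2)) *
        (2 * (1 + a ^ 2) * (1 + ((z + y).1 + ‖(z + y).2‖) ^ 2)) := by gcongr
    _ = _ := by ring

lemma rpow_neg_le_of_le_mul {R R' K N : ℝ} (hN : 0 ≤ N) (hR : 1 ≤ R) (hK : 0 < K)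
    (h : R ≤ K * R') : R' ^ (-N) ≤ K ^ N * R ^ (-N) := by
  have hR' : 0 < R' := pos_of_mul_pos_right (lt_of_lt_of_le (by linarith) h) hK.le
  rw [Real.rpow_neg (by positivity), Real.rpow_neg (by positivity), ← div_eq_mul_inv,
    inv_le_comm₀ (by positivity) (by positivity), inv_div, div_le_iff₀ (by positivity),
    ← Real.mul_rpow (by positivity) (by positivity), mul_comm _ K]
  exact Real.rpow_le_rpow (by positivity) h hN

lemma quad_smul_eq (e z : ℝ × 𝔼) {a : ℝ} (ha : a ≠ 0) :
    quad (a • e) z = (a : ℂ) ^ 2 * quad e (a⁻¹ • z) := by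
  have : (a : ℂ) ≠ 0 := by exact_mod_cast ha
  rw [quad_smul_left, quad_path]
  push_cast
  field_simp

lemma exists_exp_neg_rho_mul_le {e : ℝ × 𝔼} (he : ‖e.2‖ < e.1) (m : ℕ) :
    ∃ C : ℝ, ∀ ξ, Real.exp (-rho e ξ) * (1 + ‖ξ‖) ^ m ≤ C := by
  have hσ : 0 < e.1 - ‖e.2‖ := sub_pos.2 he
  set σ := e.1 - ‖e.2‖ with hσd
  refine ⟨m.factorial / σ ^ m * Real.exp σ, fun ξ => ?_⟩
  have h1 := Real.pow_div_factorial_le_exp (σ * (1 + ‖ξ‖)) (by positivity) m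
  rw [div_le_iff₀ (by positivity), mul_pow] at h1
  have h2 : Real.exp (-rho e ξ) ≤ Real.exp (-(σ * ‖ξ‖)) := by
    have := rho_lower e ξ
    gcongr
  have h3 : (1 + ‖ξ‖) ^ m ≤ m.factorial / σ ^ m * Real.exp (σ * (1 + ‖ξ‖)) := by
    rw [div_mul_eq_mul_div, le_div_iff₀ (by positivity)]
    linarith
  calc _ ≤ Real.exp (-(σ * ‖ξ‖)) * (m.factorial / σ ^ m * Real.exp (σ * (1 + ‖ξ‖))) := by gcongr
    _ = m.factorial / σ ^ m * (Real.exp (-(σ * ‖ξ‖)) * Real.exp (σ * (1 + ‖ξ‖))) := by ring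
    _ = _ := by rw [← Real.exp_add]; congr 2; ring

lemma norm_szego_le [Nontrivial 𝔼] (e z : ℝ × 𝔼) (he : ‖e.2‖ < e.1) :
    ‖szego e z‖ ≤ ∫ η in lightCone 𝔼, Real.exp (-minkowski e η) := by
  refine norm_integral_le_of_norm_le (integrable_exp_neg_minkowski he)
    (Filter.Eventually.of_forall fun η => ?_)
  rw [norm_mul, norm_exp_I_mul, mul_one, Complex.norm_real, Real.norm_of_nonneg (by positivity)]

/-- The dual wave `|u|^(q-2) ū`. -/
noncomputable def dualWave (q : ℝ) (u : ℝ × 𝔼 → ℂ) (z : ℝ × 𝔼) : ℂ :=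
  ((‖u z‖ ^ (q - 2) : ℝ) : ℂ) * (starRingEnd ℂ) (u z)

/-- At the exponent `q = 2 (d + 1) / (d - 1)` the dual wave of an `𝔉`-function is holomorphic
data times a conjugate Szegő kernel. -/
lemma dualWave_eq (hd : 2 ≤ d) {q : ℝ} (hq : q * ((d : ℝ) - 1) / 2 = d + 1) {e : ℝ × 𝔼}
    (he : ‖e.2‖ < e.1) (z₀ : ℝ × 𝔼) (c : ℂ) : ∃ w : ℂ, ∀ z,
    dualWave q (foschiWave e z₀ c) z =
      w * ((quad e (z + z₀))⁻¹ * (starRingEnd ℂ) (szego e (z + z₀))) := by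
  obtain ⟨κ, hκ0, hκ⟩ := norm_foschiWave hd he z₀ c
  have hd1 : ((d : ℂ) - 1) ≠ 0 := by
    have : (d : ℂ) ≠ 1 := by exact_mod_cast (by omega : d ≠ 1)
    exact sub_ne_zero.2 this
  refine ⟨((κ ^ (q - 2) : ℝ) : ℂ) * ((((2 * Real.pi) ^ d)⁻¹ : ℝ) *
    (starRingEnd ℂ) (Complex.exp c)) / ((d : ℂ) - 1), fun z => ?_⟩
  have hQ := quad_ne_zero he (z + z₀)
  have hQ' : (starRingEnd ℂ) (quad e (z + z₀)) ≠ 0 := by simpa using hQ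
  have hn : 0 < ‖quad e (z + z₀)‖ := norm_pos_iff.2 hQ
  -- The exponent enters only here: `(q - 2)(d - 1)/2 = 2`, so the weight is an inverse square.
  have h1 : ‖foschiWave e z₀ c z‖ ^ (q - 2) = κ ^ (q - 2) * (‖quad e (z + z₀)‖ ^ 2)⁻¹ := by
    rw [hκ, Real.mul_rpow hκ0.le (by positivity), ← Real.rpow_mul hn.le,
      show -(((d : ℝ) - 1) / 2) * (q - 2) = -(2 : ℝ) by linarith, Real.rpow_neg hn.le,
      Real.rpow_two]
  -- Splitting the square as `quad · conj quad`, the conjugate factor joins `conj coneInt` to form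
  -- the conjugate Szegő kernel, and `quad⁻¹` remains.
  have h2 : ((‖quad e (z + z₀)‖ : ℂ) ^ 2) =
      quad e (z + z₀) * (starRingEnd ℂ) (quad e (z + z₀)) := (Complex.mul_conj' _).symm
  rw [dualWave, h1, szego_eq_coneInt (by rwa [finrank_euclideanSpace_fin]) he, foschiWave,
    finrank_euclideanSpace_fin]
  simp only [map_mul, map_sub, map_one, map_natCast, map_div₀, Complex.conj_ofReal]
  push_cast
  rw [h2]
  field_simp

lemma continuous_szego [Nontrivial 𝔼] {e : ℝ × 𝔼} (he : ‖e.2‖ < e.1) :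
    Continuous (szego e : ℝ × 𝔼 → ℂ) := by
  refine continuous_of_dominated (fun z => (integrable_szego he z).1)
    (fun z => Filter.Eventually.of_forall fun η => ?_) (integrable_exp_neg_minkowski he)
    (Filter.Eventually.of_forall fun η => ?_)
  · rw [norm_mul, norm_exp_I_mul, mul_one, Complex.norm_real, Real.norm_of_nonneg (by positivity)]
  · have := continuous_ell η
    fun_prop

/-- The regularising multiplier, which tends to `1` as `a → ∞`. -/
noncomputable def regularizer (e : ℝ × 𝔼) (a : ℝ) (z : ℝ × 𝔼) : ℂ :=
  (((a ^ 2 * mass e : ℝ) : ℂ) / quad (a • e) z) ^ d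

/-- The regulariser is a dilate by `a` of one fixed bounded function equal to `1` at the origin,
which yields both its uniform bound and its limit. -/
lemma regularizer_eq (e z : ℝ × 𝔼) {a : ℝ} (ha : a ≠ 0) :
    regularizer e a z = ((mass e : ℂ) / quad e (a⁻¹ • z)) ^ d := by
  have : (a : ℂ) ≠ 0 := by exact_mod_cast ha
  rw [regularizer, quad_smul_eq e z ha]
  push_cast
  rw [mul_div_mul_left _ _ (pow_ne_zero 2 this)]

lemma exists_norm_regularizer_le {e : ℝ × 𝔼} (he : ‖e.2‖ < e.1) :
    ∃ K : ℝ, 0 ≤ K ∧ ∀ a : ℝ, a ≠ 0 → ∀ z, ‖regularizer e a z‖ ≤ K := by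
  obtain ⟨K, hK, h, -⟩ := exists_norm_inv_quad_le he
  have hm := mass_pos he
  refine ⟨(mass e * K) ^ d, by positivity, fun a ha z => ?_⟩
  rw [regularizer_eq e z ha, norm_pow, div_eq_mul_inv, norm_mul, Complex.norm_real,
    Real.norm_of_nonneg hm.le]
  gcongr
  exact h _

lemma tendsto_regularizer {e : ℝ × 𝔼} (he : ‖e.2‖ < e.1) (z : ℝ × 𝔼) :
    Filter.Tendsto (fun n : ℕ => regularizer e ((n : ℝ) + 1) z) Filter.atTop (nhds 1) := by
  have hm : (mass e : ℂ) ≠ 0 := by exact_mod_cast (mass_pos he).ne'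
  have hc := continuous_quad e
  have h1 : Continuous fun s : ℝ => ((mass e : ℂ) / quad e (s • z)) ^ d :=
    (continuous_const.div (by fun_prop) fun s => quad_ne_zero he _).pow d
  have h2 := (h1.tendsto 0).comp tendsto_one_div_add_atTop_nhds_zero_nat
  have h3 : ((mass e : ℂ) / quad e ((0 : ℝ) • z)) ^ d = 1 := by
    rw [quad_path]
    simp [hm]
  rw [h3] at h2
  refine h2.congr fun n => ?_
  rw [regularizer_eq e z (by positivity), Function.comp_apply, one_div]

lemma norm_dualWave {q : ℝ} (hq : 1 < q) (u : ℝ × 𝔼 → ℂ) (z : ℝ × 𝔼) :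
    ‖dualWave q u z‖ = ‖u z‖ ^ (q - 1) := by
  rw [dualWave, norm_mul, RCLike.norm_conj, Complex.norm_real, Real.norm_of_nonneg (by positivity)]
  rcases (norm_nonneg (u z)).eq_or_lt with h | h
  · rw [← h, mul_zero, Real.zero_rpow (by linarith)]
  · rw [← Real.rpow_add_one h.ne']; congr 1; ring

/-- The half-wave identity tested on the dual wave of an `𝔉`-function. -/
lemma exists_integral_dualWave (hd : 2 ≤ d) {q : ℝ} (hq : q * ((d : ℝ) - 1) / 2 = d + 1)
    {e : ℝ × 𝔼} (he : ‖e.2‖ < e.1) (z₀ : ℝ × 𝔼) (c : ℂ) {F₀ : 𝔼 → ℂ} {u₀ : ℝ × 𝔼 → ℂ}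
    (h₀ : IsAdmissible 2 q F₀ u₀)
    (hne : ∫ ξ, F₀ ξ * (starRingEnd ℂ) (Complex.exp (expo e z₀ ξ)) ≠ 0) :
    ∃ D : ℂ, ∀ (G : 𝔼 → ℂ) (v : ℝ × 𝔼 → ℂ), IsAdmissible 2 q G v →
      ∫ z, v z * dualWave q (foschiWave e z₀ c) z =
        D * ∫ ξ, G ξ * (starRingEnd ℂ) (Complex.exp (expo e z₀ ξ)) := by
  have : Nontrivial 𝔼 := Module.nontrivial_of_finrank_pos (R := ℝ) (by
    rw [finrank_euclideanSpace_fin]; omega)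
  have hd2 : (2:ℝ) ≤ d := by exact_mod_cast hd
  have hq1 : 1 < q := by
    by_contra! h
    nlinarith
  have hN : (d : ℝ) < q * ((d : ℝ) - 1) / 2 := by rw [hq]; linarith
  obtain ⟨w, hw⟩ := dualWave_eq hd hq he z₀ c
  obtain ⟨L, hL, hLz⟩ := exists_norm_quad_reference_le_add z₀
  obtain ⟨K, hK, -, -, hKz⟩ := exists_norm_inv_quad_le he
  obtain ⟨Kr, hKr, hr⟩ := exists_norm_regularizer_le he
  set S := ∫ η in lightCone 𝔼, Real.exp (-minkowski e η) with hS
  have hS0 : 0 ≤ S := integral_nonneg fun η => by positivity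
  have hsz := continuous_szego he
  -- The regulariser adds `d` inverse powers of a `quad`, turning `quad⁻¹` into a `hardyKernel` with
  -- decay `d + 1`. This is integrable and still holomorphic in the forward tube.
  set φ : ℕ → ℝ × 𝔼 → ℂ := fun n z =>
    dualWave q (foschiWave e z₀ c) z * regularizer e ((n : ℝ) + 1) (z + z₀) with hφ
  have hae : ∀ n : ℕ, ‖(((n : ℝ) + 1) • e).2‖ < (((n : ℝ) + 1) • e).1 := by
    intro n
    have hn : (0:ℝ) < (n : ℝ) + 1 := by positivity
    rw [Prod.smul_fst, Prod.smul_snd, norm_smul, Real.norm_of_nonneg hn.le, smul_eq_mul]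
    gcongr
  have hφe : ∀ n z, φ n z = w * ((((n : ℝ) + 1) ^ 2 * mass e : ℝ) : ℂ) ^ d *
      (hardyKernel d e (((n : ℝ) + 1) • e) (z + z₀) * (starRingEnd ℂ) (szego e (z + z₀))) := by
    intro n z
    simp only [hφ, hw, regularizer, hardyKernel]
    rw [div_pow, mul_inv]
    ring
  have hφc : ∀ n, Continuous (φ n) := by
    intro n
    have h1 := continuous_hardyKernel d he (hae n)
    rw [funext (hφe n)]
    exact continuous_const.mul ((h1.comp (continuous_add_const z₀)).mul
      (Complex.continuous_conj.comp (hsz.comp (continuous_add_const z₀))))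
  have hφb : ∀ n, ∃ B : ℝ, ∀ z, ‖φ n z‖ ≤ B * ‖quad ((1, 0) : ℝ × 𝔼) z‖ ^ (-((d : ℝ) + 1)) := by
    intro n
    obtain ⟨K', hK', -, -, hKz'⟩ := exists_norm_inv_quad_le (hae n)
    set Km := max K K'
    have hKm : 0 < Km := lt_max_of_lt_left hK
    refine ⟨‖w * ((((n : ℝ) + 1) ^ 2 * mass e : ℝ) : ℂ) ^ d‖ *
      (Km ^ (d + 1) * L ^ ((d : ℝ) + 1) * S), fun z => ?_⟩
    have h1 := norm_hardyKernel_le (k := d) (z := z + z₀) hKm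
      ((hKz _).trans (by gcongr; exact le_max_left _ _))
      ((hKz' _).trans (by gcongr; exact le_max_right _ _))
    have h2 := rpow_neg_le_of_le_mul (N := (d : ℝ) + 1) (by positivity)
      (one_le_norm_quad_reference z) hL (hLz z)
    have h3 := norm_szego_le e (z + z₀) he
    rw [hφe, norm_mul, mul_assoc]
    refine mul_le_mul_of_nonneg_left ?_ (norm_nonneg _)
    rw [norm_mul, RCLike.norm_conj]
    calc _ ≤ (Km ^ (d + 1) * (L ^ ((d : ℝ) + 1) *
          ‖quad ((1, 0) : ℝ × 𝔼) z‖ ^ (-((d : ℝ) + 1)))) * S := by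
          refine mul_le_mul (h1.trans ?_) h3 (norm_nonneg _) (by positivity)
          gcongr
      _ = _ := by ring
  have hφh : ∀ n, ∃ D : ℂ, ∀ ξ, ∫ z, Complex.exp (Complex.I * (phase z ξ : ℝ)) * φ n z =
      D * (starRingEnd ℂ) (Complex.exp (expo e z₀ ξ)) := by
    intro n
    have h1 := fun ξ : 𝔼 => integral_hardyKernel_mul_szego (by rwa [finrank_euclideanSpace_fin])
      (k := d) (by rw [finrank_euclideanSpace_fin]) he he (hae n) ξ
    refine ⟨w * ((((n : ℝ) + 1) ^ 2 * mass e : ℝ) : ℂ) ^ d * ∫ η in lightCone 𝔼,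
      (Real.exp (-minkowski e η) : ℂ) * hardyFourier d e (((n : ℝ) + 1) • e) η, fun ξ => ?_⟩
    have h2 : (starRingEnd ℂ) (Complex.exp (expo e z₀ ξ)) =
        (Real.exp (-rho e ξ) : ℂ) * Complex.exp (-Complex.I * (phase z₀ ξ : ℝ)) := by
      rw [← Complex.exp_conj, Complex.ofReal_exp, ← Complex.exp_add]
      congr 1
      simp [expo]
    have h3 : ∀ z, Complex.exp (Complex.I * (phase z ξ : ℝ)) * φ n z =
        (w * ((((n : ℝ) + 1) ^ 2 * mass e : ℝ) : ℂ) ^ d *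
          Complex.exp (-Complex.I * (phase z₀ ξ : ℝ))) *
        (Complex.exp (Complex.I * (phase (z + z₀) ξ : ℝ)) *
      (hardyKernel d e (((n : ℝ) + 1) • e) (z + z₀) * (starRingEnd ℂ) (szego e (z + z₀)))) := by
      intro z
      have h4 : Complex.exp (Complex.I * (phase z ξ : ℝ)) =
          Complex.exp (-Complex.I * (phase z₀ ξ : ℝ)) *
            Complex.exp (Complex.I * (phase (z + z₀) ξ : ℝ)) := by
        rw [← Complex.exp_add, phase_add]; push_cast; congr 1; ring
      rw [hφe, h4]; ring
    simp only [h3]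
    rw [integral_const_mul, integral_add_right_eq_self (fun z =>
      Complex.exp (Complex.I * (phase z ξ : ℝ)) *
      (hardyKernel d e (((n : ℝ) + 1) • e) z * (starRingEnd ℂ) (szego e z))) z₀, h1, h2]
    ring
  choose D hD using hφh
  have hpair : ∀ n (G : 𝔼 → ℂ) (v : ℝ × 𝔼 → ℂ), IsAdmissible 2 q G v → ∫ z, v z * φ n z =
      ((((2 * Real.pi) ^ d)⁻¹ : ℝ) * D n) *
        ∫ ξ, G ξ * (starRingEnd ℂ) (Complex.exp (expo e z₀ ξ)) := by
    intro n G v h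
    obtain ⟨B, hB⟩ := hφb n
    obtain ⟨C, hC⟩ := exists_exp_neg_rho_mul_le he (d + 1)
    have hec := continuous_expo e z₀
    rw [h.integral_mul hd hq1 hN (M := (d : ℝ) + 1) (by nlinarith) (by linarith) (hφc n) hB
      (H := fun ξ => D n * (starRingEnd ℂ) (Complex.exp (expo e z₀ ξ)))
      (continuous_const.mul (Complex.continuous_conj.comp (by fun_prop))) (hD n)
      (C := ‖D n‖ * C) (fun ξ => ?_), mul_assoc, ← integral_const_mul (D n)]
    · congr 2; ext ξ; ring
    · rw [norm_mul, RCLike.norm_conj, norm_exp_expo, mul_assoc]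
      exact mul_le_mul_of_nonneg_left (hC ξ) (norm_nonneg _)
  have hlim : ∀ (G : 𝔼 → ℂ) (v : ℝ × 𝔼 → ℂ), IsAdmissible 2 q G v →
      Filter.Tendsto (fun n => ∫ z, v z * φ n z) Filter.atTop
        (nhds (∫ z, v z * dualWave q (foschiWave e z₀ c) z)) := by
    intro G v h
    obtain ⟨κ, hκ0, hκ⟩ := norm_foschiWave hd he z₀ c
    set M := (q - 1) * ((d : ℝ) - 1) / 2 with hM
    have hM0 : 0 ≤ M := by
      have : 0 ≤ (q - 1) * ((d : ℝ) - 1) := mul_nonneg (by linarith) (by linarith)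
      linarith
    have hvq := integrable_wave_mul_quad hd hq1 hN le_rfl h.memLp_wave
    have hvm := h.memLp_wave.1
    have hdb : ∀ z, ‖dualWave q (foschiWave e z₀ c) z‖ ≤
        κ ^ (q - 1) * (L * K) ^ M * ‖quad ((1, 0) : ℝ × 𝔼) z‖ ^ (-M) := by
      intro z
      rw [norm_dualWave hq1, hκ, Real.mul_rpow hκ0.le (by positivity),
        ← Real.rpow_mul (norm_nonneg _), mul_assoc]
      refine mul_le_mul_of_nonneg_left ?_ (by positivity)
      have h1 := rpow_neg_le_of_le_mul (R' := ‖quad e (z + z₀)‖) (K := L * K) hM0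
        (one_le_norm_quad_reference z) (by positivity) ((hLz z).trans (by
          rw [mul_assoc]; exact mul_le_mul_of_nonneg_left (hKz _) hL.le))
      have h5 : -(((d : ℝ) - 1) / 2) * (q - 1) = -M := by rw [hM]; ring
      rw [h5]; exact h1
    have hwm : Continuous (dualWave q (foschiWave e z₀ c)) := by
      rw [funext hw]
      have h1 := continuous_quad e
      exact continuous_const.mul (((h1.comp (continuous_add_const z₀)).inv₀ fun z =>
        quad_ne_zero he _).mul (Complex.continuous_conj.comp (hsz.comp (continuous_add_const z₀))))
    refine tendsto_integral_of_dominated_convergence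
      (fun z => (κ ^ (q - 1) * (L * K) ^ M * Kr) *
        (‖v z‖ * ‖quad ((1, 0) : ℝ × 𝔼) z‖ ^ (-M)))
      (fun n => hvm.mul (hφc n).aestronglyMeasurable) (hvq.const_mul _)
      (fun n => Filter.Eventually.of_forall fun z => ?_) (Filter.Eventually.of_forall fun z => ?_)
    · rw [norm_mul, hφ, norm_mul]
      have h1 := mul_le_mul (hdb z) (hr ((n : ℝ) + 1) (by positivity) (z + z₀)) (norm_nonneg _)
        (by positivity)
      calc _ ≤ ‖v z‖ * (κ ^ (q - 1) * (L * K) ^ M * ‖quad ((1, 0) : ℝ × 𝔼) z‖ ^ (-M) * Kr) :=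
            mul_le_mul_of_nonneg_left h1 (norm_nonneg _)
        _ = _ := by ring
    · have h1 := (tendsto_regularizer he (z + z₀)).const_mul
        (dualWave q (foschiWave e z₀ c) z)
      rw [mul_one] at h1
      exact h1.const_mul (v z)
  -- The limit of the constants `D n` is not computed: it is read off from the single pair `(F₀,
  -- u₀)`, whose frequency pairing is nonzero by `hne`.
  have hDlim : Filter.Tendsto (fun n => (((((2 * Real.pi) ^ d)⁻¹ : ℝ) : ℂ) * D n)) Filter.atTop
      (nhds ((∫ z, u₀ z * dualWave q (foschiWave e z₀ c) z) /
        ∫ ξ, F₀ ξ * (starRingEnd ℂ) (Complex.exp (expo e z₀ ξ)))) := by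
    refine ((hlim F₀ u₀ h₀).div_const _).congr fun n => ?_
    rw [hpair n F₀ u₀ h₀, mul_div_cancel_right₀ _ hne]
  refine ⟨(∫ z, u₀ z * dualWave q (foschiWave e z₀ c) z) /
    ∫ ξ, F₀ ξ * (starRingEnd ℂ) (Complex.exp (expo e z₀ ξ)),
    fun G v h => tendsto_nhds_unique (hlim G v h) ?_⟩
  refine (hDlim.mul_const _).congr fun n => ?_
  rw [hpair n G v h]

/-- `𝔉`-functions are critical points for `p = 2`. -/
theorem isCriticalPoint_two (hd : 2 ≤ d) {q : ℝ} (hq : q * ((d : ℝ) - 1) / 2 = d + 1)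
    {F : 𝔼 → ℂ} (hF : IsFoschian F) : IsCriticalPoint 2 q F := by
  have : Nontrivial 𝔼 := Module.nontrivial_of_finrank_pos (R := ℝ) (by
    rw [finrank_euclideanSpace_fin]; omega)
  have hd2 : (2:ℝ) ≤ d := by exact_mod_cast hd
  have hq0 : 0 < q := by
    by_contra! h
    nlinarith
  obtain ⟨e, z₀, c, he, hFe⟩ := hF.exists_expo
  have hadm := isAdmissible_foschiWave hd one_lt_two hq0 (by rw [hq]; linarith) he z₀ c hFe
  have he2 : ‖((2 : ℝ) • e).2‖ < ((2 : ℝ) • e).1 := by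
    rw [Prod.smul_fst, Prod.smul_snd, norm_smul, smul_eq_mul, Real.norm_two]
    linarith
  have hJ := integral_inv_mul_exp_neg_rho_pos (E := 𝔼) (by rwa [finrank_euclideanSpace_fin]) he2
  set J := ∫ ξ : 𝔼, ‖ξ‖⁻¹ * Real.exp (-rho ((2 : ℝ) • e) ξ) with hJd
  have hX : ∫ ξ, F ξ * (starRingEnd ℂ) (Complex.exp (expo e z₀ ξ)) = Complex.exp c * J := by
    rw [hJd, ← integral_complex_ofReal, ← integral_const_mul]
    refine integral_congr_ae ?_
    filter_upwards [hFe] with ξ hξ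
    have h1 := Complex.mul_conj' (Complex.exp (expo e z₀ ξ))
    have h2 : ‖Complex.exp (expo e z₀ ξ)‖ ^ 2 = Real.exp (-rho ((2 : ℝ) • e) ξ) := by
      rw [norm_exp_expo, ← Real.exp_nat_mul, rho_smul_left]; congr 1; push_cast; ring
    rw [hξ, Complex.exp_add, ← h2]
    push_cast
    linear_combination (‖ξ‖ : ℂ)⁻¹ * Complex.exp c * h1
  have hJc : (J : ℂ) ≠ 0 := by exact_mod_cast hJ.ne'
  have hne : ∫ ξ, F ξ * (starRingEnd ℂ) (Complex.exp (expo e z₀ ξ)) ≠ 0 := by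
    rw [hX]; exact mul_ne_zero (Complex.exp_ne_zero c) hJc
  obtain ⟨D, hD⟩ := exists_integral_dualWave hd hq he z₀ c hadm hne
  set u := foschiWave e z₀ c with hu
  set I := ∫ z, ‖u z‖ ^ q with hI
  have hself : (I : ℂ) = D * (Complex.exp c * J) := by
    rw [← hX, ← hD F u hadm, hI, ← integral_complex_ofReal]
    congr 1; ext z
    rw [dualWave, ← norm_rpow_sub_two_mul hq0]; ring
  have hcc : Complex.exp c * (starRingEnd ℂ) (Complex.exp c) = ((‖Complex.exp c‖ ^ 2 : ℝ) : ℂ) := by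
    rw [Complex.mul_conj']; push_cast; rfl
  have hcn : 0 < ‖Complex.exp c‖ ^ 2 := by
    have := norm_pos_iff.2 (Complex.exp_ne_zero c); positivity
  have hcn' : ((‖Complex.exp c‖ ^ 2 : ℝ) : ℂ) ≠ 0 := by exact_mod_cast hcn.ne'
  -- The multiplier is fixed by testing on `F` itself: `I` is the `q`-th power of the wave norm and
  -- `J * ‖exp c‖ ^ 2` is the square of the frequency norm. It is real, as required.
  refine ⟨u, hadm, I / (J * ‖Complex.exp c‖ ^ 2), fun G v hGv => ?_⟩
  have hDlam : D = ((I / (J * ‖Complex.exp c‖ ^ 2) : ℝ) : ℂ) * (starRingEnd ℂ) (Complex.exp c) := by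
    rw [Complex.ofReal_div, Complex.ofReal_mul, div_mul_eq_mul_div, eq_div_iff (mul_ne_zero hJc hcn'),
      ← hcc, hself]
    ring
  have hleft : ∫ z, ((‖u z‖ ^ (q - 2) : ℝ) : ℂ) * (starRingEnd ℂ) (u z) * v z =
      D * ∫ ξ, G ξ * (starRingEnd ℂ) (Complex.exp (expo e z₀ ξ)) := by
    rw [← hD G v hGv]
    congr 1; ext z
    rw [dualWave, mul_comm]
  -- For `p = 2` the weight `‖ξ‖` cancels the `‖ξ‖⁻¹` in `F`, leaving a pure exponential.
  have hright : ∫ ξ, ((‖F ξ‖ ^ ((2 : ℝ) - 2) : ℝ) : ℂ) * (starRingEnd ℂ) (F ξ) * G ξ *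
      ((‖ξ‖ ^ ((2 : ℝ) - 1) : ℝ) : ℂ) = (starRingEnd ℂ) (Complex.exp c) *
        ∫ ξ, G ξ * (starRingEnd ℂ) (Complex.exp (expo e z₀ ξ)) := by
    rw [← integral_const_mul]
    refine integral_congr_ae ?_
    filter_upwards [hFe, Measure.ae_ne volume (0:𝔼)] with ξ hξ h0
    have hn : (‖ξ‖ : ℂ) ≠ 0 := by simpa using h0
    rw [sub_self, Real.rpow_zero, show (2:ℝ) - 1 = 1 by norm_num, Real.rpow_one, hξ,
      Complex.exp_add]
    simp only [map_mul, map_inv₀, Complex.conj_ofReal, Complex.ofReal_one]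
    field_simp
  unfold EulerLagrange
  rw [hleft, hright, hDlam, mul_assoc, Complex.re_ofReal_mul]

end Critical

end ConeExtension

/-! ### Conclusion: arithmetic of the exponents. -/

theorem theorem2 (d : ℕ) (hd : 2 ≤ d) (p q : ℝ) (hp1 : 1 < p)
    (hp2 : p < 2 * (d : ℝ) / ((d : ℝ) - 1))
    (hq : q = ((d : ℝ) + 1) / ((d : ℝ) - 1) * (p / (p - 1)))
    (F : EuclideanSpace ℝ (Fin d) → ℂ) (hF : ConeExtension.IsFoschian F) :
    (∃ u, ConeExtension.IsAdmissible p q F u) ∧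
      (ConeExtension.IsCriticalPoint p q F ↔ p = 2) := by
  have hd2 : (2:ℝ) ≤ d := by exact_mod_cast hd
  have hd1 : (0:ℝ) < (d:ℝ) - 1 := by linarith
  have hp0 : 0 < p - 1 := by linarith
  have hN : q * ((d : ℝ) - 1) / 2 = (d + 1) * p / (2 * (p - 1)) := by
    rw [hq]; field_simp
  have hpq : q * ((d : ℝ) - 1) * (p - 1) = (d + 1) * p := by
    rw [hq]; field_simp
  -- The integrability threshold `N > d` is equivalent to `p < 2d/(d-1)`.
  have hNd : (d : ℝ) < q * ((d : ℝ) - 1) / 2 := by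
    rw [hN, lt_div_iff₀ (by positivity)]
    rw [lt_div_iff₀ hd1] at hp2
    linarith
  have hq1 : 1 ≤ q := by
    by_contra! h
    nlinarith
  have hq0 : 0 < q := by linarith
  refine ⟨?_, fun h => ?_, fun h => ?_⟩
  · obtain ⟨e, z₀, c, he, hFe⟩ := hF.exists_expo
    exact ⟨_, ConeExtension.isAdmissible_foschiWave hd hp1 hq0 hNd he z₀ c hFe⟩
  · have h1 := ConeExtension.exponent_of_isCriticalPoint hd hp1 hq1 hNd hpq hF h
    rw [hN, div_eq_iff (by positivity)] at h1
    have h2 : ((d : ℝ) + 1) * (p - 2) = 0 := by linear_combination -h1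
    have h3 := (mul_eq_zero.1 h2).resolve_left (by positivity)
    linarith
  · subst h
    refine ConeExtension.isCriticalPoint_two hd ?_ hF
    rw [hN]; norm_num
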